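/- Let $G=(G_t)_{t\ge 0}$ be a centered Gaussian process with continuous paths and continuous covariance function $R(t,s)=E[G_tG_s]$. Suppose that there are constants $\beta\in(\tfrac12,1)$, $C_\beta>0$, $C'_\beta\ge 0$ and a function $\Psi$ such that $R(0,t)=0$ for all $t\ge 0$ and, for all $t,s>0$ with $t\ne s$, $$\frac{\partial^2 R}{\partial t\,\partial s}(t,s)=C_\beta|t-s|^{2\beta-2}+\Psi(t,s),\qquad |\Psi(t,s)|\le C'_\beta\,|ts|^{\beta-1},$$ and suppose that for each $s>0$ the function $t\mapsto\frac{\partial R}{\partial s}(t,s)$, $t\ne s$, has no jump at $t=s$ (it has a finite limit as $t\to s$, $t\neq s$). Let $k>0$, $\mu\in\mathbb R$, and let $X$ be the continuous solution of $$dX_t=k(\mu-X_t)\,dt+dG_t,\qquad X_0=0 .$$ Put $$\hat\mu=\frac1T\int_0^T X_t\,dt,\qquad \hat k=\left[\frac{\frac1T\int_0^TX_t^2\,dt-\left(\frac1T\int_0^TX_t\,dt\right)^2}{C_\beta\,\Gamma(2\beta-1)}\right]^{-\frac1{2\beta}},$$ $$\hat k_{LS}=\frac{X_T\int_0^TX_t\,dt-T\int_0^TX_t\,dX_t}{T\int_0^TX_t^2\,dt-\left(\int_0^TX_t\,dt\right)^2},\qquad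 \hat\mu_{LS}=\frac{X_T\int_0^TX_t^2\,dt-\int_0^TX_t\,dX_t\int_0^TX_t\,dt}{X_T\int_0^TX_t\,dt-T\int_0^TX_t\,dX_t},$$ where $\int_0^TX_t\,dX_t=\int_0^TX_t\,k(\mu-X_t)\,dt+\int_0^TX_t\,\delta G_t$ and $\int_0^TX_t\,\delta G_t$ is the Skorohod integral, that is, the adjoint of the Malliavin derivative with respect to $(G_t)_{t\in[0,T]}$ applied to $X\mathbf 1_{[0,T]}$. Then $\hat\mu\to\mu$ and $\hat k\to k$ almost surely as $T\to\infty$. Moreover, the Skorohod integrals $\int_0^TX_t\,\delta G_t$, $T\ge 0$, exist and have a version that is continuous in $T$, and with any such continuous version $\hat\mu_{LS}\to\mu$ and $\hat k_{LS}\to k$ almost surely as $T\to\infty$. -/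

import Mathlib

open MeasureTheory ProbabilityTheory Filter Set
open scoped Topology

namespace Vasicek

noncomputable section

/- Processes indexed by `[0, ∞)` are written as functions `ℝ → Ω → ℝ` of which only the values at
times `t ≥ 0` matter. -/

/-- The covariance function `R(t, s) = E[G_t G_s]` of a centered process. -/
def covFun {Ω : Type*} [MeasurableSpace Ω] (P : Measure Ω) (G : ℝ → Ω → ℝ) (t s : ℝ) : ℝ :=
  ∫ ω, G t ω * G s ω ∂P

/-- `(G_t)_{t ≥ 0}` is a centered Gaussian process with (almost surely) continuous paths and
continuous covariance function. -/
structure IsContCenteredGaussian {Ω : Type*} [MeasurableSpace Ω] (P : Measure Ω)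
    (G : ℝ → Ω → ℝ) : Prop where
  measurable : ∀ t, 0 ≤ t → Measurable (G t)
  gaussian : IsGaussianProcess (fun t : Ici (0 : ℝ) => G t) P
  centered : ∀ t, 0 ≤ t → ∫ ω, G t ω ∂P = 0
  continuous_paths : ∀ᵐ ω ∂P, ContinuousOn (fun t => G t ω) (Ici 0)
  continuous_cov : ContinuousOn (fun p : ℝ × ℝ => covFun P G p.1 p.2) (Ici 0 ×ˢ Ici 0)

/-- The assumption on the covariance function: off the diagonal,
`∂²R/∂t∂s (t, s) = C |t - s|^(2β - 2) + Ψ(t, s)` with `|Ψ(t, s)| ≤ C' |t s|^(β - 1)`,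
and `R(0, t) = 0`. The first partial derivative `∂R/∂s (·, s)` does not jump across the diagonal
(otherwise the derivative off the diagonal would not see a singular part of the covariance measure
on the diagonal, such as that of `min t s`, and would not determine `R`). -/
structure CovAssumption (R : ℝ → ℝ → ℝ) (β C C' : ℝ) (Ψ : ℝ → ℝ → ℝ) : Prop where
  half_lt : 1 / 2 < β
  lt_one : β < 1
  C_pos : 0 < C
  C'_nonneg : 0 ≤ C'
  differentiable : ∀ t s, 0 < t → 0 < s → t ≠ s → DifferentiableAt ℝ (fun v => R t v) s
  mixed_deriv : ∀ t s, 0 < t → 0 < s → t ≠ s →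
    HasDerivAt (fun u => deriv (fun v => R u v) s) (C * |t - s| ^ (2 * β - 2) + Ψ t s) t
  no_jump : ∀ s, 0 < s → ∃ l : ℝ, Tendsto (fun u => deriv (fun v => R u v) s) (𝓝[≠] s) (𝓝 l)
  bound : ∀ t s, 0 < t → 0 < s → t ≠ s → |Ψ t s| ≤ C' * |t * s| ^ (β - 1)
  zero_left : ∀ t, 0 ≤ t → R 0 t = 0

/-- `X` is a continuous solution of `dX_t = k (μ - X_t) dt + dG_t`, `X_0 = 0`. -/
def IsVasicekSolution {Ω : Type*} [MeasurableSpace Ω] (P : Measure Ω) (G : ℝ → Ω → ℝ) (k μ : ℝ)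
    (X : ℝ → Ω → ℝ) : Prop :=
  ∀ᵐ ω ∂P, ContinuousOn (fun t => X t ω) (Ici 0) ∧ X 0 ω = 0 ∧
    ∀ t, 0 ≤ t → X t ω = (∫ s in (0 : ℝ)..t, k * (μ - X s ω)) + (G t ω - G 0 ω)

/-! ### The Skorohod integral

The Hilbert space `𝔥` associated with `G` is the completion of the step functions for
`⟪1_[a,b), 1_[c,d)⟫ = E[(G_b - G_a)(G_d - G_c)]`. It is realised inside `L²(P)` by the isometry
`1_[a,b) ↦ G_b - G_a`. -/

open Classical in
/-- The element `1_[a,b)` of `𝔥`, that is, the class of `G_b - G_a` in `L²(P)`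
(which is square integrable when `G` is Gaussian). -/
def indH {Ω : Type*} [MeasurableSpace Ω] (P : Measure Ω) (G : ℝ → Ω → ℝ) (a b : ℝ) : Lp ℝ 2 P :=
  if h : MemLp (fun ω => G b ω - G a ω) 2 P then h.toLp _ else 0

/-- The step function `∑_{i < n} φ(iT/n) 1_[iT/n, (i+1)T/n)` as an element of `𝔥`. -/
def stepH {Ω : Type*} [MeasurableSpace Ω] (P : Measure Ω) (G : ℝ → Ω → ℝ) (T : ℝ) (φ : ℝ → ℝ)
    (n : ℕ) : Lp ℝ 2 P :=
  ∑ i ∈ Finset.range n, φ (i * T / n) • indH P G (i * T / n) ((i + 1) * T / n)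

/-- The function `φ`, continuous on `[0, T]`, extended by `0`, is the element `h` of `𝔥`:
`h` is the limit in `𝔥` of the step functions that approximate `φ` uniformly. -/
def RepresentsH {Ω : Type*} [MeasurableSpace Ω] (P : Measure Ω) (G : ℝ → Ω → ℝ) (T : ℝ)
    (φ : ℝ → ℝ) (h : Lp ℝ 2 P) : Prop :=
  Tendsto (stepH P G T φ) atTop (𝓝 h)

/-- Functions `f` on `ℝᵐ` that are smooth and bounded together with all their derivatives. -/
def IsCbSmooth {m : ℕ} (f : (Fin m → ℝ) → ℝ) : Prop :=
  ContDiff ℝ ((⊤ : ℕ∞) : WithTop ℕ∞) f ∧ ∀ j : ℕ, ∃ B : ℝ, ∀ x, ‖iteratedFDeriv ℝ j f x‖ ≤ B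

/-- The smooth random variable `F = f(G_{t_1}, …, G_{t_m})`. -/
def smoothRV {Ω : Type*} (G : ℝ → Ω → ℝ) {m : ℕ} (f : (Fin m → ℝ) → ℝ) (t : Fin m → ℝ)
    (ω : Ω) : ℝ :=
  f (fun i => G (t i) ω)

/-- The Malliavin derivative `DF = ∑ᵢ ∂ᵢf(G_{t_1}, …, G_{t_m}) 1_[0, t_i)` of
`F = f(G_{t_1}, …, G_{t_m})`. -/
def malliavinD {Ω : Type*} [MeasurableSpace Ω] (P : Measure Ω) (G : ℝ → Ω → ℝ) {m : ℕ}
    (f : (Fin m → ℝ) → ℝ) (t : Fin m → ℝ) (ω : Ω) : Lp ℝ 2 P :=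
  ∑ i, (fderiv ℝ f (fun j => G (t j) ω) (Pi.single i 1)) • indH P G 0 (t i)

/-- The σ-algebra generated by `G_s`, `0 ≤ s ≤ T`. -/
@[reducible] def sigmaG {Ω : Type*} (G : ℝ → Ω → ℝ) (T : ℝ) : MeasurableSpace Ω :=
  ⨆ s ∈ Icc 0 T, MeasurableSpace.comap (G s) inferInstance

/-- `Y` is the Skorohod integral `∫_0^T X_t δG_t`: the process `X 1_[0,T]` is an element `u` of
`L²(Ω; 𝔥)`, and `Y` is the square integrable functional of `(G_s)_{s ≤ T}` given by the
adjoint of the Malliavin derivative, `E[F Y] = E[⟪DF, u⟫]` for all smooth random variables `F`. -/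
def IsSkorohodIntegral {Ω : Type*} [MeasurableSpace Ω] (P : Measure Ω) (G : ℝ → Ω → ℝ) (T : ℝ)
    (X : ℝ → Ω → ℝ) (Y : Ω → ℝ) : Prop :=
  MemLp Y 2 P ∧ AEStronglyMeasurable[sigmaG G T] Y P ∧
  ∃ u : Ω → Lp ℝ 2 P, MemLp u 2 P ∧
    (∀ᵐ ω ∂P, RepresentsH P G T (fun t => X t ω) (u ω)) ∧
    ∀ (m : ℕ) (f : (Fin m → ℝ) → ℝ) (t : Fin m → ℝ), IsCbSmooth f → (∀ i, t i ∈ Icc 0 T) →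
      ∫ ω, smoothRV G f t ω * Y ω ∂P = ∫ ω, inner ℝ (malliavinD P G f t ω) (u ω) ∂P

/-- `S` is a continuous version of the process `T ↦ ∫_0^T X_t δG_t`, `T ≥ 0`. (The integral is
defined up to a null set for each `T`; a continuous version is unique up to indistinguishability.) -/
def IsSkorohodProcess {Ω : Type*} [MeasurableSpace Ω] (P : Measure Ω) (G : ℝ → Ω → ℝ)
    (X : ℝ → Ω → ℝ) (S : ℝ → Ω → ℝ) : Prop :=
  (∀ T, 0 ≤ T → IsSkorohodIntegral P G T X (S T)) ∧
    ∀ᵐ ω ∂P, ContinuousOn (fun T => S T ω) (Ici 0)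

/-! ### The estimators

Here `x` is the observed path, `J T` stands for `∫_0^T X_t dX_t`. -/

/-- `∫_0^T X_t dX_t = ∫_0^T X_t k (μ - X_t) dt + ∫_0^T X_t δG_t`, where `z T` is the value of
the last integral. -/
def intXdX (k μ : ℝ) (x z : ℝ → ℝ) (T : ℝ) : ℝ :=
  (∫ t in (0 : ℝ)..T, x t * (k * (μ - x t))) + z T

/-- The sample mean estimator of `μ`. -/
def muHat (x : ℝ → ℝ) (T : ℝ) : ℝ := 1 / T * ∫ t in (0 : ℝ)..T, x t

/-- The second moment estimator of `k`. -/
def kHat (β C : ℝ) (x : ℝ → ℝ) (T : ℝ) : ℝ :=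
  ((1 / T * (∫ t in (0 : ℝ)..T, x t ^ 2) - (1 / T * ∫ t in (0 : ℝ)..T, x t) ^ 2) /
    (C * Real.Gamma (2 * β - 1))) ^ (-(1 / (2 * β)))

/-- The least squares estimator of `k`. -/
def kHatLS (x J : ℝ → ℝ) (T : ℝ) : ℝ :=
  (x T * (∫ t in (0 : ℝ)..T, x t) - T * J T) /
    (T * (∫ t in (0 : ℝ)..T, x t ^ 2) - (∫ t in (0 : ℝ)..T, x t) ^ 2)

/-- The least squares estimator of `μ`. -/
def muHatLS (x J : ℝ → ℝ) (T : ℝ) : ℝ :=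
  (x T * (∫ t in (0 : ℝ)..T, x t ^ 2) - J T * ∫ t in (0 : ℝ)..T, x t) /
    (x T * (∫ t in (0 : ℝ)..T, x t) - T * J T)

end

end Vasicek

set_option linter.unusedSectionVars false

namespace Vasicek

/-! Reduction to one Gaussian process. After a modification `g` of G with g_0 = 0 and all paths
continuous, variation of constants gives X_t = m(t) + Z_t with m(t) = μ(1 - e^{-kt}) and Z_t = ∫_0^t
e^{-k(t-s)} dg_s, a pathwise integral defined by parts (`ou`). The covariance of increments of `g`
over a rectangle is the integral of the kernel K = ∂²R/∂t∂s over it (`rectangle_increment`): the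
absence of a jump excludes a singular part on the diagonal, and R(0,·) = 0 fixes the constant of
integration.

Moment estimates. Since K differs from C|u-v|^{2β-2} by at most C'|uv|^{β-1}, one gets E(g_t-g_s)² ≤
c|t-s|^{2β}. The variance of Z_t tends to σ = C Γ(2β-1) k^{-2β}: the first part of K gives an
explicit Gamma integral, and the remainder is at most C' times the square of ∫_0^t e^{-k(t-u)}
u^{β-1} du, which vanishes in the limit. Exponential smoothing costs a factor k^{-2}, so the
covariance ρ of Z has ∫∫_{[0,T]²}|ρ| = O(T^{2β}). By Isserlis' formula the covariance of Z_t² and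
Z_s² is 2ρ(t,s)², so both ∫_0^T Z and ∫_0^T (Z²-EZ²) have second moment O(T^{2β}), which is o(T²)
because β < 1.

Almost sure limits. Along T = n^p with p(2-2β) ≥ 2 the second moments of the averages are summable;
monotonicity of ∫Z² and ∫(Z+1)² fills the gaps (`tendsto_time_average`). Hence the averages of X and
X² tend to μ and μ²+σ, which settles the moment estimators. A chaining bound on unit blocks gives
X_T²/T → 0 (`tendsto_ou_sq_div_atTop`).

The Skorohod integral. As 2β > 1, quadratic variation vanishes, and the left Riemann sums of ∫X dg
are asymptotically Q_T = X_T²/2 - ∫_0^T X k(μ-X) dt. Gaussian integration by parts applied to these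
sums against a smooth F yields E⟨DF, X⟩ plus E[F] times the mean of the sum, since DX is
deterministic. Thus Q_T - E Q_T is the Skorohod integral (`integral_smooth_mul_pathIntegral`), and
density of smooth functionals makes it unique. Consequently ∫_0^T X dX = X_T²/2 - E Q_T, while E Q_T
/ T → kσ (`tendsto_integral_pathIntegral_div`). Dividing the least squares formulas by T² gives the
limits kσ/σ = k and kσμ/(kσ) = μ. -/

/-! ### Integrals of the singular kernels |u-v|^{2β-2} and |uv|^{β-1} -/

lemma intervalIntegrable_abs_rpow {p : ℝ} (hp : -1 < p) (a b : ℝ) :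
    IntervalIntegrable (fun x : ℝ => |x| ^ p) volume a b := by
  have h1 : ∀ b : ℝ, 0 ≤ b → IntervalIntegrable (fun x : ℝ => |x| ^ p) volume 0 b := by
    intro b hb
    refine (intervalIntegral.intervalIntegrable_rpow' (a := 0) (b := b) hp).congr ?_
    intro x hx
    rw [uIoc_of_le hb] at hx
    simp only [abs_of_pos hx.1]
  have h2 : ∀ b : ℝ, IntervalIntegrable (fun x : ℝ => |x| ^ p) volume 0 b := by
    intro b
    rcases le_total 0 b with hb | hb
    · exact h1 b hb
    · have := (h1 (-b) (by linarith))
      rw [IntervalIntegrable.iff_comp_neg] at this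
      simpa using this
  exact (h2 a).symm.trans (h2 b)

lemma intervalIntegrable_abs_sub_rpow {p : ℝ} (hp : -1 < p) (v a b : ℝ) :
    IntervalIntegrable (fun x : ℝ => |x - v| ^ p) volume a b := by
  have := (intervalIntegrable_abs_rpow hp (a - v) (b - v)).comp_sub_right v
  simpa using this

/-- Splitting at the singularity v leaves two explicit integrals, each no larger than over the full
length; the result does not depend on where v lies. -/
lemma integral_abs_sub_rpow_le {p : ℝ} (hp : -1 < p) {a b v : ℝ} (hv : v ∈ Icc a b) :
    ∫ x in a..b, |x - v| ^ p ≤ 2 * (b - a) ^ (p + 1) / (p + 1) := by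
  have h1 : ∫ x in a..v, |x - v| ^ p = (v - a) ^ (p + 1) / (p + 1) := by
    have : ∫ x in a..v, |x - v| ^ p = ∫ x in a..v, (fun y => y ^ p) (v - x) := by
      refine intervalIntegral.integral_congr fun x hx => ?_
      rw [uIcc_of_le hv.1] at hx
      simp only
      rw [abs_sub_comm, abs_of_nonneg (by linarith [hx.2])]
    rw [this, intervalIntegral.integral_comp_sub_left (fun y => y ^ p), integral_rpow (Or.inl hp)]
    rw [sub_self, Real.zero_rpow (by linarith), sub_zero]
  have h2 : ∫ x in v..b, |x - v| ^ p = (b - v) ^ (p + 1) / (p + 1) := by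
    have : ∫ x in v..b, |x - v| ^ p = ∫ x in v..b, (fun y => y ^ p) (x - v) := by
      refine intervalIntegral.integral_congr fun x hx => ?_
      rw [uIcc_of_le hv.2] at hx
      simp only
      rw [abs_of_nonneg (by linarith [hx.1])]
    rw [this, intervalIntegral.integral_comp_sub_right (fun y => y ^ p), integral_rpow (Or.inl hp)]
    rw [sub_self, Real.zero_rpow (by linarith), sub_zero]
  rw [← intervalIntegral.integral_add_adjacent_intervals
    (intervalIntegrable_abs_sub_rpow hp v a v) (intervalIntegrable_abs_sub_rpow hp v v b), h1, h2,
    ← add_div]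
  have hp1 : 0 < p + 1 := by linarith
  have e1 : (v - a) ^ (p + 1) ≤ (b - a) ^ (p + 1) :=
    Real.rpow_le_rpow (by linarith [hv.1]) (by linarith [hv.2]) hp1.le
  have e2 : (b - v) ^ (p + 1) ≤ (b - a) ^ (p + 1) :=
    Real.rpow_le_rpow (by linarith [hv.2]) (by linarith [hv.1]) hp1.le
  gcongr
  linarith

/-- Subadditivity of x ↦ x^β for β ≤ 1 gives b^β - a^β ≤ (b-a)^β, so the estimate sees only the
length of the interval. -/
lemma integral_rpow_le {β : ℝ} (hβ : 0 < β) (hβ1 : β ≤ 1) {a b : ℝ} (ha : 0 ≤ a) (hab : a ≤ b) :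
    ∫ x in a..b, |x| ^ (β - 1) ≤ (b - a) ^ β / β := by
  have : ∫ x in a..b, |x| ^ (β - 1) = ∫ x in a..b, x ^ (β - 1) := by
    refine intervalIntegral.integral_congr fun x hx => ?_
    rw [uIcc_of_le hab] at hx
    rw [abs_of_nonneg (by linarith [hx.1])]
  rw [this, integral_rpow (Or.inl (by linarith)), sub_add_cancel]
  have := Real.rpow_add_le_add_rpow (sub_nonneg.2 hab) ha hβ.le hβ1
  rw [sub_add_cancel] at this
  gcongr
  linarith

/-- The kernel that dominates the mixed derivative of the covariance. -/
noncomputable def kernelBound (β C C' u v : ℝ) : ℝ :=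
  C * |u - v| ^ (2 * β - 2) + C' * (|u| ^ (β - 1) * |v| ^ (β - 1))

lemma kernelBound_nonneg {β C C' : ℝ} (hC : 0 ≤ C) (hC' : 0 ≤ C') (u v : ℝ) :
    0 ≤ kernelBound β C C' u v := by
  unfold kernelBound; positivity

section
variable {β : ℝ} (h1 : 1 / 2 < β) (h2 : β < 1)
include h1 h2

lemma integrableOn_abs_sub_rpow (a b : ℝ) (hab : a ≤ b) :
    Integrable (fun p : ℝ × ℝ => |p.1 - p.2| ^ (2 * β - 2))
      ((volume.restrict (Ioc a b)).prod (volume.restrict (Ioc a b))) ∧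
    ∫ p : ℝ × ℝ, |p.1 - p.2| ^ (2 * β - 2)
      ∂((volume.restrict (Ioc a b)).prod (volume.restrict (Ioc a b))) ≤
      2 / (2 * β - 1) * (b - a) ^ (2 * β) := by
  have hp : -1 < 2 * β - 2 := by linarith
  have hm : Measurable (fun p : ℝ × ℝ => |p.1 - p.2| ^ (2 * β - 2)) := by fun_prop
  have hle : ∀ y ∈ Ioc a b, ∫ x in Ioc a b, |x - y| ^ (2 * β - 2) ≤
      2 * (b - a) ^ (2 * β - 1) / (2 * β - 1) := by
    intro y hy
    have := integral_abs_sub_rpow_le hp (v := y) (Ioc_subset_Icc_self hy)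
    rw [intervalIntegral.integral_of_le hab] at this
    convert this using 3 <;> ring_nf
  have hint : Integrable (fun p : ℝ × ℝ => |p.1 - p.2| ^ (2 * β - 2))
      ((volume.restrict (Ioc a b)).prod (volume.restrict (Ioc a b))) := by
    rw [integrable_prod_iff' hm.aestronglyMeasurable]
    constructor
    · refine Eventually.of_forall fun y => ?_
      have := intervalIntegrable_abs_sub_rpow hp y a b
      rwa [intervalIntegrable_iff_integrableOn_Ioc_of_le hab] at this
    · refine Integrable.mono' (g := fun _ => 2 * (b - a) ^ (2 * β - 1) / (2 * β - 1))
        (integrable_const _) ?_ ?_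
      · exact (hm.norm.stronglyMeasurable.integral_prod_left').aestronglyMeasurable
      · filter_upwards [ae_restrict_mem measurableSet_Ioc] with y hy
        have e : ∀ x : ℝ, ‖|x - y| ^ (2 * β - 2)‖ = |x - y| ^ (2 * β - 2) := fun x =>
          Real.norm_of_nonneg (by positivity)
        simp only [e]
        rw [Real.norm_of_nonneg (integral_nonneg fun x => by positivity)]
        exact hle y hy
  refine ⟨hint, ?_⟩
  rw [integral_prod_symm _ hint]
  calc ∫ y in Ioc a b, ∫ x in Ioc a b, |x - y| ^ (2 * β - 2)
      ≤ ∫ y in Ioc a b, 2 * (b - a) ^ (2 * β - 1) / (2 * β - 1) := by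
        refine setIntegral_mono_on hint.integral_prod_right (integrable_const _) measurableSet_Ioc hle
    _ = 2 / (2 * β - 1) * (b - a) ^ (2 * β) := by
        rw [setIntegral_const, Measure.real, Real.volume_Ioc,
          ENNReal.toReal_ofReal (by linarith), smul_eq_mul]
        rcases hab.eq_or_lt with h | h
        · subst h
          rw [sub_self, Real.zero_rpow (by linarith : 2 * β ≠ 0)]; simp
        · have : (b - a) ^ (2 * β) = (b - a) ^ (2 * β - 1) * (b - a) := by
            rw [← Real.rpow_add_one (by linarith)]; congr 1; ring
          rw [this]; ring

lemma integrableOn_rpow_mul_rpow (a b : ℝ) (ha : 0 ≤ a) (hab : a ≤ b) :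
    Integrable (fun p : ℝ × ℝ => |p.1| ^ (β - 1) * |p.2| ^ (β - 1))
      ((volume.restrict (Ioc a b)).prod (volume.restrict (Ioc a b))) ∧
    ∫ p : ℝ × ℝ, |p.1| ^ (β - 1) * |p.2| ^ (β - 1)
      ∂((volume.restrict (Ioc a b)).prod (volume.restrict (Ioc a b))) ≤
      1 / β ^ 2 * (b - a) ^ (2 * β) := by
  have hp : -1 < β - 1 := by linarith
  have hi : Integrable (fun x : ℝ => |x| ^ (β - 1)) (volume.restrict (Ioc a b)) := by
    have := intervalIntegrable_abs_rpow hp a b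
    rwa [intervalIntegrable_iff_integrableOn_Ioc_of_le hab] at this
  refine ⟨hi.mul_prod hi, ?_⟩
  rw [integral_prod_mul (fun x : ℝ => |x| ^ (β - 1)) (fun x : ℝ => |x| ^ (β - 1))]
  have := integral_rpow_le (by linarith : 0 < β) h2.le ha hab
  rw [intervalIntegral.integral_of_le hab] at this
  have h0 : 0 ≤ ∫ x in Ioc a b, |x| ^ (β - 1) := integral_nonneg fun x => by positivity
  calc _ ≤ ((b - a) ^ β / β) * ((b - a) ^ β / β) := mul_le_mul this this h0 (h0.trans this)
    _ = _ := by
      rw [two_mul β, Real.rpow_add_of_nonneg (by linarith) (by linarith) (by linarith)]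
      field_simp

lemma kernelBound_integrable_prod {C C' : ℝ} (hC : 0 ≤ C) (hC' : 0 ≤ C') (a b : ℝ) (ha : 0 ≤ a)
    (hab : a ≤ b) :
    Integrable (fun p : ℝ × ℝ => kernelBound β C C' p.1 p.2)
      ((volume.restrict (Ioc a b)).prod (volume.restrict (Ioc a b))) ∧
    ∫ p : ℝ × ℝ, kernelBound β C C' p.1 p.2
      ∂((volume.restrict (Ioc a b)).prod (volume.restrict (Ioc a b))) ≤
      (C * (2 / (2 * β - 1)) + C' * (1 / β ^ 2)) * (b - a) ^ (2 * β) := by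
  obtain ⟨i1, l1⟩ := integrableOn_abs_sub_rpow h1 h2 a b hab
  obtain ⟨i2, l2⟩ := integrableOn_rpow_mul_rpow h1 h2 a b ha hab
  refine ⟨(i1.const_mul C).add (i2.const_mul C'), ?_⟩
  unfold kernelBound
  rw [integral_add (i1.const_mul C) (i2.const_mul C'), integral_const_mul, integral_const_mul]
  have := mul_le_mul_of_nonneg_left l1 hC
  have := mul_le_mul_of_nonneg_left l2 hC'
  linarith

lemma kernelBound_integrableOn {C C' : ℝ} (hC : 0 ≤ C) (hC' : 0 ≤ C') {a b c d : ℝ} (ha : 0 ≤ a)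
    (hc : 0 ≤ c) :
    IntegrableOn (fun p : ℝ × ℝ => kernelBound β C C' p.1 p.2) (Ioc a b ×ˢ Ioc c d) := by
  have := (kernelBound_integrable_prod h1 h2 hC hC' 0 (max 0 (max b d)) le_rfl (le_max_left _ _)).1
  rw [Measure.prod_restrict, ← Measure.volume_eq_prod] at this
  refine IntegrableOn.mono_set this ?_
  refine prod_mono (Ioc_subset_Ioc ha ?_) (Ioc_subset_Ioc hc ?_)
  · exact (le_max_left b d).trans (le_max_right _ _)
  · exact (le_max_right b d).trans (le_max_right _ _)

lemma setIntegral_kernelBound_le {C C' : ℝ} (hC : 0 ≤ C) (hC' : 0 ≤ C') {a b : ℝ} (ha : 0 ≤ a)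
    (hab : a ≤ b) :
    ∫ p in Ioc a b ×ˢ Ioc a b, kernelBound β C C' p.1 p.2 ≤
      (C * (2 / (2 * β - 1)) + C' * (1 / β ^ 2)) * (b - a) ^ (2 * β) := by
  have := (kernelBound_integrable_prod h1 h2 hC hC' a b ha hab).2
  rwa [Measure.prod_restrict, ← Measure.volume_eq_prod] at this

lemma kernelBound_section_integrable {C C' : ℝ} (a b v : ℝ) :
    IntervalIntegrable (fun u => kernelBound β C C' u v) volume a b := by
  unfold kernelBound
  exact ((intervalIntegrable_abs_sub_rpow (by linarith) v a b).const_mul C).add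
    (((intervalIntegrable_abs_rpow (by linarith) a b).mul_const _).const_mul C')

end


/-! ### Recovering the covariance from its mixed derivative -/

/-- The mixed derivative of the covariance, extended by zero. -/
noncomputable def covKernel (β C : ℝ) (Ψ : ℝ → ℝ → ℝ) (u v : ℝ) : ℝ :=
  open Classical in if 0 < u ∧ 0 < v ∧ u ≠ v then C * |u - v| ^ (2 * β - 2) + Ψ u v else 0

/-- Derivatives as limits of sequences: this is what transfers measurability from R to its
derivatives. -/
lemma tendsto_seq_slope {f : ℝ → ℝ} {f' x : ℝ} (h : HasDerivAt f f' x) :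
    Tendsto (fun n : ℕ => ((n : ℝ) + 1) * (f (x + 1 / ((n : ℝ) + 1)) - f x)) atTop (𝓝 f') := by
  have h1 := hasDerivAt_iff_tendsto_slope_zero.1 h
  have h2 : Tendsto (fun n : ℕ => 1 / ((n : ℝ) + 1)) atTop (𝓝[≠] 0) := by
    refine tendsto_nhdsWithin_iff.2 ⟨tendsto_one_div_add_atTop_nhds_zero_nat, ?_⟩
    exact Eventually.of_forall fun n => by
      have : (0 : ℝ) < 1 / ((n : ℝ) + 1) := by positivity
      exact this.ne'
  refine (h1.comp h2).congr fun n => ?_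
  simp [smul_eq_mul]

section
variable {R Ψ : ℝ → ℝ → ℝ} {β C C' : ℝ} (hR : CovAssumption R β C C' Ψ)
  (hcont : ContinuousOn (fun p : ℝ × ℝ => R p.1 p.2) (Ici 0 ×ˢ Ici 0))
lemma covKernel_of_pos {u v : ℝ} (hu : 0 < u) (hv : 0 < v) (h : u ≠ v) :
    covKernel β C Ψ u v = C * |u - v| ^ (2 * β - 2) + Ψ u v := by
  simp [covKernel, hu, hv, h]

include hR

lemma abs_covKernel_sub_le {u v : ℝ} (hu : 0 < u) (hv : 0 < v) (h : u ≠ v) :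
    |covKernel β C Ψ u v - C * |u - v| ^ (2 * β - 2)| ≤ C' * (|u| ^ (β - 1) * |v| ^ (β - 1)) := by
  rw [covKernel_of_pos hu hv h, add_sub_cancel_left]
  refine (hR.bound u v hu hv h).trans_eq ?_
  rw [abs_mul, Real.mul_rpow (abs_nonneg _) (abs_nonneg _)]

lemma abs_covKernel_le (u v : ℝ) : |covKernel β C Ψ u v| ≤ kernelBound β C C' u v := by
  by_cases h : 0 < u ∧ 0 < v ∧ u ≠ v
  · have h1 := abs_covKernel_sub_le hR h.1 h.2.1 h.2.2
    have h2 : 0 ≤ C * |u - v| ^ (2 * β - 2) := mul_nonneg hR.C_pos.le (by positivity)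
    unfold kernelBound
    rw [abs_le] at h1 ⊢
    constructor <;> linarith [h1.1, h1.2]
  · have : covKernel β C Ψ u v = 0 := by simp only [covKernel, h, if_false]
    rw [this, abs_zero]
    exact kernelBound_nonneg hR.C_pos.le hR.C'_nonneg u v

include hcont in
-- Measurability is inherited from R rather than from Ψ: the first derivative is a limit of
-- difference quotients of the continuous R, and the kernel is a limit of difference quotients of
-- that derivative.
lemma measurable_covKernel : Measurable (fun p : ℝ × ℝ => covKernel β C Ψ p.1 p.2) := by
  set U : Set (ℝ × ℝ) := {p | 0 < p.1 ∧ 0 < p.2 ∧ p.1 ≠ p.2} with hU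
  have hUm : MeasurableSet U := by
    refine (measurableSet_lt measurable_const measurable_fst).inter
      ((measurableSet_lt measurable_const measurable_snd).inter ?_)
    exact (measurableSet_eq_fun measurable_fst measurable_snd).compl
  set R' : ℝ × ℝ → ℝ := fun p => R (max p.1 0) (max p.2 0) with hR'
  have hR'c : Continuous R' := by
    have := hcont.comp_continuous (f := fun p : ℝ × ℝ => (max p.1 0, max p.2 0)) (by fun_prop)
      (fun p => mem_prod.2 ⟨mem_Ici.2 (le_max_right _ _), mem_Ici.2 (le_max_right _ _)⟩)
    exact this
  set D : ℝ × ℝ → ℝ := U.indicator (fun p => deriv (fun v => R p.1 v) p.2) with hD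
  have hDm : Measurable D := by
    refine measurable_of_tendsto_metrizable (f := fun (n : ℕ) => U.indicator
      (fun p => ((n : ℝ) + 1) * (R' (p.1, p.2 + 1 / ((n : ℝ) + 1)) - R' p))) (fun n => ?_) ?_
    · refine Measurable.indicator ?_ hUm
      refine Continuous.measurable ?_
      fun_prop
    · rw [tendsto_pi_nhds]
      intro p
      by_cases hp : p ∈ U
      · simp only [hD, indicator_of_mem hp]
        have := tendsto_seq_slope (hR.differentiable p.1 p.2 hp.1 hp.2.1 hp.2.2).hasDerivAt
        refine this.congr fun n => ?_
        have hn : (0 : ℝ) < 1 / ((n : ℝ) + 1) := by positivity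
        simp only [hR']
        rw [max_eq_left hp.1.le, max_eq_left hp.2.1.le, max_eq_left (by linarith [hp.2.1])]
      · simp only [hD, indicator_of_notMem hp]
        exact tendsto_const_nhds
  have hKm : Measurable (U.indicator fun p : ℝ × ℝ => C * |p.1 - p.2| ^ (2 * β - 2) + Ψ p.1 p.2) := by
    refine measurable_of_tendsto_metrizable (f := fun (n : ℕ) => U.indicator
      (fun p => ((n : ℝ) + 1) * (D (p.1 + 1 / ((n : ℝ) + 1), p.2) - D p))) (fun n => ?_) ?_
    · refine Measurable.indicator ?_ hUm
      have : Measurable (fun p : ℝ × ℝ => (p.1 + 1 / ((n : ℝ) + 1), p.2)) := by fun_prop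
      exact ((hDm.comp this).sub hDm).const_mul _
    · rw [tendsto_pi_nhds]
      intro p
      by_cases hp : p ∈ U
      · simp only [indicator_of_mem hp]
        have := tendsto_seq_slope (hR.mixed_deriv p.1 p.2 hp.1 hp.2.1 hp.2.2)
        refine this.congr' ?_
        have h0 : Tendsto (fun n : ℕ => p.1 + 1 / ((n : ℝ) + 1)) atTop (𝓝 (p.1 + 0)) :=
          tendsto_const_nhds.add tendsto_one_div_add_atTop_nhds_zero_nat
        rw [add_zero] at h0
        filter_upwards [h0.eventually_ne hp.2.2] with n hn
        have hn' : (0 : ℝ) < 1 / ((n : ℝ) + 1) := by positivity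
        have hmem : (p.1 + 1 / ((n : ℝ) + 1), p.2) ∈ U := ⟨by
          show 0 < p.1 + _
          linarith [hp.1], hp.2.1, hn⟩
        simp only [hD, indicator_of_mem hp, indicator_of_mem hmem]
      · simp only [indicator_of_notMem hp]
        exact tendsto_const_nhds
  convert hKm using 1
  ext p
  by_cases hp : p ∈ U
  · rw [indicator_of_mem hp, covKernel_of_pos hp.1 hp.2.1 hp.2.2]
  · rw [indicator_of_notMem hp]
    have : ¬ (0 < p.1 ∧ 0 < p.2 ∧ p.1 ≠ p.2) := hp
    simp only [covKernel, this, if_false]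

include hcont in
lemma covKernel_section_integrable (a b v : ℝ) :
    IntervalIntegrable (fun u => covKernel β C Ψ u v) volume a b := by
  refine (kernelBound_section_integrable hR.half_lt hR.lt_one (C := C) (C' := C') a b v).mono_fun ?_
    (Eventually.of_forall fun u => ?_)
  · have : Measurable (fun u => covKernel β C Ψ u v) :=
      (measurable_covKernel hR hcont).comp (f := fun u : ℝ => (u, v)) (by fun_prop)
    exact this.aestronglyMeasurable
  · show |covKernel β C Ψ u v| ≤ |kernelBound β C C' u v|
    exact (abs_covKernel_le hR u v).trans (le_abs_self _)

include hcont in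
lemma covKernel_integrableOn {a b c d : ℝ} (ha : 0 ≤ a) (hc : 0 ≤ c) :
    IntegrableOn (fun p : ℝ × ℝ => covKernel β C Ψ p.1 p.2) (Ioc a b ×ˢ Ioc c d) := by
  refine Integrable.mono' (kernelBound_integrableOn hR.half_lt hR.lt_one hR.C_pos.le hR.C'_nonneg
    ha hc) (measurable_covKernel hR hcont).aestronglyMeasurable
    (Eventually.of_forall fun p => abs_covKernel_le hR p.1 p.2)

include hcont in
/-- The fundamental theorem of calculus for the first derivative, off the diagonal. -/
lemma deriv_sub_deriv_eq {s u₁ u₂ : ℝ} (hs : 0 < s) (h1 : 0 < u₁) (h2 : 0 < u₂) (h1s : u₁ ≠ s)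
    (h2s : u₂ ≠ s) :
    deriv (fun v => R u₂ v) s - deriv (fun v => R u₁ v) s =
      ∫ r in u₁..u₂, covKernel β C Ψ r s := by
  obtain ⟨l, hl⟩ := hR.no_jump s hs
  -- Filling in the limit supplied by `no_jump` makes the derivative continuous across u = s, so the
  -- fundamental theorem with one exceptional point applies.
  set F : ℝ → ℝ := Function.update (fun u => deriv (fun v => R u v) s) s l with hF
  have hFd : ∀ u, 0 < u → u ≠ s → HasDerivAt F (covKernel β C Ψ u s) u := by
    intro u hu hus
    rw [covKernel_of_pos hu hs hus]
    refine (hR.mixed_deriv u s hu hs hus).congr_of_eventuallyEq ?_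
    filter_upwards [isOpen_ne.mem_nhds hus] with x hx
    exact Function.update_of_ne hx _ _
  have hFc : ∀ u, 0 < u → ContinuousAt F u := by
    intro u hu
    by_cases hus : u = s
    · rw [hus]; exact continuousAt_update_same.2 hl
    · exact (hFd u hu hus).continuousAt
  have hmin : 0 < min u₁ u₂ := lt_min h1 h2
  have := MeasureTheory.integral_eq_of_hasDerivAt_off_countable F
    (fun r => covKernel β C Ψ r s) (a := u₁) (b := u₂) (countable_singleton s)
    (fun u hu => (hFc u (lt_of_lt_of_le hmin hu.1)).continuousWithinAt)
    (fun u hu => hFd u (hmin.trans hu.1.1) hu.2)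
    (covKernel_section_integrable hR hcont u₁ u₂ s)
  rw [this, hF, Function.update_of_ne h2s, Function.update_of_ne h1s]

include hcont in
-- The fundamental theorem leaves an unknown A(s) independent of u. As u decreases to 0, ∂R/∂s(u,·)
-- tends to A uniformly near s while R(u,·) tends to R(0,·) = 0; hence A is the derivative of the
-- zero function.
lemma deriv_eq_integral {s u : ℝ} (hs : 0 < s) (hu : 0 < u) (hus : u ≠ s) :
    deriv (fun v => R u v) s = ∫ r in 0..u, covKernel β C Ψ r s := by
  have hβ := hR.half_lt
  have hβ1 := hR.lt_one
  -- For x in (s/2, 2s) and r < c the distance |r - x| exceeds c, so below height c the kernel is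
  -- bounded uniformly in x.
  set c := s / 4 with hc
  have hc0 : 0 < c := by positivity
  set A : ℝ → ℝ := fun x => deriv (fun v => R c v) x - ∫ r in 0..c, covKernel β C Ψ r x with hA
  have hint : ∀ x a b, IntervalIntegrable (fun u => covKernel β C Ψ u x) volume a b :=
    fun x a b => covKernel_section_integrable hR hcont a b x
  have hDA : ∀ x, 0 < x → ∀ u, 0 < u → c ≠ x → u ≠ x →
      deriv (fun v => R u v) x = A x + ∫ r in 0..u, covKernel β C Ψ r x := by
    intro x hx u hu hcx hux
    have e1 := deriv_sub_deriv_eq hR hcont hx hc0 hu hcx hux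
    have e2 := intervalIntegral.integral_add_adjacent_intervals (hint x 0 c) (hint x c u)
    simp only [hA]; linarith
  have hcs : c ≠ s := by rw [hc]; linarith
  suffices hAs : A s = 0 by
    rw [hDA s hs u hu hcs hus, hAs, zero_add]
  set S : Set ℝ := Ioo (s / 2) (2 * s) with hS
  set B : ℝ → ℝ := fun u => ∫ r in 0..u, (C * c ^ (2 * β - 2) + C' * (|r| ^ (β - 1) * c ^ (β - 1)))
    with hB
  have hBint : ∀ a b, IntervalIntegrable
      (fun r : ℝ => C * c ^ (2 * β - 2) + C' * (|r| ^ (β - 1) * c ^ (β - 1))) volume a b := fun a b =>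
    intervalIntegrable_const.add
      (((intervalIntegrable_abs_rpow (by linarith) a b).mul_const _).const_mul C')
  have hB0 : Tendsto B (𝓝[>] 0) (𝓝 0) := by
    have h1 : Continuous B := intervalIntegral.continuous_primitive hBint 0
    have h2 : B 0 = 0 := by simp [hB]
    have h3 := (h1.tendsto 0).mono_left (nhdsWithin_le_nhds (s := Ioi (0 : ℝ)))
    rwa [h2] at h3
  have hbound : ∀ u, 0 < u → u < c → ∀ x ∈ S, |deriv (fun v => R u v) x - A x| ≤ B u := by
    intro u hu huc x hx
    have hx0 : 0 < x := lt_trans (by positivity) hx.1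
    have hcx : c < x := lt_trans (by rw [hc]; linarith) hx.1
    rw [hDA x hx0 u hu hcx.ne (huc.trans hcx).ne, add_sub_cancel_left]
    have := intervalIntegral.norm_integral_le_of_norm_le (μ := volume) hu.le
      (f := fun r => covKernel β C Ψ r x)
      (g := fun r : ℝ => C * c ^ (2 * β - 2) + C' * (|r| ^ (β - 1) * c ^ (β - 1))) ?_ (hBint 0 u)
    · exact this
    · refine Eventually.of_forall fun r hr => (abs_covKernel_le hR r x).trans ?_
      have hxr : c ≤ |r - x| := by
        rw [abs_sub_comm, abs_of_nonneg (by linarith [hr.2])]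
        have := hx.1
        linarith [hr.2]
      have e1 : |r - x| ^ (2 * β - 2) ≤ c ^ (2 * β - 2) :=
        Real.rpow_le_rpow_of_nonpos hc0 hxr (by linarith)
      have e2 : |x| ^ (β - 1) ≤ c ^ (β - 1) :=
        Real.rpow_le_rpow_of_nonpos hc0 (hcx.le.trans (le_abs_self x)) (by linarith)
      have := hR.C_pos.le
      have := hR.C'_nonneg
      unfold kernelBound
      gcongr
  have hunif : TendstoUniformlyOn (fun u x => deriv (fun v => R u v) x) A (𝓝[>] 0) S := by
    rw [Metric.tendstoUniformlyOn_iff]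
    intro ε hε
    filter_upwards [hB0.eventually_lt_const hε, self_mem_nhdsWithin,
      nhdsWithin_le_nhds (Iio_mem_nhds hc0)] with u h1 h2 h3 x hx
    rw [dist_comm, Real.dist_eq]
    exact (hbound u h2 h3 x hx).trans_lt h1
  have hs' : s ∈ S := ⟨by linarith, by linarith⟩
  have hlim : ∀ x ∈ S, Tendsto (fun u => R u x) (𝓝[>] 0) (𝓝 ((fun _ => (0 : ℝ)) x)) := by
    intro x hx
    have hx0 : 0 ≤ x := (lt_trans (by positivity) hx.1).le
    have h1 : ContinuousWithinAt (fun p : ℝ × ℝ => R p.1 p.2) (Ici 0 ×ˢ Ici 0) (0, x) :=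
      hcont _ ⟨self_mem_Ici, hx0⟩
    have h2 : Tendsto (fun u : ℝ => (u, x)) (𝓝[>] 0) (𝓝[Ici 0 ×ˢ Ici 0] (0, x)) := by
      refine tendsto_nhdsWithin_iff.2 ⟨?_, ?_⟩
      · have : Continuous (fun u : ℝ => (u, x)) := by fun_prop
        exact this.continuousAt.tendsto.mono_left nhdsWithin_le_nhds
      · filter_upwards [self_mem_nhdsWithin] with u hu
        exact mem_prod.2 ⟨mem_Ici.2 (le_of_lt hu), mem_Ici.2 hx0⟩
    have h3 := h1.tendsto.comp h2
    simp only at h3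
    rw [hR.zero_left x hx0] at h3
    exact h3
  have hder := hasDerivAt_of_tendstoUniformlyOn (l := 𝓝[>] (0 : ℝ)) (f := fun u x => R u x)
    (g := fun _ => (0 : ℝ)) isOpen_Ioo hunif ?_ hlim hs'
  · exact hder.unique (hasDerivAt_const s (0 : ℝ))
  · filter_upwards [self_mem_nhdsWithin, nhdsWithin_le_nhds (Iio_mem_nhds hc0)] with u h1 h2 x hx
    have hx0 : 0 < x := lt_trans (by positivity) hx.1
    have hcx : c < x := lt_trans (by rw [hc]; linarith) hx.1
    exact (hR.differentiable u x h1 hx0 (h2.trans hcx).ne).hasDerivAt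

include hcont in
lemma sub_eq_integral {t c d : ℝ} (ht : 0 ≤ t) (hc : 0 ≤ c) (hcd : c ≤ d) :
    R t d - R t c = ∫ v in c..d, ∫ r in 0..t, covKernel β C Ψ r v := by
  rcases ht.eq_or_lt with rfl | ht
  · rw [hR.zero_left d (hc.trans hcd), hR.zero_left c hc]; simp
  have hi : IntervalIntegrable (fun v => ∫ r in 0..t, covKernel β C Ψ r v) volume c d := by
    rw [intervalIntegrable_iff_integrableOn_Ioc_of_le hcd]
    have := covKernel_integrableOn hR hcont (a := 0) (b := t) (c := c) (d := d) le_rfl hc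
    rw [IntegrableOn, Measure.volume_eq_prod, ← Measure.prod_restrict] at this
    simp only [intervalIntegral.integral_of_le ht.le]
    exact this.integral_prod_right
  symm
  refine MeasureTheory.integral_eq_of_hasDerivAt_off_countable_of_le (fun v => R t v)
    (fun v => ∫ r in 0..t, covKernel β C Ψ r v) hcd (countable_singleton t) ?_ ?_ hi
  · refine hcont.comp (f := fun v : ℝ => (t, v)) (by fun_prop) fun v hv => ?_
    exact ⟨ht.le, hc.trans hv.1⟩
  · intro x hx
    have hx0 : 0 < x := hc.trans_lt hx.1.1
    have hxt : t ≠ x := fun h => hx.2 h.symm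
    rw [← deriv_eq_integral hR hcont hx0 ht hxt]
    exact (hR.differentiable t x ht hx0 hxt).hasDerivAt

include hcont in
/-- The increment of the covariance over a rectangle is the integral of the kernel. -/
theorem rectangle_increment {a b c d : ℝ} (ha : 0 ≤ a) (hab : a ≤ b) (hc : 0 ≤ c) (hcd : c ≤ d) :
    R b d - R a d - R b c + R a c =
      ∫ p in Ioc a b ×ˢ Ioc c d, covKernel β C Ψ p.1 p.2 := by
  have e1 := sub_eq_integral hR hcont (ha.trans hab) hc hcd
  have e2 := sub_eq_integral hR hcont ha hc hcd
  have hK := covKernel_integrableOn hR hcont (a := a) (b := b) (c := c) (d := d) ha hc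
  have hi : ∀ t, 0 ≤ t →
      IntervalIntegrable (fun v => ∫ r in 0..t, covKernel β C Ψ r v) volume c d := by
    intro t ht
    rw [intervalIntegrable_iff_integrableOn_Ioc_of_le hcd]
    have := covKernel_integrableOn hR hcont (a := 0) (b := t) (c := c) (d := d) le_rfl hc
    rw [IntegrableOn, Measure.volume_eq_prod, ← Measure.prod_restrict] at this
    simp only [intervalIntegral.integral_of_le ht]
    exact this.integral_prod_right
  have e3 : R b d - R a d - R b c + R a c =
      ∫ v in c..d, ∫ r in a..b, covKernel β C Ψ r v := by
    have : R b d - R a d - R b c + R a c = (R b d - R b c) - (R a d - R a c) := by ring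
    rw [this, e1, e2, ← intervalIntegral.integral_sub (hi b (ha.trans hab)) (hi a ha)]
    refine intervalIntegral.integral_congr fun v _ => ?_
    exact intervalIntegral.integral_interval_sub_left (covKernel_section_integrable hR hcont _ _ _)
      (covKernel_section_integrable hR hcont _ _ _)
  rw [e3, intervalIntegral.integral_of_le hcd, Measure.volume_eq_prod, ← Measure.prod_restrict]
  rw [IntegrableOn, Measure.volume_eq_prod, ← Measure.prod_restrict] at hK
  rw [integral_prod_symm _ hK]
  simp only [intervalIntegral.integral_of_le hab]

end


/-! ### Dyadic chaining and a maximal inequality -/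

section Chaining

/-- A dyadic point of level l + 1 is either of level l or one step of length 2^{-(l+1)} to the right
of such a point, so each level contributes at most one increment. -/
lemma chaining_dyadic {f : ℝ → ℝ} {B q : ℝ}
    (h : ∀ l i : ℕ, i < 2 ^ l → |f (((i : ℝ) + 1) / 2 ^ l) - f ((i : ℝ) / 2 ^ l)| ≤ B * q ^ l)
    (hB : 0 ≤ B) (hq : 0 ≤ q) (l : ℕ) :
    ∀ i : ℕ, i ≤ 2 ^ l →
      |f ((i : ℝ) / 2 ^ l) - f 0| ≤ B * ∑ j ∈ Finset.range (l + 1), q ^ j := by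
  induction l with
  | zero =>
    intro i hi
    have hi' : i = 0 ∨ i = 1 := by simp at hi; omega
    rcases hi' with rfl | rfl
    · simpa using hB
    · have := h 0 0 (by norm_num)
      simpa using this
  | succ l ih =>
    intro i hi
    rw [Finset.sum_range_succ, mul_add]
    have hnn : 0 ≤ B * q ^ (l + 1) := by positivity
    obtain ⟨m, rfl | rfl⟩ : ∃ m, i = 2 * m ∨ i = 2 * m + 1 := ⟨i / 2, by omega⟩
    · have e : ((2 * m : ℕ) : ℝ) / 2 ^ (l + 1) = (m : ℝ) / 2 ^ l := by
        push_cast; rw [pow_succ]; field_simp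
      rw [e]
      have := ih m (by rw [pow_succ] at hi; omega)
      linarith
    · have e : ((2 * m : ℕ) : ℝ) / 2 ^ (l + 1) = (m : ℝ) / 2 ^ l := by
        push_cast; rw [pow_succ]; field_simp
      have h1 := ih m (by rw [pow_succ] at hi; omega)
      have h2 := h (l + 1) (2 * m) (by omega)
      rw [e] at h2
      have e2 : (((2 * m + 1 : ℕ) : ℝ)) = ((2 * m : ℕ) : ℝ) + 1 := by push_cast; ring
      rw [e2]
      calc _ = |(f ((((2 * m : ℕ) : ℝ) + 1) / 2 ^ (l + 1)) - f ((m : ℝ) / 2 ^ l)) +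
            (f ((m : ℝ) / 2 ^ l) - f 0)| := by congr 1; ring
        _ ≤ _ := (abs_add_le _ _).trans (by linarith)

lemma chaining {f : ℝ → ℝ} (hf : Continuous f) {B q : ℝ} (hB : 0 ≤ B) (hq : 0 ≤ q) (hq1 : q < 1)
    (h : ∀ l i : ℕ, i < 2 ^ l → |f (((i : ℝ) + 1) / 2 ^ l) - f ((i : ℝ) / 2 ^ l)| ≤ B * q ^ l)
    {t : ℝ} (ht : t ∈ Icc (0 : ℝ) 1) : |f t - f 0| ≤ B * (1 - q)⁻¹ := by
  have h1 : Tendsto (fun l : ℕ => (⌊t * 2 ^ l⌋₊ : ℝ) / 2 ^ l) atTop (𝓝 t) :=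
    (tendsto_nat_floor_mul_div_atTop ht.1).comp (tendsto_pow_atTop_atTop_of_one_lt one_lt_two)
  have h2 : Tendsto (fun l : ℕ => |f ((⌊t * 2 ^ l⌋₊ : ℝ) / 2 ^ l) - f 0|) atTop (𝓝 |f t - f 0|) :=
    (((hf.tendsto t).comp h1).sub_const _).abs
  refine le_of_tendsto h2 (Eventually.of_forall fun l => ?_)
  refine (chaining_dyadic h hB hq l _ ?_).trans ?_
  · have : t * 2 ^ l ≤ ((2 ^ l : ℕ) : ℝ) := by
      push_cast
      exact mul_le_of_le_one_left (by positivity) ht.2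
    exact Nat.floor_le_of_le this
  · gcongr
    rw [← tsum_geometric_of_lt_one hq hq1]
    exact (summable_geometric_of_lt_one hq hq1).sum_le_tsum _ (fun i _ => by positivity)

variable {Ω : Type*} [MeasurableSpace Ω] {P : Measure Ω} {g : ℝ → Ω → ℝ}

/-- A maximal inequality for processes with Hölder continuous fourth moments. -/
theorem exists_maximal_bound (hm : ∀ t, Measurable (g t)) (hc : ∀ ω, Continuous fun t => g t ω)
    {c β : ℝ} (hc0 : 0 ≤ c) (hβ : 1 / 2 < β)
    (hmom : ∀ s t, 0 ≤ s → s ≤ t →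
      ∫⁻ ω, ENNReal.ofReal ((g t ω - g s ω) ^ 4) ∂P ≤ ENNReal.ofReal (c * (t - s) ^ (4 * β))) :
    ∃ c' : ℝ, 0 ≤ c' ∧ ∀ a L, 0 ≤ a → 0 < L → ∃ N : Ω → ENNReal, Measurable N ∧
      ∫⁻ ω, N ω ∂P ≤ ENNReal.ofReal (c' * L ^ (4 * β)) ∧
      ∀ ω, ∀ t ∈ Icc a (a + L), ENNReal.ofReal ((g t ω - g a ω) ^ 4) ≤ N ω := by
  -- Chosen with q^4 = 1/2: the weight 2^l in the sum `M` below turns into the bound M^{1/4} q^l for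
  -- increments of level l.
  set q : ℝ := (1 / 2) ^ ((1 : ℝ) / 4) with hq
  have hq0 : 0 < q := by positivity
  have hq4 : q ^ 4 = 1 / 2 := by
    rw [hq, ← Real.rpow_natCast, ← Real.rpow_mul (by norm_num)]; norm_num
  have hq1 : q < 1 := Real.rpow_lt_one (by norm_num) (by norm_num) (by norm_num)
  set K : ℝ := (1 - q)⁻¹ ^ 4 with hK
  have hK0 : 0 < K := by have : 0 < 1 - q := by linarith
                         positivity
  -- Level l has 2^l increments, weight 2^l and fourth moments of order 2^{-4βl}; the product is
  -- r^l, and r < 1 exactly because β > 1/2.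
  set r : ℝ := (2 : ℝ) ^ (2 - 4 * β) with hr
  have hr0 : 0 < r := by positivity
  have hr1 : r < 1 := Real.rpow_lt_one_of_one_lt_of_neg one_lt_two (by linarith)
  refine ⟨K * c * (1 - r)⁻¹, by have : 0 < 1 - r := by linarith
                                positivity, fun a L ha hL => ?_⟩
  set Δ : ℕ → ℕ → Ω → ℝ := fun l i ω =>
    g (a + L * (((i : ℝ) + 1) / 2 ^ l)) ω - g (a + L * ((i : ℝ) / 2 ^ l)) ω with hΔ
  have hΔm : ∀ l i, Measurable (Δ l i) := fun l i => (hm _).sub (hm _)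
  set M : Ω → ENNReal := fun ω => ∑' l : ℕ, ∑ i ∈ Finset.range (2 ^ l),
    ENNReal.ofReal (2 ^ l) * ENNReal.ofReal (Δ l i ω ^ 4) with hM
  have hMm : Measurable M := by
    refine Measurable.tsum fun l => Finset.measurable_sum _ fun i _ => ?_
    exact (((hΔm l i).pow_const 4).ennreal_ofReal).const_mul _
  refine ⟨fun ω => ENNReal.ofReal K * M ω, hMm.const_mul _, ?_, ?_⟩
  · rw [lintegral_const_mul _ hMm, mul_assoc, mul_assoc, ENNReal.ofReal_mul hK0.le]
    gcongr
    have hterm : ∀ l : ℕ, ∫⁻ ω, ∑ i ∈ Finset.range (2 ^ l),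
        ENNReal.ofReal (2 ^ l) * ENNReal.ofReal (Δ l i ω ^ 4) ∂P ≤
          ENNReal.ofReal (c * L ^ (4 * β) * r ^ l) := by
      intro l
      rw [lintegral_finsetSum _ fun i _ => (((hΔm l i).pow_const 4).ennreal_ofReal).const_mul _]
      have h1 : ∀ i ∈ Finset.range (2 ^ l), ∫⁻ ω, ENNReal.ofReal (2 ^ l) *
          ENNReal.ofReal (Δ l i ω ^ 4) ∂P ≤
          ENNReal.ofReal (2 ^ l * (c * (L / 2 ^ l) ^ (4 * β))) := by
        intro i _
        rw [lintegral_const_mul _ ((hΔm l i).pow_const 4).ennreal_ofReal,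
          ENNReal.ofReal_mul (by positivity : (0 : ℝ) ≤ 2 ^ l)]
        gcongr
        refine (hmom (a + L * ((i : ℝ) / 2 ^ l)) (a + L * (((i : ℝ) + 1) / 2 ^ l))
          (by positivity) (by gcongr; linarith)).trans_eq ?_
        congr 3; ring
      refine (Finset.sum_le_sum h1).trans_eq ?_
      rw [Finset.sum_const, Finset.card_range, nsmul_eq_mul]
      have : ((2 ^ l : ℕ) : ENNReal) = ENNReal.ofReal (2 ^ l) := by
        rw [ENNReal.ofReal_pow (by norm_num)]; simp
      rw [this, ← ENNReal.ofReal_mul (by positivity)]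
      congr 1
      rw [Real.div_rpow hL.le (by positivity), ← Real.rpow_natCast 2 l, ← Real.rpow_mul (by norm_num),
        hr, ← Real.rpow_natCast (2 ^ (2 - 4 * β)) l, ← Real.rpow_mul (by norm_num)]
      have e : (2 : ℝ) ^ ((2 - 4 * β) * l) = 2 ^ (l : ℝ) * 2 ^ (l : ℝ) / 2 ^ (l * (4 * β)) := by
        rw [← Real.rpow_add (by norm_num), ← Real.rpow_sub (by norm_num)]; congr 1; ring
      rw [e]; ring
    calc ∫⁻ ω, M ω ∂P = ∑' l : ℕ, ∫⁻ ω, ∑ i ∈ Finset.range (2 ^ l),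
        ENNReal.ofReal (2 ^ l) * ENNReal.ofReal (Δ l i ω ^ 4) ∂P := by
          refine lintegral_tsum fun l => (Finset.measurable_sum _ fun i _ => ?_).aemeasurable
          exact (((hΔm l i).pow_const 4).ennreal_ofReal).const_mul _
      _ ≤ ∑' l : ℕ, ENNReal.ofReal (c * L ^ (4 * β) * r ^ l) := ENNReal.tsum_le_tsum hterm
      _ = ENNReal.ofReal (c * ((1 - r)⁻¹ * L ^ (4 * β))) := by
          rw [← ENNReal.ofReal_tsum_of_nonneg (fun l => by positivity)
            ((summable_geometric_of_lt_one hr0.le hr1).mul_left _), tsum_mul_left,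
            tsum_geometric_of_lt_one hr0.le hr1]
          congr 1; ring
  · intro ω t ht
    by_cases htop : M ω = ⊤
    · simp only [htop]
      rw [ENNReal.mul_top (by simpa using hK0)]
      exact le_top
    set b : ℝ := (M ω).toReal with hb
    have hb0 : 0 ≤ b := ENNReal.toReal_nonneg
    set B : ℝ := b ^ ((1 : ℝ) / 4) with hBdef
    have hB0 : 0 ≤ B := by positivity
    have hB4 : B ^ 4 = b := by
      rw [hBdef, ← Real.rpow_natCast, ← Real.rpow_mul hb0]; norm_num
    have hincr : ∀ l i : ℕ, i < 2 ^ l → |Δ l i ω| ≤ B * q ^ l := by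
      intro l i hi
      have h1 : ENNReal.ofReal (2 ^ l * Δ l i ω ^ 4) ≤ M ω := by
        rw [ENNReal.ofReal_mul (by positivity)]
        refine le_trans ?_ (ENNReal.le_tsum l)
        exact Finset.single_le_sum (f := fun i => ENNReal.ofReal (2 ^ l) *
          ENNReal.ofReal (Δ l i ω ^ 4)) (fun _ _ => zero_le) (Finset.mem_range.2 hi)
      have h2 : 2 ^ l * Δ l i ω ^ 4 ≤ b := (ENNReal.ofReal_le_iff_le_toReal htop).1 h1
      refine le_of_pow_le_pow_left₀ (n := 4) (by norm_num) (by positivity) ?_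
      rw [mul_pow, hB4, ← pow_mul, mul_comm l 4, pow_mul, hq4, pow_abs, abs_of_nonneg
        (by positivity : 0 ≤ Δ l i ω ^ 4), one_div, inv_pow, ← div_eq_mul_inv,
        le_div_iff₀ (by positivity)]
      linarith
    have hx : (t - a) / L ∈ Icc (0 : ℝ) 1 :=
      ⟨div_nonneg (by linarith [ht.1]) hL.le, (div_le_one hL).2 (by linarith [ht.2])⟩
    have h3 := chaining (f := fun x => g (a + L * x) ω)
      ((hc ω).comp (by fun_prop : Continuous fun x : ℝ => a + L * x)) hB0 hq0.le hq1 hincr hx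
    simp only [mul_zero, add_zero] at h3
    rw [mul_div_cancel₀ _ hL.ne', add_sub_cancel] at h3
    have h4 : (g t ω - g a ω) ^ 4 ≤ K * b := by
      have := pow_le_pow_left₀ (abs_nonneg _) h3 4
      rw [pow_abs, abs_of_nonneg (by positivity : 0 ≤ (g t ω - g a ω) ^ 4), mul_pow, hB4] at this
      rw [hK]; linarith
    calc ENNReal.ofReal ((g t ω - g a ω) ^ 4) ≤ ENNReal.ofReal (K * b) := ENNReal.ofReal_le_ofReal h4
      _ = ENNReal.ofReal K * M ω := by
        rw [ENNReal.ofReal_mul hK0.le, hb, ENNReal.ofReal_toReal htop]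

end Chaining

/-! ### Stein's identity and Gaussian moments -/

section Stein

open scoped NNReal

/-- Stein's identity for a centered Gaussian measure on the line. -/
theorem gaussianReal_stein {v : ℝ≥0} {h h' : ℝ → ℝ} (hd : ∀ x, HasDerivAt h (h' x) x)
    (i1 : Integrable (fun x => x * h x) (gaussianReal 0 v)) (i2 : Integrable h' (gaussianReal 0 v))
    (i3 : Integrable h (gaussianReal 0 v)) :
    ∫ x, x * h x ∂(gaussianReal 0 v) = v * ∫ x, h' x ∂(gaussianReal 0 v) := by
  -- The degenerate law is a Dirac mass without density. Otherwise the identity is integration by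
  -- parts against the density φ, which satisfies φ' = -(x/v) φ.
  by_cases hv : v = 0
  · subst hv
    simp [gaussianReal_zero_var]
  have hv' : (0 : ℝ) < v := by positivity
  have key : ∀ {F : ℝ → ℝ}, Integrable F (gaussianReal 0 v) →
      Integrable (fun x => F x * gaussianPDFReal 0 v x) := by
    intro F hF
    rw [gaussianReal_of_var_ne_zero _ hv, integrable_withDensity_iff (measurable_gaussianPDF 0 v)
      (ae_of_all _ fun _ => gaussianPDF_lt_top)] at hF
    simpa [toReal_gaussianPDF] using hF
  have hφ : ∀ x, HasDerivAt (gaussianPDFReal 0 v) (-(x / v) * gaussianPDFReal 0 v x) x := by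
    intro x
    have e : gaussianPDFReal 0 v = fun x => (√(2 * Real.pi * v))⁻¹ * Real.exp (-(x - 0) ^ 2 / (2 * v)) :=
      rfl
    rw [e]
    have h1 : HasDerivAt (fun x : ℝ => -(x - 0) ^ 2 / (2 * v)) (-(x / v)) x := by
      have := (((hasDerivAt_id x).sub_const 0).pow 2).neg.div_const (2 * (v : ℝ))
      refine HasDerivAt.congr_deriv this ?_
      simp only [id, sub_zero]; norm_num; field_simp
    have := (h1.exp).const_mul ((√(2 * Real.pi * v))⁻¹)
    exact this.congr_deriv (by ring)
  have e := integral_mul_deriv_eq_deriv_mul_of_integrable (u := h) (u' := h')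
    (v := gaussianPDFReal 0 v) (v' := fun x => -(x / v) * gaussianPDFReal 0 v x)
    (fun x _ => hd x) (fun x _ => hφ x) ?_ (key i2) (key i3)
  · rw [integral_gaussianReal_eq_integral_smul hv, integral_gaussianReal_eq_integral_smul hv]
    simp only [smul_eq_mul]
    have e1 : ∫ x, h x * (-(x / v) * gaussianPDFReal 0 v x) =
        -((v : ℝ)⁻¹ * ∫ x, gaussianPDFReal 0 v x * (x * h x)) := by
      rw [← integral_const_mul, ← integral_neg]
      congr 1; ext x; field_simp
    have e2 : ∫ x, h' x * gaussianPDFReal 0 v x = ∫ x, gaussianPDFReal 0 v x * h' x := by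
      congr 1; ext x; ring
    rw [e1, e2, neg_inj] at e
    rw [← e]; field_simp
  · have := (key i1).const_mul (-(v : ℝ)⁻¹)
    refine this.congr (Eventually.of_forall fun x => ?_)
    simp only [Pi.mul_apply]; field_simp

lemma integrable_pow_gaussianReal (v : ℝ≥0) (n : ℕ) :
    Integrable (fun x : ℝ => x ^ n) (gaussianReal 0 v) := by
  by_cases hn : n = 0
  · subst hn; simp
  have := (memLp_id_gaussianReal' (μ := 0) (v := v) n (by simp)).integrable_norm_pow hn
  refine (integrable_norm_iff (by fun_prop)).1 ?_
  simpa using this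

lemma integral_sq_gaussianReal (v : ℝ≥0) : ∫ x, x ^ 2 ∂(gaussianReal 0 v) = v := by
  have := gaussianReal_stein (v := v) (h := fun x => x) (h' := fun _ => 1)
    (fun x => hasDerivAt_id x) (by simpa [sq] using integrable_pow_gaussianReal v 2)
    (integrable_const _) (by simpa using integrable_pow_gaussianReal v 1)
  simpa [sq] using this

lemma integral_pow_four_gaussianReal (v : ℝ≥0) :
    ∫ x, x ^ 4 ∂(gaussianReal 0 v) = 3 * (v : ℝ) ^ 2 := by
  have := gaussianReal_stein (v := v) (h := fun x => x ^ 3) (h' := fun x => 3 * x ^ 2)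
    (fun x => by simpa using hasDerivAt_pow 3 x)
    (by refine (integrable_pow_gaussianReal v 4).congr (ae_of_all _ fun x => ?_); ring)
    ((integrable_pow_gaussianReal v 2).const_mul 3) (integrable_pow_gaussianReal v 3)
  rw [integral_const_mul, integral_sq_gaussianReal] at this
  calc _ = ∫ x, x * x ^ 3 ∂(gaussianReal 0 v) := by congr 1; ext x; ring
    _ = _ := by rw [this]; ring

variable {Ω : Type*} [MeasurableSpace Ω] {P : Measure Ω}

lemma integral_comp_of_map_eq {Y : Ω → ℝ} (hY : AEMeasurable Y P) {v : ℝ≥0}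
    (h : P.map Y = gaussianReal 0 v) (n : ℕ) :
    ∫ ω, Y ω ^ n ∂P = ∫ x, x ^ n ∂(gaussianReal 0 v) := by
  rw [← h, integral_map hY (by fun_prop)]

lemma fourth_moment_of_map_eq {Y : Ω → ℝ} (hY : AEMeasurable Y P) {v : ℝ≥0}
    (h : P.map Y = gaussianReal 0 v) :
    Integrable (fun ω => Y ω ^ 4) P ∧ ∫ ω, Y ω ^ 4 ∂P = 3 * (∫ ω, Y ω ^ 2 ∂P) ^ 2 := by
  constructor
  · have := integrable_pow_gaussianReal v 4
    rw [← h, integrable_map_measure (by fun_prop) hY] at this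
    exact this
  · rw [integral_comp_of_map_eq hY h, integral_comp_of_map_eq hY h, integral_pow_four_gaussianReal,
      integral_sq_gaussianReal]

lemma _root_.ProbabilityTheory.HasGaussianLaw.map_eq_of_centered {Y : Ω → ℝ} [IsProbabilityMeasure P]
    (hY : HasGaussianLaw Y P) (h0 : ∫ ω, Y ω ∂P = 0) :
    P.map Y = gaussianReal 0 (∫ ω, Y ω ^ 2 ∂P).toNNReal := by
  rw [hY.map_eq_gaussianReal, h0, variance_of_integral_eq_zero hY.aemeasurable h0]

end Stein


/-! ### The regular modification of G and its moment bounds -/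

/-- A centered Gaussian process on the line with continuous paths, starting at zero, whose
covariance is given by a kernel that is close to `C * |u - v| ^ (2 * β - 2)`. -/
structure KernelGaussian {Ω : Type*} [MeasurableSpace Ω] (P : Measure Ω) (g : ℝ → Ω → ℝ)
    (K : ℝ → ℝ → ℝ) (β C C' : ℝ) : Prop where
  meas : ∀ t, Measurable (g t)
  cont : ∀ ω, Continuous fun t => g t ω
  gaussian : IsGaussianProcess g P
  centered : ∀ t, ∫ ω, g t ω ∂P = 0
  zero : ∀ ω, g 0 ω = 0
  half_lt : 1 / 2 < β
  lt_one : β < 1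
  C_pos : 0 < C
  C'_nonneg : 0 ≤ C'
  measK : Measurable (fun p : ℝ × ℝ => K p.1 p.2)
  boundK : ∀ u v, |K u v| ≤ kernelBound β C C' u v
  closeK : ∀ u v, 0 < u → 0 < v → u ≠ v →
    |K u v - C * |u - v| ^ (2 * β - 2)| ≤ C' * (|u| ^ (β - 1) * |v| ^ (β - 1))
  cov : ∀ a b c d, 0 ≤ a → a ≤ b → 0 ≤ c → c ≤ d →
    ∫ ω, (g b ω - g a ω) * (g d ω - g c ω) ∂P = ∫ p in Ioc a b ×ˢ Ioc c d, K p.1 p.2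

section
variable {Ω : Type*} [MeasurableSpace Ω] {P : Measure Ω} [IsProbabilityMeasure P]

/-- A Gaussian process as in the theorem has a modification with everywhere continuous paths. -/
theorem exists_kernelGaussian {G : ℝ → Ω → ℝ} (hG : IsContCenteredGaussian P G)
    {β C C' : ℝ} {Ψ : ℝ → ℝ → ℝ} (hR : CovAssumption (covFun P G) β C C' Ψ) :
    ∃ g : ℝ → Ω → ℝ, KernelGaussian P g (covKernel β C Ψ) β C C' ∧
      ∀ᵐ ω ∂P, ∀ t, 0 ≤ t → g t ω = G t ω := by
  classical
  have hL2 : ∀ t, 0 ≤ t → MemLp (G t) 2 P := fun t ht =>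
    (hG.gaussian.hasGaussianLaw_eval ⟨t, ht⟩).memLp_two
  -- R(0,0) = E[G_0²] = 0.
  have hG0 : G 0 =ᵐ[P] 0 := by
    have h0 := hR.zero_left 0 le_rfl
    unfold covFun at h0
    rw [integral_eq_zero_iff_of_nonneg (fun ω => mul_self_nonneg _)
      ((hL2 0 le_rfl).integrable_mul (hL2 0 le_rfl))] at h0
    filter_upwards [h0] with ω hω
    simpa using hω
  -- The set of continuous paths need not be measurable, so a measurable subset of full measure
  -- replaces it.
  obtain ⟨A, hAsub, hAm, hAc⟩ : ∃ A : Set Ω, (∀ ω ∈ A, ContinuousOn (fun t => G t ω) (Ici 0)) ∧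
      MeasurableSet A ∧ ∀ᵐ ω ∂P, ω ∈ A := by
    obtain ⟨t, ht, htm, ht0⟩ := exists_measurable_superset_of_null (ae_iff.1 hG.continuous_paths)
    refine ⟨tᶜ, fun ω hω => ?_, htm.compl, ?_⟩
    · by_contra h
      exact hω (ht h)
    · rw [ae_iff]; simpa using ht0
  -- Subtracting `G 0` makes every path start at zero, the indicator makes every path continuous,
  -- and `max t 0` extends the process to negative times.
  set g : ℝ → Ω → ℝ := fun t => A.indicator (fun ω => G (max t 0) ω - G 0 ω) with hg
  have hgG' : ∀ᵐ ω ∂P, ∀ t, g t ω = G (max t 0) ω := by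
    filter_upwards [hAc, hG0] with ω h1 h2 t
    simp only [hg, indicator_of_mem h1, h2, Pi.zero_apply, sub_zero]
  have hgG : ∀ᵐ ω ∂P, ∀ t, 0 ≤ t → g t ω = G t ω := by
    filter_upwards [hgG'] with ω h t ht
    rw [h t, max_eq_left ht]
  have hgGt : ∀ t, 0 ≤ t → g t =ᵐ[P] G t := fun t ht => by
    filter_upwards [hgG] with ω h using h t ht
  refine ⟨g, ?_, hgG⟩
  refine ⟨fun t => ?_, fun ω => ?_, ?_, fun t => ?_, fun ω => ?_, hR.half_lt, hR.lt_one, hR.C_pos,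
    hR.C'_nonneg, measurable_covKernel hR hG.continuous_cov, abs_covKernel_le hR,
    fun u v hu hv h => abs_covKernel_sub_le hR hu hv h, fun a b c d ha hab hc hcd => ?_⟩
  · exact ((hG.measurable _ (le_max_right _ _)).sub (hG.measurable 0 le_rfl)).indicator hAm
  · by_cases hω : ω ∈ A
    · simp only [hg, indicator_of_mem hω]
      refine Continuous.sub ?_ continuous_const
      exact (hAsub ω hω).comp_continuous (by fun_prop) fun t => mem_Ici.2 (le_max_right _ _)
    · simp only [hg, indicator_of_notMem hω]
      exact continuous_const
  · have h1 := hG.gaussian.comp_right (S := ℝ) fun t => ⟨max t 0, mem_Ici.2 (le_max_right _ _)⟩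
    refine h1.congr fun t => ?_
    filter_upwards [hgG'] with ω h
    exact (h t).symm
  · have : g t =ᵐ[P] G (max t 0) := by filter_upwards [hgG'] with ω h using h t
    rw [integral_congr_ae this, hG.centered _ (le_max_right _ _)]
  · by_cases hω : ω ∈ A
    · simp [hg, indicator_of_mem hω]
    · simp [hg, indicator_of_notMem hω]
  · have hb := ha.trans hab
    have hd := hc.trans hcd
    rw [← rectangle_increment hR hG.continuous_cov ha hab hc hcd]
    have : (fun ω => (g b ω - g a ω) * (g d ω - g c ω)) =ᵐ[P]
        fun ω => G b ω * G d ω - G a ω * G d ω - G b ω * G c ω + G a ω * G c ω := by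
      filter_upwards [hgG] with ω h
      rw [h b hb, h a ha, h d hd, h c hc]; ring
    have hi : ∀ x y, 0 ≤ x → 0 ≤ y → Integrable (fun ω => G x ω * G y ω) P := fun x y hx hy =>
      (hL2 x hx).integrable_mul (hL2 y hy)
    have e1 := integral_add (((hi b d hb hd).sub (hi a d ha hd)).sub (hi b c hb hc)) (hi a c ha hc)
    have e2 := integral_sub ((hi b d hb hd).sub (hi a d ha hd)) (hi b c hb hc)
    have e3 := integral_sub (hi b d hb hd) (hi a d ha hd)
    simp only [Pi.sub_apply] at e1 e2
    rw [integral_congr_ae this, e1, e2, e3]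
    rfl

namespace KernelGaussian
variable {g : ℝ → Ω → ℝ} {K : ℝ → ℝ → ℝ} {β C C' : ℝ} (M : KernelGaussian P g K β C C')
include M

lemma memLp (t : ℝ) {p : ENNReal} (hp : p ≠ ⊤) : MemLp (g t) p P :=
  (M.gaussian.hasGaussianLaw_eval t).memLp hp

lemma kernel_integrableOn {a b c d : ℝ} (ha : 0 ≤ a) (hc : 0 ≤ c) :
    IntegrableOn (fun p : ℝ × ℝ => K p.1 p.2) (Ioc a b ×ˢ Ioc c d) :=
  Integrable.mono' (kernelBound_integrableOn M.half_lt M.lt_one M.C_pos.le M.C'_nonneg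
    ha hc) M.measK.aestronglyMeasurable (Eventually.of_forall fun p => M.boundK p.1 p.2)

lemma exists_integral_abs_kernel_le : ∃ c : ℝ, 0 ≤ c ∧ ∀ a b, 0 ≤ a → a ≤ b →
    ∫ p in Ioc a b ×ˢ Ioc a b, |K p.1 p.2| ≤ c * (b - a) ^ (2 * β) := by
  have h1 := M.half_lt
  have h2 := M.C_pos
  have h3 := M.C'_nonneg
  refine ⟨C * (2 / (2 * β - 1)) + C' * (1 / β ^ 2), ?_, fun a b ha hab => ?_⟩
  · have : 0 < 2 * β - 1 := by linarith
    positivity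
  · refine le_trans ?_ (setIntegral_kernelBound_le h1 M.lt_one h2.le h3 ha hab)
    exact integral_mono (M.kernel_integrableOn ha ha).norm
      (kernelBound_integrableOn h1 M.lt_one h2.le h3 ha ha) fun p => M.boundK p.1 p.2

lemma exists_second_moment_le : ∃ c : ℝ, 0 ≤ c ∧ ∀ s t, 0 ≤ s → s ≤ t →
    ∫ ω, (g t ω - g s ω) ^ 2 ∂P ≤ c * (t - s) ^ (2 * β) := by
  obtain ⟨c, hc, h⟩ := M.exists_integral_abs_kernel_le
  refine ⟨c, hc, fun s t hs hst => (h s t hs hst).trans' ?_⟩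
  simp only [sq]
  rw [M.cov s t s t hs hst hs hst]
  exact (le_abs_self _).trans (abs_integral_le_integral_abs)

lemma exists_fourth_moment_le : ∃ c : ℝ, 0 ≤ c ∧ ∀ s t, 0 ≤ s → s ≤ t →
    ∫⁻ ω, ENNReal.ofReal ((g t ω - g s ω) ^ 4) ∂P ≤ ENNReal.ofReal (c * (t - s) ^ (4 * β)) := by
  obtain ⟨c, hc, h⟩ := M.exists_second_moment_le
  refine ⟨3 * c ^ 2, by positivity, fun s t hs hst => ?_⟩
  have hgl : HasGaussianLaw (fun ω => g t ω - g s ω) P := M.gaussian.hasGaussianLaw_fun_sub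
  have h0 : ∫ ω, g t ω - g s ω ∂P = 0 := by
    rw [integral_sub ((M.memLp t (p := 2) (by simp)).integrable (by norm_num))
      ((M.memLp s (p := 2) (by simp)).integrable (by norm_num)), M.centered, M.centered, sub_zero]
  obtain ⟨hi, h4⟩ := fourth_moment_of_map_eq hgl.aemeasurable (hgl.map_eq_of_centered h0)
  rw [← ofReal_integral_eq_lintegral_ofReal hi (ae_of_all _ fun ω => by positivity), h4]
  refine ENNReal.ofReal_le_ofReal ?_
  have h2 := h s t hs hst
  have h2' : 0 ≤ ∫ ω, (g t ω - g s ω) ^ 2 ∂P := integral_nonneg fun ω => by positivity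
  calc 3 * (∫ ω, (g t ω - g s ω) ^ 2 ∂P) ^ 2 ≤ 3 * (c * (t - s) ^ (2 * β)) ^ 2 := by gcongr
    _ = 3 * c ^ 2 * (t - s) ^ (4 * β) := by
      rw [mul_pow, ← Real.rpow_natCast ((t - s) ^ (2 * β)), ← Real.rpow_mul (by linarith)]
      push_cast; ring_nf

/-- The maximal inequality for `g`. -/
theorem exists_block_bound : ∃ c' : ℝ, 0 ≤ c' ∧ ∀ a L, 0 ≤ a → 0 < L → ∃ N : Ω → ENNReal,
    Measurable N ∧ ∫⁻ ω, N ω ∂P ≤ ENNReal.ofReal (c' * L ^ (4 * β)) ∧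
      ∀ ω, ∀ t ∈ Icc a (a + L), ENNReal.ofReal ((g t ω - g a ω) ^ 4) ≤ N ω := by
  obtain ⟨c, hc, h⟩ := M.exists_fourth_moment_le
  exact exists_maximal_bound M.meas M.cont hc M.half_lt h

/-- On bounded intervals the process is dominated by a random variable with fourth moment. -/
theorem exists_dominating (T : ℝ) : ∃ Y : Ω → ℝ, MemLp Y 4 P ∧ (∀ ω, 1 ≤ Y ω) ∧
    ∀ᵐ ω ∂P, ∀ t ∈ Icc 0 T, |g t ω| ≤ Y ω := by
  obtain ⟨c', hc', h⟩ := M.exists_block_bound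
  obtain ⟨N, hNm, hNi, hN⟩ := h 0 (max T 1) le_rfl (by positivity)
  have hfin : ∫⁻ ω, N ω ∂P ≠ ⊤ := (hNi.trans_lt ENNReal.ofReal_lt_top).ne
  set Z : Ω → ℝ := fun ω => (N ω).toReal ^ ((1 : ℝ) / 4) with hZ
  have hZm : Measurable Z := hNm.ennreal_toReal.pow_const _
  have hZ4 : ∀ ω, Z ω ^ 4 = (N ω).toReal := fun ω => by
    rw [hZ, ← Real.rpow_natCast, ← Real.rpow_mul ENNReal.toReal_nonneg]; norm_num
  have hZ0 : ∀ ω, 0 ≤ Z ω := fun ω => by positivity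
  have hZL : MemLp Z 4 P := by
    rw [← integrable_norm_rpow_iff hZm.aestronglyMeasurable (by norm_num) (by norm_num)]
    refine (integrable_toReal_of_lintegral_ne_top hNm.aemeasurable hfin).congr
      (ae_of_all _ fun ω => ?_)
    have e : (N ω).toReal = Z ω ^ 4 := (hZ4 ω).symm
    show (N ω).toReal = ‖Z ω‖ ^ (4 : ENNReal).toReal
    rw [Real.norm_of_nonneg (hZ0 ω), e, ← Real.rpow_natCast]
    norm_num
  refine ⟨fun ω => Z ω + 1, hZL.add (memLp_const 1), fun ω => by linarith [hZ0 ω], ?_⟩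
  filter_upwards [ae_lt_top hNm hfin] with ω hω t ht
  have h1 := hN ω t ⟨ht.1, by rw [zero_add]; exact ht.2.trans (le_max_left _ _)⟩
  rw [ENNReal.ofReal_le_iff_le_toReal hω.ne, M.zero ω, sub_zero, ← hZ4] at h1
  have h2 : |g t ω| ≤ Z ω := by
    refine le_of_pow_le_pow_left₀ (n := 4) (by norm_num) (hZ0 ω) ?_
    rwa [pow_abs, abs_of_nonneg (by positivity)]
  linarith

end KernelGaussian
end

/-! ### Riemann–Stieltjes sums on uniform grids -/

section Steps

/-- The step function with the value `f ((i + θ) T / n)` on `(i T / n, (i + 1) T / n]`. -/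
noncomputable def stepFun (θ T : ℝ) (f : ℝ → ℝ) (n : ℕ) (u : ℝ) : ℝ :=
  ∑ i ∈ Finset.range n,
    (Ioc (i * T / n) ((i + 1) * T / n)).indicator (fun _ => f ((i + θ) * T / n)) u

lemma measurable_stepFun (θ T : ℝ) (f : ℝ → ℝ) (n : ℕ) : Measurable (stepFun θ T f n) :=
  Finset.measurable_sum _ fun _ _ => measurable_const.indicator measurableSet_Ioc

/-- The evaluation point x depends on u and n but not on f; convergence and bounds for step
functions then follow from those of f. -/
lemma stepFun_spec {θ T : ℝ} (hθ : θ ∈ Icc (0 : ℝ) 1) {n : ℕ} (hn : 0 < n) {u : ℝ}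
    (hu : u ∈ Ioc 0 T) : ∃ x ∈ Icc 0 T, |x - u| ≤ T / n ∧ ∀ f, stepFun θ T f n u = f x := by
  have hT : 0 < T := hu.1.trans_le hu.2
  have hn' : (0 : ℝ) < n := by exact_mod_cast hn
  set w : ℝ := u * n / T with hw
  have hw0 : 0 < w := by have := hu.1; positivity
  have hwn : w ≤ n := by
    rw [hw, div_le_iff₀ hT, mul_comm]; exact mul_le_mul_of_nonneg_left hu.2 hn'.le
  have huw : u = w * T / n := by rw [hw]; field_simp
  -- The grid intervals are open on the left and closed on the right, hence ceiling minus one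
  -- instead of the floor.
  set i : ℕ := ⌈w⌉₊ - 1 with hi
  have hc1 : 1 ≤ ⌈w⌉₊ := Nat.one_le_ceil_iff.2 hw0
  have hci : ((⌈w⌉₊ : ℕ) : ℝ) = (i : ℝ) + 1 := by
    rw [hi, Nat.cast_sub hc1]; simp
  have hi1 : (i : ℝ) < w := by
    have := Nat.ceil_lt_add_one hw0.le
    linarith
  have hi2 : w ≤ (i : ℝ) + 1 := by rw [← hci]; exact Nat.le_ceil w
  have hin : i < n := by
    have : ((i : ℕ) : ℝ) < (n : ℝ) := hi1.trans_le hwn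
    exact_mod_cast this
  have hin' : (i : ℝ) + 1 ≤ n := by exact_mod_cast hin
  refine ⟨(i + θ) * T / n, ⟨?_, ?_⟩, ?_, fun f => ?_⟩
  · have := hθ.1; positivity
  · rw [div_le_iff₀ hn', mul_comm T]
    have := hθ.2
    gcongr
    linarith
  · rw [huw, ← sub_div, ← sub_mul, abs_div, abs_mul, abs_of_pos hT, abs_of_pos hn']
    gcongr
    have : |(i : ℝ) + θ - w| ≤ 1 := by
      have := hθ.1; have := hθ.2
      rw [abs_le]; constructor <;> linarith
    nlinarith
  · rw [stepFun, Finset.sum_eq_single i, indicator_of_mem]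
    · rw [huw]
      constructor
      · gcongr
      · gcongr
    · intro j _ hji
      refine indicator_of_notMem (fun hmem => hji ?_) _
      rw [huw] at hmem
      have h1 : (j : ℝ) < w := by
        have := hmem.1
        rw [div_lt_div_iff_of_pos_right hn', mul_lt_mul_iff_left₀ hT] at this
        exact this
      have h2 : w ≤ j + 1 := by
        have := hmem.2
        rw [div_le_div_iff_of_pos_right hn', mul_le_mul_iff_left₀ hT] at this
        exact this
      have h3 : (j : ℝ) < (i : ℝ) + 1 := h1.trans_le hi2
      have h4 : (i : ℝ) < (j : ℝ) + 1 := hi1.trans_le h2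
      have h5 : j < i + 1 := by exact_mod_cast h3
      have h6 : i < j + 1 := by exact_mod_cast h4
      omega
    · intro h; exact absurd (Finset.mem_range.2 hin) h

lemma tendsto_stepFun {θ T : ℝ} (hθ : θ ∈ Icc (0 : ℝ) 1) {f : ℝ → ℝ} (hf : Continuous f) {u : ℝ}
    (hu : u ∈ Ioc 0 T) : Tendsto (fun n => stepFun θ T f n u) atTop (𝓝 (f u)) := by
  rw [Metric.tendsto_nhds]
  intro ε hε
  obtain ⟨δ, hδ, h⟩ := Metric.continuousAt_iff.1 (hf.continuousAt (x := u)) ε hε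
  have h1 : Tendsto (fun n : ℕ => T / (n : ℝ)) atTop (𝓝 0) := tendsto_const_div_atTop_nhds_zero_nat T
  filter_upwards [h1.eventually_lt_const hδ, eventually_gt_atTop 0] with n hn hn0
  obtain ⟨x, -, hx, hs⟩ := stepFun_spec hθ hn0 hu
  rw [hs]
  exact h (by rw [Real.dist_eq]; exact hx.trans_lt hn)

lemma abs_stepFun_le {θ T : ℝ} (hθ : θ ∈ Icc (0 : ℝ) 1) {f : ℝ → ℝ} {B : ℝ} (hB : 0 ≤ B)
    (hf : ∀ x ∈ Icc 0 T, |f x| ≤ B) (n : ℕ) {u : ℝ} (hu : u ∈ Ioc 0 T) :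
    |stepFun θ T f n u| ≤ B := by
  rcases Nat.eq_zero_or_pos n with rfl | hn
  · simpa [stepFun] using hB
  · obtain ⟨x, hx, -, hs⟩ := stepFun_spec hθ hn hu
    rw [hs]; exact hf x hx

lemma Ioc_grid_subset {T : ℝ} (hT : 0 ≤ T) {n i : ℕ} (hi : i < n) :
    Ioc ((i : ℝ) * T / n) ((i + 1) * T / n) ⊆ Ioc 0 T := by
  have hn' : (0 : ℝ) < n := by exact_mod_cast (Nat.zero_le i).trans_lt hi
  refine Ioc_subset_Ioc (by positivity) ?_
  rw [div_le_iff₀ hn', mul_comm T]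
  have : (i : ℝ) + 1 ≤ n := by exact_mod_cast hi
  gcongr

lemma grid_le {T : ℝ} (hT : 0 ≤ T) (n i : ℕ) : (i : ℝ) * T / n ≤ (i + 1) * T / n := by
  gcongr; linarith

lemma grid_nonneg {T : ℝ} (hT : 0 ≤ T) (n i : ℕ) : 0 ≤ (i : ℝ) * T / n := by positivity

lemma grid_mem_Icc {T : ℝ} (hT : 0 ≤ T) {n i : ℕ} (hi : i ≤ n) : (i : ℝ) * T / n ∈ Icc 0 T := by
  refine ⟨by positivity, ?_⟩
  rcases Nat.eq_zero_or_pos n with rfl | hn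
  · simpa using hT
  rw [div_le_iff₀ (by exact_mod_cast hn), mul_comm T]
  have : (i : ℝ) ≤ n := by exact_mod_cast hi
  gcongr

lemma exists_abs_le_of_continuous {f : ℝ → ℝ} (hf : Continuous f) (T : ℝ) :
    ∃ B, 0 ≤ B ∧ ∀ x ∈ Icc 0 T, |f x| ≤ B := by
  obtain ⟨B, hB⟩ := isCompact_Icc.exists_bound_of_continuousOn (s := Icc 0 T) hf.continuousOn
  exact ⟨max B 0, le_max_right _ _, fun x hx => (hB x hx).trans (le_max_left _ _)⟩

/-- Riemann-Stieltjes sums against an absolutely continuous integrator. -/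
lemma tendsto_riemann {θ T : ℝ} (hθ : θ ∈ Icc (0 : ℝ) 1) (hT : 0 ≤ T) {f h : ℝ → ℝ}
    (hf : Continuous f) (hh : IntegrableOn h (Ioc 0 T)) :
    Tendsto (fun n : ℕ => ∑ i ∈ Finset.range n,
      f ((i + θ) * T / n) * ∫ u in (i * T / n)..((i + 1) * T / n), h u) atTop
      (𝓝 (∫ u in 0..T, f u * h u)) := by
  obtain ⟨B, hB, hfB⟩ := exists_abs_le_of_continuous hf T
  have e : ∀ n : ℕ, ∑ i ∈ Finset.range n,
      f ((i + θ) * T / n) * ∫ u in (i * T / n)..((i + 1) * T / n), h u =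
      ∫ u in Ioc 0 T, stepFun θ T f n u * h u := by
    intro n
    simp only [stepFun, Finset.sum_mul]
    rw [integral_finsetSum]
    · refine Finset.sum_congr rfl fun i hi => ?_
      rw [intervalIntegral.integral_of_le (grid_le hT n i), ← integral_const_mul,
        ← integral_indicator measurableSet_Ioc, ← integral_indicator measurableSet_Ioc]
      congr 1; ext u
      have hsub := Ioc_grid_subset hT (Finset.mem_range.1 hi)
      by_cases hu : u ∈ Ioc ((i : ℝ) * T / n) ((i + 1) * T / n)
      · simp only [indicator_of_mem hu, indicator_of_mem (hsub hu)]
      · rw [indicator_of_notMem hu, indicator_apply, indicator_of_notMem hu, zero_mul, ite_self]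
    · intro i _
      refine Integrable.bdd_mul (c := |f ((i + θ) * T / n)|) hh
        (measurable_const.indicator measurableSet_Ioc).aestronglyMeasurable (ae_of_all _ fun u => ?_)
      exact norm_indicator_le_norm_self _ _
  simp only [e]
  rw [intervalIntegral.integral_of_le hT]
  refine tendsto_integral_of_dominated_convergence (fun u => B * |h u|) (fun n => ?_)
    (hh.norm.const_mul B) (fun n => ?_) ?_
  · exact ((measurable_stepFun θ T f n).aestronglyMeasurable).mul hh.aestronglyMeasurable
  · filter_upwards [ae_restrict_mem measurableSet_Ioc] with u hu
    rw [norm_mul]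
    exact mul_le_mul_of_nonneg_right (abs_stepFun_le hθ hB hfB n hu) (norm_nonneg _)
  · filter_upwards [ae_restrict_mem measurableSet_Ioc] with u hu
    exact (tendsto_stepFun hθ hf hu).mul_const _

lemma abel_sum (a φ : ℕ → ℝ) (n : ℕ) :
    ∑ i ∈ Finset.range n, φ i * (a (i + 1) - a i) =
      φ n * a n - φ 0 * a 0 - ∑ i ∈ Finset.range n, a (i + 1) * (φ (i + 1) - φ i) := by
  induction n with
  | zero => simp
  | succ n ih => rw [Finset.sum_range_succ, ih, Finset.sum_range_succ]; ring

lemma abel_grid (a φ : ℝ → ℝ) (T : ℝ) {n : ℕ} (hn : 0 < n) :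
    ∑ i ∈ Finset.range n, φ (i * T / n) * (a ((i + 1) * T / n) - a (i * T / n)) =
      φ T * a T - φ 0 * a 0 -
      ∑ i ∈ Finset.range n, a ((i + 1) * T / n) * (φ ((i + 1) * T / n) - φ (i * T / n)) := by
  have := abel_sum (fun i => a (i * T / n)) (fun i => φ (i * T / n)) n
  have hn' : (n : ℝ) ≠ 0 := by positivity
  simpa [mul_div_cancel_left₀ _ hn'] using this

/-- Integration by parts for Riemann-Stieltjes sums of a continuously differentiable function. -/
lemma tendsto_stieltjes {T : ℝ} (hT : 0 ≤ T) {a φ φ' : ℝ → ℝ} (ha : Continuous a)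
    (hφ : ∀ x, HasDerivAt φ (φ' x) x) (hφ' : Continuous φ') :
    Tendsto (fun n : ℕ => ∑ i ∈ Finset.range n,
      φ (i * T / n) * (a ((i + 1) * T / n) - a (i * T / n))) atTop
      (𝓝 (φ T * a T - φ 0 * a 0 - ∫ u in 0..T, a u * φ' u)) := by
  have h1 := tendsto_riemann (θ := 1) (by simp) hT ha
    (hφ'.integrableOn_Icc (a := 0) (b := T) |>.mono_set Ioc_subset_Icc_self)
  refine (tendsto_const_nhds.sub h1).congr' ?_
  filter_upwards [eventually_gt_atTop 0] with n hn
  rw [abel_grid a φ T hn]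
  congr 1
  refine Finset.sum_congr rfl fun i _ => ?_
  rw [intervalIntegral.integral_eq_sub_of_hasDerivAt (fun x _ => hφ x)
    (hφ'.intervalIntegrable _ _)]

/-- Writing the double sum as an integral of step functions against K reduces its convergence and
its bounds to dominated convergence with majorant a multiple of |K|. -/
lemma double_sum_eq_integral {T S : ℝ} (hT : 0 ≤ T) (hS : 0 ≤ S) {f h : ℝ → ℝ} {K : ℝ → ℝ → ℝ}
    (hK : IntegrableOn (fun p : ℝ × ℝ => K p.1 p.2) (Ioc 0 T ×ˢ Ioc 0 S)) (n m : ℕ) :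
    ∑ i ∈ Finset.range n, ∑ j ∈ Finset.range m, f (i * T / n) * h (j * S / m) *
      ∫ p in Ioc (i * T / n) ((i + 1) * T / n) ×ˢ Ioc (j * S / m) ((j + 1) * S / m), K p.1 p.2 =
    ∫ p in Ioc 0 T ×ˢ Ioc 0 S, stepFun 0 T f n p.1 * stepFun 0 S h m p.2 * K p.1 p.2 := by
  simp only [stepFun, Finset.sum_mul, Finset.mul_sum, add_zero]
  have hint : ∀ (i j : ℕ), IntegrableOn (fun p : ℝ × ℝ =>
      (Ioc (i * T / n) ((i + 1) * T / n)).indicator (fun _ => f (i * T / n)) p.1 *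
      (Ioc (j * S / m) ((j + 1) * S / m)).indicator (fun _ => h (j * S / m)) p.2 * K p.1 p.2)
      (Ioc 0 T ×ˢ Ioc 0 S) := by
    intro i j
    refine Integrable.bdd_mul (c := |f (i * T / n)| * |h (j * S / m)|) hK ?_ (ae_of_all _ fun u => ?_)
    · exact (((measurable_const.indicator measurableSet_Ioc).comp measurable_fst).mul
        ((measurable_const.indicator measurableSet_Ioc).comp measurable_snd)).aestronglyMeasurable
    · rw [norm_mul]
      exact mul_le_mul (norm_indicator_le_norm_self _ _) (norm_indicator_le_norm_self _ _)
        (norm_nonneg _) (abs_nonneg _)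
  rw [Finset.sum_comm, integral_finsetSum]
  · refine Finset.sum_congr rfl fun j hj => ?_
    rw [integral_finsetSum _ fun i _ => hint i j]
    refine Finset.sum_congr rfl fun i hi => ?_
    have h1 := Ioc_grid_subset hT (Finset.mem_range.1 hi)
    have h2 := Ioc_grid_subset hS (Finset.mem_range.1 hj)
    rw [← integral_const_mul, ← integral_indicator (measurableSet_Ioc.prod measurableSet_Ioc),
      ← integral_indicator (measurableSet_Ioc.prod measurableSet_Ioc)]
    congr 1; ext p
    by_cases hp1 : p.1 ∈ Ioc ((i : ℝ) * T / n) ((i + 1) * T / n)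
    · by_cases hp2 : p.2 ∈ Ioc ((j : ℝ) * S / m) ((j + 1) * S / m)
      · rw [indicator_of_mem (mem_prod.2 ⟨hp1, hp2⟩),
          indicator_of_mem (mem_prod.2 ⟨h1 hp1, h2 hp2⟩), indicator_of_mem hp1, indicator_of_mem hp2]
      · rw [indicator_of_notMem (fun h => hp2 h.2), indicator_apply, indicator_of_notMem hp2]
        simp
    · rw [indicator_of_notMem (fun h => hp1 h.1), indicator_apply, indicator_of_notMem hp1]
      simp
  · intro j _
    exact integrable_finsetSum _ fun i _ => hint i j

/-- The two meshes are refined independently, which is what a Cauchy argument for the step functions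
requires. -/
lemma tendsto_double_sum {T S : ℝ} (hT : 0 ≤ T) (hS : 0 ≤ S) {f h : ℝ → ℝ} {K : ℝ → ℝ → ℝ}
    (hf : Continuous f) (hh : Continuous h)
    (hK : IntegrableOn (fun p : ℝ × ℝ => K p.1 p.2) (Ioc 0 T ×ˢ Ioc 0 S)) :
    Tendsto (fun q : ℕ × ℕ => ∑ i ∈ Finset.range q.1, ∑ j ∈ Finset.range q.2,
      f (i * T / q.1) * h (j * S / q.2) *
      ∫ p in Ioc (i * T / q.1) ((i + 1) * T / q.1) ×ˢ Ioc (j * S / q.2) ((j + 1) * S / q.2),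
        K p.1 p.2) atTop (𝓝 (∫ p in Ioc 0 T ×ˢ Ioc 0 S, f p.1 * h p.2 * K p.1 p.2)) := by
  simp only [double_sum_eq_integral hT hS hK]
  obtain ⟨B, hB, hfB⟩ := exists_abs_le_of_continuous hf T
  obtain ⟨D, hD, hhD⟩ := exists_abs_le_of_continuous hh S
  refine tendsto_integral_filter_of_dominated_convergence (fun p => B * D * |K p.1 p.2|)
    (Eventually.of_forall fun q => ?_) (Eventually.of_forall fun q => ?_) (hK.norm.const_mul (B * D)) ?_
  · exact ((((measurable_stepFun 0 T f q.1).comp measurable_fst).mul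
      ((measurable_stepFun 0 S h q.2).comp measurable_snd)).aestronglyMeasurable).mul
      hK.aestronglyMeasurable
  · filter_upwards [ae_restrict_mem (measurableSet_Ioc.prod measurableSet_Ioc)] with p hp
    rw [norm_mul, norm_mul]
    refine mul_le_mul_of_nonneg_right ?_ (norm_nonneg _)
    exact mul_le_mul (abs_stepFun_le (by simp) hB hfB _ hp.1) (abs_stepFun_le (by simp) hD hhD _ hp.2)
      (norm_nonneg _) hB
  · filter_upwards [ae_restrict_mem (measurableSet_Ioc.prod measurableSet_Ioc)] with p hp
    rw [← prod_atTop_atTop_eq]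
    exact (((tendsto_stepFun (by simp) hf hp.1).comp tendsto_fst).mul
      ((tendsto_stepFun (by simp) hh hp.2).comp tendsto_snd)).mul_const _

lemma abs_double_sum_le {T : ℝ} (hT : 0 ≤ T) {f : ℝ → ℝ} {K : ℝ → ℝ → ℝ} {B : ℝ} (hB : 0 ≤ B)
    (hf : ∀ x ∈ Icc 0 T, |f x| ≤ B)
    (hK : IntegrableOn (fun p : ℝ × ℝ => K p.1 p.2) (Ioc 0 T ×ˢ Ioc 0 T)) (n m : ℕ) :
    |∑ i ∈ Finset.range n, ∑ j ∈ Finset.range m, f (i * T / n) * f (j * T / m) *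
      ∫ p in Ioc (i * T / n) ((i + 1) * T / n) ×ˢ Ioc (j * T / m) ((j + 1) * T / m), K p.1 p.2| ≤
    B ^ 2 * ∫ p in Ioc 0 T ×ˢ Ioc 0 T, |K p.1 p.2| := by
  rw [double_sum_eq_integral hT hT hK, ← integral_const_mul, ← Real.norm_eq_abs]
  refine norm_integral_le_of_norm_le (hK.norm.const_mul (B ^ 2)) ?_
  filter_upwards [ae_restrict_mem (measurableSet_Ioc.prod measurableSet_Ioc)] with p hp
  rw [norm_mul, norm_mul, sq]
  refine mul_le_mul_of_nonneg_right ?_ (norm_nonneg _)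
  exact mul_le_mul (abs_stepFun_le (by simp) hB hf _ hp.1) (abs_stepFun_le (by simp) hB hf _ hp.2)
    (norm_nonneg _) hB

end Steps

/-! ### Continuous functions as elements of 𝔥 -/

section Hilbert
variable {Ω : Type*} [MeasurableSpace Ω] {P : Measure Ω} [IsProbabilityMeasure P]

namespace KernelGaussian
variable {g : ℝ → Ω → ℝ} {K : ℝ → ℝ → ℝ} {β C C' : ℝ} (M : KernelGaussian P g K β C C')
include M

lemma memLp_sub (a b : ℝ) {p : ENNReal} (hp : p ≠ ⊤) : MemLp (fun ω => g b ω - g a ω) p P :=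
  (M.memLp b hp).sub (M.memLp a hp)

lemma indH_eq (a b : ℝ) : indH P g a b = (M.memLp_sub a b (p := 2) (by simp)).toLp _ := by
  rw [indH, dif_pos]

lemma inner_indH {a b c d : ℝ} (ha : 0 ≤ a) (hab : a ≤ b) (hc : 0 ≤ c) (hcd : c ≤ d) :
    inner ℝ (indH P g a b) (indH P g c d) = ∫ p in Ioc a b ×ˢ Ioc c d, K p.1 p.2 := by
  rw [← M.cov a b c d ha hab hc hcd, M.indH_eq, M.indH_eq, L2.inner_def]
  refine integral_congr_ae ?_
  filter_upwards [(M.memLp_sub a b (p := 2) (by simp)).coeFn_toLp,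
    (M.memLp_sub c d (p := 2) (by simp)).coeFn_toLp] with ω h1 h2
  rw [h1, h2, RCLike.inner_apply, conj_trivial, mul_comm]

lemma inner_stepH {T S : ℝ} (hT : 0 ≤ T) (hS : 0 ≤ S) (f h : ℝ → ℝ) (n m : ℕ) :
    inner ℝ (stepH P g T f n) (stepH P g S h m) =
      ∑ i ∈ Finset.range n, ∑ j ∈ Finset.range m, f (i * T / n) * h (j * S / m) *
      ∫ p in Ioc (i * T / n) ((i + 1) * T / n) ×ˢ Ioc (j * S / m) ((j + 1) * S / m), K p.1 p.2 := by
  rw [stepH, stepH, sum_inner]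
  refine Finset.sum_congr rfl fun i _ => ?_
  rw [inner_sum]
  refine Finset.sum_congr rfl fun j _ => ?_
  rw [real_inner_smul_left, real_inner_smul_right, M.inner_indH (grid_nonneg hT n i) (grid_le hT n i)
    (grid_nonneg hS m j) (grid_le hS m j)]
  ring

lemma tendsto_inner_stepH {T S : ℝ} (hT : 0 ≤ T) (hS : 0 ≤ S) {f h : ℝ → ℝ}
    (hf : Continuous f) (hh : Continuous h) :
    Tendsto (fun q : ℕ × ℕ => inner ℝ (stepH P g T f q.1) (stepH P g S h q.2)) atTop
      (𝓝 (∫ p in Ioc 0 T ×ˢ Ioc 0 S, f p.1 * h p.2 * K p.1 p.2)) := by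
  simp only [M.inner_stepH hT hS]
  exact tendsto_double_sum hT hS hf hh (M.kernel_integrableOn le_rfl le_rfl)

/-- ‖s_n - s_m‖² = ⟨s_n,s_n⟩ - 2⟨s_n,s_m⟩ + ⟨s_m,s_m⟩, and the three inner products have the same
limit ∫∫ f f K; so the step functions are Cauchy. -/
lemma exists_representsH {T : ℝ} (hT : 0 ≤ T) {f : ℝ → ℝ} (hf : Continuous f) :
    ∃ h, RepresentsH P g T f h := by
  refine cauchySeq_tendsto_of_complete ?_
  rw [cauchySeq_iff_tendsto_dist_atTop_0]
  have h0 := M.tendsto_inner_stepH hT hT hf hf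
  have t1 : Tendsto (fun q : ℕ × ℕ => (q.1, q.1)) atTop atTop := by
    rw [← prod_atTop_atTop_eq]; exact tendsto_fst.prodMk tendsto_fst
  have t2 : Tendsto (fun q : ℕ × ℕ => (q.2, q.2)) atTop atTop := by
    rw [← prod_atTop_atTop_eq]; exact tendsto_snd.prodMk tendsto_snd
  have h1 := ((h0.comp t1).sub (h0.const_mul 2)).add (h0.comp t2)
  have h2 := h1.sqrt
  rw [show ∀ x : ℝ, √(x - 2 * x + x) = 0 from fun x => by ring_nf; simp] at h2
  refine h2.congr fun q => ?_
  rw [dist_eq_norm, ← Real.sqrt_sq (norm_nonneg _), @norm_sub_sq_real]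
  simp only [Function.comp, real_inner_self_eq_norm_sq]

lemma exists_norm_stepH_le (T : ℝ) (hT : 0 ≤ T) : ∃ c : ℝ, 0 ≤ c ∧ ∀ (f : ℝ → ℝ) (B : ℝ), 0 ≤ B →
    (∀ x ∈ Icc 0 T, |f x| ≤ B) → ∀ n, ‖stepH P g T f n‖ ≤ c * B := by
  refine ⟨√(∫ p in Ioc 0 T ×ˢ Ioc 0 T, |K p.1 p.2|), Real.sqrt_nonneg _, fun f B hB hf n => ?_⟩
  have h0 : 0 ≤ ∫ p in Ioc 0 T ×ˢ Ioc 0 T, |K p.1 p.2| := integral_nonneg fun p => abs_nonneg _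
  refine le_of_sq_le_sq ?_ (by positivity)
  rw [← real_inner_self_eq_norm_sq, M.inner_stepH hT hT, mul_pow, Real.sq_sqrt h0, mul_comm]
  exact (le_abs_self _).trans
    (abs_double_sum_le hT hB hf (M.kernel_integrableOn le_rfl le_rfl) n n)

end KernelGaussian
end Hilbert

/-! ### The Ornstein–Uhlenbeck transform of a continuous path -/

section Path

/-- The path of the centered Ornstein-Uhlenbeck process driven by the path `a`. -/
noncomputable def ou (k : ℝ) (a : ℝ → ℝ) (t : ℝ) : ℝ :=
  a t - k * ∫ s in 0..t, Real.exp (-(k * (t - s))) * a s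

/-- The Riemann-Stieltjes sums of `ou`. -/
noncomputable def ouSum (k : ℝ) (a : ℝ → ℝ) (t : ℝ) (n : ℕ) : ℝ :=
  ∑ i ∈ Finset.range n, Real.exp (-(k * (t - i * t / n))) *
    (a ((i + 1) * t / n) - a (i * t / n))

/-- `ou` is the Stieltjes integral of e^{-k(t-s)} against a, which exists by parts for any
continuous a. The sums are finite linear combinations of values of a, so they are Gaussian when a is
a path of g. -/
lemma tendsto_ouSum (k : ℝ) {a : ℝ → ℝ} (ha : Continuous a) (ha0 : a 0 = 0) {t : ℝ} (ht : 0 ≤ t) :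
    Tendsto (ouSum k a t) atTop (𝓝 (ou k a t)) := by
  have h1 : ∀ x, HasDerivAt (fun x => Real.exp (-(k * (t - x)))) (k * Real.exp (-(k * (t - x)))) x := by
    intro x
    have : HasDerivAt (fun x : ℝ => -(k * (t - x))) k x := by
      have := (((hasDerivAt_id x).const_sub t).const_mul k).neg
      exact this.congr_deriv (by ring)
    exact this.exp.congr_deriv (by ring)
  have := tendsto_stieltjes ht ha h1 (by fun_prop)
  refine (this.congr fun n => rfl).congr' EventuallyEq.rfl |>.trans (le_of_eq ?_)
  congr 1
  rw [ou, ha0, ← intervalIntegral.integral_const_mul]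
  simp only [sub_self, mul_zero, neg_zero, Real.exp_zero, one_mul, sub_zero]
  congr 2; ext x; ring

/-- After Abel summation the weights are the increments of an increasing function with values in
[0,1], so the sum part costs at most Y and the boundary term another Y, whatever n and t are. -/
lemma abs_ouSum_le {k : ℝ} (hk : 0 < k) {a : ℝ → ℝ} (ha0 : a 0 = 0) {t Y : ℝ} (ht : 0 ≤ t)
    (hY : 0 ≤ Y) (ha : ∀ x ∈ Icc 0 t, |a x| ≤ Y) (n : ℕ) : |ouSum k a t n| ≤ 2 * Y := by
  rcases Nat.eq_zero_or_pos n with rfl | hn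
  · simp [ouSum]; linarith
  have hn' : (0 : ℝ) < n := by exact_mod_cast hn
  set φ : ℝ → ℝ := fun x => Real.exp (-(k * (t - x))) with hφ
  have e : ouSum k a t n = φ t * a t - φ 0 * a 0 -
      ∑ i ∈ Finset.range n, a ((i + 1) * t / n) * (φ ((i + 1) * t / n) - φ (i * t / n)) :=
    abel_grid a φ t hn
  have hmono : ∀ i : ℕ, φ (i * t / n) ≤ φ ((i + 1) * t / n) := by
    intro i
    simp only [hφ]
    have := grid_le ht n i
    gcongr
  have hφt : φ t = 1 := by simp [hφ]
  have hφ0 : 0 ≤ φ 0 := (Real.exp_pos _).le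
  have hsum : |∑ i ∈ Finset.range n, a ((i + 1) * t / n) * (φ ((i + 1) * t / n) - φ (i * t / n))|
      ≤ Y * (φ t - φ 0) := by
    refine (Finset.abs_sum_le_sum_abs _ _).trans ?_
    have htel : ∑ i ∈ Finset.range n, (φ ((i + 1) * t / n) - φ (i * t / n)) = φ t - φ 0 := by
      have := Finset.sum_range_sub (fun i : ℕ => φ (i * t / n)) n
      simpa [mul_div_cancel_left₀ _ hn'.ne'] using this
    rw [← htel, Finset.mul_sum]
    refine Finset.sum_le_sum fun i hi => ?_
    rw [abs_mul, abs_of_nonneg (sub_nonneg.2 (hmono i))]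
    refine mul_le_mul_of_nonneg_right (ha _ ?_) (sub_nonneg.2 (hmono i))
    have := grid_mem_Icc ht (n := n) (i := i + 1) (Finset.mem_range.1 hi)
    push_cast at this
    exact this
  have hat : |a t| ≤ Y := ha t ⟨ht, le_rfl⟩
  rw [e, ha0, hφt]
  rw [hφt] at hsum
  have := abs_le.1 hsum
  have := abs_le.1 hat
  rw [abs_le]
  constructor <;> nlinarith

lemma abs_ou_le {k : ℝ} (hk : 0 < k) {a : ℝ → ℝ} (hac : Continuous a) (ha0 : a 0 = 0) {t Y : ℝ}
    (ht : 0 ≤ t) (hY : 0 ≤ Y) (ha : ∀ x ∈ Icc 0 t, |a x| ≤ Y) : |ou k a t| ≤ 2 * Y :=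
  le_of_tendsto (tendsto_ouSum k hac ha0 ht).abs
    (Eventually.of_forall fun n => abs_ouSum_le hk ha0 ht hY ha n)

lemma ou_eq (k : ℝ) (a : ℝ → ℝ) (t : ℝ) :
    ou k a t = a t - k * (Real.exp (-(k * t)) * ∫ s in 0..t, Real.exp (k * s) * a s) := by
  have h : ∫ s in 0..t, Real.exp (-(k * (t - s))) * a s =
      Real.exp (-(k * t)) * ∫ s in 0..t, Real.exp (k * s) * a s := by
    rw [← intervalIntegral.integral_const_mul]
    refine intervalIntegral.integral_congr fun s _ => ?_
    rw [← mul_assoc, ← Real.exp_add]; congr 2; ring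
  rw [ou, h]

lemma hasDerivAt_primitive {a : ℝ → ℝ} (ha : Continuous a) (t : ℝ) :
    HasDerivAt (fun t => ∫ s in 0..t, a s) (a t) t :=
  intervalIntegral.integral_hasDerivAt_right (ha.intervalIntegrable _ _)
    (ha.stronglyMeasurableAtFilter _ _) ha.continuousAt

lemma continuous_primitive' {a : ℝ → ℝ} (ha : Continuous a) :
    Continuous (fun t => ∫ s in 0..t, a s) :=
  continuous_iff_continuousAt.2 fun t => (hasDerivAt_primitive ha t).continuousAt

lemma continuous_ou (k : ℝ) {a : ℝ → ℝ} (ha : Continuous a) : Continuous (ou k a) := by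
  have : ou k a = fun t => a t - k * (Real.exp (-(k * t)) * ∫ s in 0..t, Real.exp (k * s) * a s) :=
    funext (ou_eq k a)
  rw [this]
  have h := continuous_primitive' (a := fun s => Real.exp (k * s) * a s) (by fun_prop)
  fun_prop

/-- Variation of constants. -/
lemma primitive_eq_of_linear {k : ℝ} {p b : ℝ → ℝ} (hb : Continuous b) (hp0 : p 0 = 0)
    (hpc : ContinuousOn p (Ici 0)) (hp : ∀ t, 0 < t → HasDerivAt p (b t - k * p t) t) {t : ℝ}
    (ht : 0 ≤ t) : p t = Real.exp (-(k * t)) * ∫ s in 0..t, Real.exp (k * s) * b s := by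
  have h1 : ∫ s in 0..t, Real.exp (k * s) * b s = Real.exp (k * t) * p t - Real.exp (k * 0) * p 0 := by
    refine MeasureTheory.integral_eq_of_hasDerivAt_off_countable_of_le
      (fun s => Real.exp (k * s) * p s) _ ht countable_empty ?_ (fun x hx => ?_) ?_
    · exact (by fun_prop : Continuous fun s : ℝ => Real.exp (k * s)).continuousOn.mul
        (hpc.mono Icc_subset_Ici_self)
    · have e1 : HasDerivAt (fun s : ℝ => Real.exp (k * s)) (k * Real.exp (k * x)) x := by
        have : HasDerivAt (fun s : ℝ => k * s) k x := by
          simpa using (hasDerivAt_id x).const_mul k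
        exact this.exp.congr_deriv (by ring)
      exact (e1.mul (hp x hx.1.1)).congr_deriv (by ring)
    · exact (by fun_prop : Continuous fun s : ℝ => Real.exp (k * s) * b s).intervalIntegrable _ _
  rw [h1, hp0, mul_zero, sub_zero, ← mul_assoc, ← Real.exp_add]
  simp

lemma integral_exp_mul (k : ℝ) (hk : k ≠ 0) (t : ℝ) :
    ∫ s in 0..t, Real.exp (k * s) = (Real.exp (k * t) - 1) / k := by
  have := intervalIntegral.integral_eq_sub_of_hasDerivAt (a := 0) (b := t)
    (f := fun s => Real.exp (k * s) / k) (f' := fun s => Real.exp (k * s)) (fun x _ => ?_)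
    ((by fun_prop : Continuous fun s : ℝ => Real.exp (k * s)).intervalIntegrable _ _)
  · rw [this]; simp; ring
  · have h : HasDerivAt (fun s : ℝ => k * s) k x := by simpa using (hasDerivAt_id x).const_mul k
    exact (h.exp.div_const k).congr_deriv (by field_simp)

/-- The function e^{-kt} ∫_0^t e^{ks} a(s) ds is a primitive of `ou k a` that vanishes at 0. -/
lemma ou_eq_sub_integral {k : ℝ} {a : ℝ → ℝ} (ha : Continuous a) (t : ℝ) :
    ou k a t = a t - k * ∫ s in 0..t, ou k a s := by
  set p : ℝ → ℝ := fun t => Real.exp (-(k * t)) * ∫ s in 0..t, Real.exp (k * s) * a s with hp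
  have hpd : ∀ t, HasDerivAt p (ou k a t) t := by
    intro t
    have e1 : HasDerivAt (fun t : ℝ => Real.exp (-(k * t))) (-k * Real.exp (-(k * t))) t := by
      have : HasDerivAt (fun s : ℝ => -(k * s)) (-k) t := by
        exact ((hasDerivAt_id t).const_mul k).neg.congr_deriv (by simp)
      exact this.exp.congr_deriv (by ring)
    have e2 := hasDerivAt_primitive (a := fun s => Real.exp (k * s) * a s) (by fun_prop) t
    refine (e1.mul e2).congr_deriv ?_
    rw [ou_eq, ← mul_assoc (Real.exp (-(k * t))) (Real.exp (k * t)), ← Real.exp_add]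
    simp; ring
  rw [intervalIntegral.integral_eq_sub_of_hasDerivAt (fun x _ => hpd x)
    ((continuous_ou k ha).intervalIntegrable _ _)]
  rw [ou_eq, hp]
  simp

/-- The mean of the solution. -/
noncomputable def meanPath (k μ t : ℝ) : ℝ := μ * (1 - Real.exp (-(k * t)))

lemma continuous_meanPath (k μ : ℝ) : Continuous (meanPath k μ) := by
  unfold meanPath; fun_prop

/-- Uniqueness of the solution of the linear equation. -/
lemma solution_eq {k μ : ℝ} (hk : 0 < k) {a x : ℝ → ℝ} (ha : Continuous a)
    (hx : ContinuousOn x (Ici 0))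
    (hsol : ∀ t, 0 ≤ t → x t = (∫ s in (0 : ℝ)..t, k * (μ - x s)) + a t) {t : ℝ} (ht : 0 ≤ t) :
    x t = meanPath k μ t + ou k a t := by
  set y : ℝ → ℝ := fun t => x (max t 0) with hy
  have hyc : Continuous y :=
    hx.comp_continuous (by fun_prop) fun t => mem_Ici.2 (le_max_right _ _)
  have hxy : ∀ t, 0 ≤ t → y t = x t := fun t ht => by simp only [hy, max_eq_left ht]
  set p : ℝ → ℝ := fun t => ∫ s in 0..t, y s with hp
  have hpd : ∀ t, HasDerivAt p (y t) t := hasDerivAt_primitive hyc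
  have hyp : ∀ t, 0 ≤ t → y t = k * μ * t + a t - k * p t := by
    intro t ht
    rw [hxy t ht, hsol t ht]
    have : ∫ s in (0 : ℝ)..t, k * (μ - x s) = ∫ s in (0 : ℝ)..t, (k * μ - k * y s) := by
      refine intervalIntegral.integral_congr fun s hs => ?_
      rw [uIcc_of_le ht] at hs
      rw [hxy s hs.1]; ring
    rw [this, intervalIntegral.integral_sub (by simp) ((hyc.const_mul k |>.intervalIntegrable _ _)),
      intervalIntegral.integral_const_mul k y, intervalIntegral.integral_const]
    simp only [smul_eq_mul, hp]; ring
  -- The equation is solved for the primitive p of the solution, because p' = kμt + a - kp makes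
  -- sense for a path a that is merely continuous.
  have hpt := primitive_eq_of_linear (k := k) (p := p) (b := fun t => k * μ * t + a t) (by fun_prop)
    (by simp [hp]) (continuous_primitive' hyc).continuousOn
    (fun s hs => (hpd s).congr_deriv (hyp s hs.le)) ht
  -- The same formula read backwards: the explicit solution for a = 0 evaluates the integral of
  -- e^{ks} kμs.
  have h2 := primitive_eq_of_linear (k := k) (p := fun t => μ * t - μ * (1 - Real.exp (-(k * t))) / k)
    (b := fun t => k * μ * t) (by fun_prop) (by simp) (by fun_prop) (fun s hs => ?_) ht
  · rw [← hxy t ht, hyp t ht, ou_eq, hpt]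
    have hadd : ∫ s in 0..t, Real.exp (k * s) * (k * μ * s + a s) =
        (∫ s in 0..t, Real.exp (k * s) * (k * μ * s)) + ∫ s in 0..t, Real.exp (k * s) * a s := by
      rw [← intervalIntegral.integral_add]
      · congr 1; ext s; ring
      · exact (by fun_prop : Continuous fun s : ℝ => Real.exp (k * s) * (k * μ * s)).intervalIntegrable _ _
      · exact (by fun_prop : Continuous fun s : ℝ => Real.exp (k * s) * a s).intervalIntegrable _ _
    rw [hadd, mul_add, ← h2, meanPath]
    field_simp; ring
  · have e1 : HasDerivAt (fun t : ℝ => Real.exp (-(k * t))) (-k * Real.exp (-(k * s))) s := by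
      have : HasDerivAt (fun s : ℝ => -(k * s)) (-k) s := by
        exact ((hasDerivAt_id s).const_mul k).neg.congr_deriv (by simp)
      exact this.exp.congr_deriv (by ring)
    have e2 := ((hasDerivAt_id s).const_mul μ).sub (((e1.const_sub 1).const_mul μ).div_const k)
    refine e2.congr_deriv ?_
    field_simp; ring

/-- The flow property of `ou`. -/
lemma ou_add {k : ℝ} (hk : 0 < k) {a : ℝ → ℝ} (ha : Continuous a) (s r : ℝ) :
    ou k a (s + r) = Real.exp (-(k * r)) * ou k a s + ou k (fun u => a (s + u) - a s) r := by
  rw [ou_eq, ou_eq, ou_eq]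
  have hc : Continuous fun u : ℝ => Real.exp (k * u) * a u := by fun_prop
  have h1 : ∫ u in 0..(s + r), Real.exp (k * u) * a u =
      (∫ u in 0..s, Real.exp (k * u) * a u) + ∫ u in s..(s + r), Real.exp (k * u) * a u :=
    (intervalIntegral.integral_add_adjacent_intervals (hc.intervalIntegrable _ _)
      (hc.intervalIntegrable _ _)).symm
  have h2 : ∫ u in s..(s + r), Real.exp (k * u) * a u =
      ∫ u in 0..r, Real.exp (k * (s + u)) * a (s + u) := by
    have := intervalIntegral.integral_comp_add_left (a := 0) (b := r)
      (fun u => Real.exp (k * u) * a u) s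
    rw [add_zero] at this
    exact this.symm
  have h3 : ∫ u in 0..r, Real.exp (k * u) * (a (s + u) - a s) =
      Real.exp (-(k * s)) * (∫ u in 0..r, Real.exp (k * (s + u)) * a (s + u)) -
        a s * ((Real.exp (k * r) - 1) / k) := by
    rw [← integral_exp_mul k hk.ne', ← intervalIntegral.integral_const_mul,
      ← intervalIntegral.integral_const_mul, ← intervalIntegral.integral_sub]
    · congr 1; ext u
      have : Real.exp (k * u) = Real.exp (-(k * s)) * Real.exp (k * (s + u)) := by
        rw [← Real.exp_add]; congr 1; ring
      rw [mul_sub, ← mul_assoc, ← this]; ring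
    · exact (by fun_prop : Continuous fun u : ℝ => Real.exp (-(k * s)) *
        (Real.exp (k * (s + u)) * a (s + u))).intervalIntegrable _ _
    · exact (by fun_prop : Continuous fun u : ℝ => a s * Real.exp (k * u)).intervalIntegrable _ _
  have e1 : Real.exp (-(k * (s + r))) = Real.exp (-(k * s)) * Real.exp (-(k * r)) := by
    rw [← Real.exp_add]; congr 1; ring
  have e2 : Real.exp (k * r) = (Real.exp (-(k * r)))⁻¹ := by rw [Real.exp_neg, inv_inv]
  rw [h1, h2, h3, e1, e2]
  have := (Real.exp_pos (-(k * r))).ne'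
  field_simp
  ring

end Path

/-! ### Gaussian limits, Isserlis' formula and the covariance of the Ornstein–Uhlenbeck process -/

section Prob
variable {Ω : Type*} [MeasurableSpace Ω] {P : Measure Ω} [IsProbabilityMeasure P]

/-- A dominated limit of centered Gaussian random variables is Gaussian. -/
lemma map_eq_gaussianReal_of_tendsto {W : ℕ → Ω → ℝ} {V Y : Ω → ℝ}
    (hW : ∀ n, HasGaussianLaw (W n) P) (hW0 : ∀ n, ∫ ω, W n ω ∂P = 0) (hV : AEMeasurable V P)
    (hlim : ∀ᵐ ω ∂P, Tendsto (fun n => W n ω) atTop (𝓝 (V ω)))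
    (hY : Integrable (fun ω => Y ω ^ 2) P) (hdom : ∀ n, ∀ᵐ ω ∂P, |W n ω| ≤ Y ω) :
    P.map V = gaussianReal 0 (∫ ω, V ω ^ 2 ∂P).toNNReal := by
  have hprob : IsProbabilityMeasure (P.map V) := Measure.isProbabilityMeasure_map hV
  refine Measure.ext_of_charFun (funext fun t => ?_)
  -- Variances and characteristic functions both pass to the limit by domination, so the limit has
  -- the characteristic function of a Gaussian law with the limiting variance.
  have hsq : Tendsto (fun n => ∫ ω, W n ω ^ 2 ∂P) atTop (𝓝 (∫ ω, V ω ^ 2 ∂P)) := by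
    refine tendsto_integral_of_dominated_convergence (fun ω => Y ω ^ 2)
      (fun n => ((hW n).aemeasurable.pow_const 2).aestronglyMeasurable) hY (fun n => ?_) ?_
    · filter_upwards [hdom n] with ω h
      rw [norm_pow, Real.norm_eq_abs]
      exact pow_le_pow_left₀ (abs_nonneg _) h 2
    · filter_upwards [hlim] with ω h using h.pow 2
  have hchar : Tendsto (fun n => charFun (P.map (W n)) t) atTop (𝓝 (charFun (P.map V) t)) := by
    have e : ∀ {U : Ω → ℝ}, AEMeasurable U P →
        charFun (P.map U) t = ∫ ω, Complex.exp (t * U ω * Complex.I) ∂P := by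
      intro U hU
      rw [charFun_apply_real, integral_map hU (by fun_prop)]
    rw [e hV]
    simp only [e (hW _).aemeasurable]
    refine tendsto_integral_of_dominated_convergence (fun _ => 1) (fun n => ?_)
      (integrable_const _) (fun n => ae_of_all _ fun ω => ?_) ?_
    · have := (hW n).aemeasurable
      exact AEMeasurable.aestronglyMeasurable (by fun_prop)
    · rw [← Complex.ofReal_mul, Complex.norm_exp_ofReal_mul_I]
    · filter_upwards [hlim] with ω h
      exact (Complex.continuous_exp.tendsto _).comp
        (((Complex.continuous_ofReal.tendsto _).comp h).const_mul _ |>.mul_const _)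
  refine tendsto_nhds_unique hchar ?_
  have e2 : ∀ n, charFun (P.map (W n)) t =
      Complex.exp (-((∫ ω, W n ω ^ 2 ∂P : ℝ) : ℂ) * t ^ 2 / 2) := by
    intro n
    rw [(hW n).map_eq_of_centered (hW0 n), charFun_gaussianReal]
    rw [Real.coe_toNNReal _ (integral_nonneg fun ω => by positivity)]
    congr 1; push_cast; ring
  simp only [e2]
  rw [charFun_gaussianReal, Real.coe_toNNReal _ (integral_nonneg fun ω => by positivity)]
  have : (t * (0 : ℝ) * Complex.I - ((∫ ω, V ω ^ 2 ∂P : ℝ) : ℂ) * t ^ 2 / 2 : ℂ) =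
      -((∫ ω, V ω ^ 2 ∂P : ℝ) : ℂ) * t ^ 2 / 2 := by push_cast; ring
  rw [this]
  refine (Complex.continuous_exp.tendsto _).comp ?_
  exact ((((Complex.continuous_ofReal.tendsto _).comp hsq).neg).mul_const _).div_const _

lemma _root_.MeasureTheory.MemLp.sq_of_four {U : Ω → ℝ} (hU : MemLp U 4 P) :
    MemLp (fun ω => U ω ^ 2) 2 P := by
  have := hU.norm_rpow_div (q := 2)
  have e : (4 : ENNReal) / 2 = 2 := by
    rw [show (4 : ENNReal) = 2 * 2 by norm_num]
    exact ENNReal.mul_div_cancel_right (by simp) (by simp)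
  rw [e] at this
  refine this.congr_norm (hU.aestronglyMeasurable.pow 2) (ae_of_all _ fun ω => ?_)
  simp

lemma _root_.MeasureTheory.MemLp.integrable_pow_four {U : Ω → ℝ} (hU : MemLp U 4 P) :
    Integrable (fun ω => U ω ^ 4) P := by
  refine hU.sq_of_four.integrable_sq.congr (ae_of_all _ fun ω => ?_)
  ring

lemma integral_add_add {f g h : Ω → ℝ} (hf : Integrable f P) (hg : Integrable g P)
    (hh : Integrable h P) :
    ∫ ω, (f ω + g ω + h ω) ∂P = (∫ ω, f ω ∂P) + (∫ ω, g ω ∂P) + ∫ ω, h ω ∂P := by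
  rw [← integral_add hf hg]
  exact integral_add (hf.add hg) hh

/-- Isserlis' formula follows from the fourth moments of the linear combinations. -/
lemma isserlis_of_fourth {U V : Ω → ℝ} (hU : MemLp U 4 P) (hV : MemLp V 4 P)
    (h : ∀ a b : ℝ, ∫ ω, (a * U ω + b * V ω) ^ 4 ∂P = 3 * (∫ ω, (a * U ω + b * V ω) ^ 2 ∂P) ^ 2) :
    ∫ ω, U ω ^ 2 * V ω ^ 2 ∂P =
      (∫ ω, U ω ^ 2 ∂P) * (∫ ω, V ω ^ 2 ∂P) + 2 * (∫ ω, U ω * V ω ∂P) ^ 2 := by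
  have hU' : MemLp U 2 P := hU.mono_exponent (by norm_num)
  have hV' : MemLp V 2 P := hV.mono_exponent (by norm_num)
  have i20 := hU'.integrable_sq
  have i02 := hV'.integrable_sq
  have i11 : Integrable (fun ω => U ω * V ω) P := hU'.integrable_mul hV'
  have i40 := hU.integrable_pow_four
  have i04 := hV.integrable_pow_four
  have i22 : Integrable (fun ω => U ω ^ 2 * V ω ^ 2) P := hU.sq_of_four.integrable_mul hV.sq_of_four
  have i4p : Integrable (fun ω => (U ω + V ω) ^ 4) P := (hU.add hV).integrable_pow_four
  have i4m : Integrable (fun ω => (U ω - V ω) ^ 4) P := (hU.sub hV).integrable_pow_four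
  -- The identity (U+V)⁴ + (U-V)⁴ = 2U⁴ + 12U²V² + 2V⁴ isolates the mixed moment; the other two
  -- choices of coefficients give the pure fourth moments.
  have a1 := h 1 1
  have a2 := h 1 (-1)
  have a3 := h 1 0
  have a4 := h 0 1
  simp only [one_mul, zero_mul, add_zero, zero_add, neg_mul, ← sub_eq_add_neg] at a1 a2 a3 a4
  have s1 : ∫ ω, (U ω + V ω) ^ 2 ∂P =
      (∫ ω, U ω ^ 2 ∂P) + 2 * (∫ ω, U ω * V ω ∂P) + ∫ ω, V ω ^ 2 ∂P := by
    rw [← integral_const_mul, ← integral_add_add i20 (i11.const_mul 2) i02]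
    congr 1; ext ω; ring
  have s2 : ∫ ω, (U ω - V ω) ^ 2 ∂P =
      (∫ ω, U ω ^ 2 ∂P) + -2 * (∫ ω, U ω * V ω ∂P) + ∫ ω, V ω ^ 2 ∂P := by
    rw [← integral_const_mul, ← integral_add_add i20 (i11.const_mul (-2)) i02]
    congr 1; ext ω; ring
  have s3 : (∫ ω, (U ω + V ω) ^ 4 ∂P) + ∫ ω, (U ω - V ω) ^ 4 ∂P =
      2 * (∫ ω, U ω ^ 4 ∂P) + 2 * (∫ ω, V ω ^ 4 ∂P) + 12 * ∫ ω, U ω ^ 2 * V ω ^ 2 ∂P := by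
    rw [← integral_const_mul, ← integral_const_mul, ← integral_const_mul, ← integral_add i4p i4m,
      ← integral_add_add (i40.const_mul 2) (i04.const_mul 2) (i22.const_mul 12)]
    congr 1; ext ω; ring
  rw [a1, a2, a3, a4, s1, s2] at s3
  linarith

namespace KernelGaussian
variable {g : ℝ → Ω → ℝ} {K : ℝ → ℝ → ℝ} {β C C' : ℝ} (M : KernelGaussian P g K β C C')
include M

/-- The linear span of the values of a Gaussian process is a Gaussian process. -/
lemma isGaussianProcess_of_span {S : Type*} {Y : S → Ω → ℝ}
    (h : ∀ s, Y s ∈ Submodule.span ℝ (range g)) : IsGaussianProcess Y P := by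
  have h' : ∀ s, ∃ c : ℝ →₀ ℝ, (c.sum fun i x => x • g i) = Y s := fun s =>
    Finsupp.mem_span_range_iff_exists_finsupp.1 (h s)
  choose c hc using h'
  refine IsGaussianProcess.of_isGaussianProcess M.gaussian fun s => ⟨(c s).support,
    ∑ i : (c s).support, c s i • ContinuousLinearMap.proj (R := ℝ) (φ := fun _ : (c s).support => ℝ) i,
    fun ω => ?_⟩
  rw [← hc s, Finsupp.sum]
  simp only [Finset.sum_apply, Pi.smul_apply, smul_eq_mul, _root_.sum_apply,
    _root_.smul_apply, ContinuousLinearMap.proj_apply, Finset.restrict]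
  exact (Finset.sum_coe_sort (c s).support fun i => c s i * g i ω).symm

lemma hasGaussianLaw_of_span {Y : Ω → ℝ} (h : Y ∈ Submodule.span ℝ (range g)) :
    HasGaussianLaw Y P :=
  (M.isGaussianProcess_of_span (S := Unit) (Y := fun _ => Y) fun _ => h).hasGaussianLaw_eval ()

lemma centered_of_span {Y : Ω → ℝ} (h : Y ∈ Submodule.span ℝ (range g)) : ∫ ω, Y ω ∂P = 0 := by
  have hi : ∀ {Y}, Y ∈ Submodule.span ℝ (range g) → Integrable Y P := fun h =>
    (M.hasGaussianLaw_of_span h).integrable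
  induction h using Submodule.span_induction with
  | mem x hx => obtain ⟨t, rfl⟩ := hx; exact M.centered t
  | zero => simp
  | add x y hx hy h1 h2 =>
    simp only [Pi.add_apply]
    rw [integral_add (hi hx) (hi hy), h1, h2, add_zero]
  | smul a x hx h1 => simp only [Pi.smul_apply, smul_eq_mul]; rw [integral_const_mul, h1, mul_zero]

lemma measurable_of_span {Y : Ω → ℝ} (h : Y ∈ Submodule.span ℝ (range g)) : Measurable Y := by
  induction h using Submodule.span_induction with
  | mem x hx => obtain ⟨t, rfl⟩ := hx; exact M.meas t
  | zero => exact measurable_zero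
  | add x y hx hy h1 h2 => exact h1.add h2
  | smul a x hx h1 => exact h1.const_smul a

lemma sub_mem_span (a b : ℝ) : (fun ω => g b ω - g a ω) ∈ Submodule.span ℝ (range g) :=
  Submodule.sub_mem _ (Submodule.subset_span ⟨b, rfl⟩) (Submodule.subset_span ⟨a, rfl⟩)

lemma ouSum_mem_span (k t : ℝ) (n : ℕ) :
    (fun ω => ouSum k (fun s => g s ω) t n) ∈ Submodule.span ℝ (range g) := by
  have : (fun ω => ouSum k (fun s => g s ω) t n) = ∑ i ∈ Finset.range n,
      Real.exp (-(k * (t - i * t / n))) • fun ω => g ((i + 1) * t / n) ω - g (i * t / n) ω := by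
    ext ω; simp [ouSum]
  rw [this]
  exact Submodule.sum_mem _ fun i _ => Submodule.smul_mem _ _ (M.sub_mem_span _ _)

lemma measurable_ou (k : ℝ) {t : ℝ} (ht : 0 ≤ t) : Measurable fun ω => ou k (fun s => g s ω) t :=
  measurable_of_tendsto_metrizable (fun n => M.measurable_of_span (M.ouSum_mem_span k t n))
    (tendsto_pi_nhds.2 fun ω => tendsto_ouSum k (M.cont ω) (M.zero ω) ht)

/-- The Ornstein-Uhlenbeck process is dominated on bounded intervals. -/
lemma exists_dominating_ou {k : ℝ} (hk : 0 < k) (T : ℝ) : ∃ Y : Ω → ℝ, MemLp Y 4 P ∧ (∀ ω, 1 ≤ Y ω) ∧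
    ∀ᵐ ω ∂P, ∀ t ∈ Icc 0 T, |g t ω| ≤ Y ω ∧ |ou k (fun s => g s ω) t| ≤ Y ω ∧
      ∀ n, |ouSum k (fun s => g s ω) t n| ≤ Y ω := by
  obtain ⟨Y, hY, hY1, h⟩ := M.exists_dominating T
  refine ⟨fun ω => 2 * Y ω, hY.const_mul 2, fun ω => by linarith [hY1 ω], ?_⟩
  filter_upwards [h] with ω hω t ht
  have hY0 : 0 ≤ Y ω := by linarith [hY1 ω]
  have h' : ∀ x ∈ Icc 0 t, |g x ω| ≤ Y ω := fun x hx => hω x ⟨hx.1, hx.2.trans ht.2⟩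
  exact ⟨(hω t ht).trans (by linarith), abs_ou_le hk (M.cont ω) (M.zero ω) ht.1 hY0 h',
    fun n => abs_ouSum_le hk (M.zero ω) ht.1 hY0 h' n⟩

lemma memLp_ou {k : ℝ} (hk : 0 < k) {t : ℝ} (ht : 0 ≤ t) :
    MemLp (fun ω => ou k (fun s => g s ω) t) 4 P := by
  obtain ⟨Y, hY, -, h⟩ := M.exists_dominating_ou hk t
  refine hY.mono (M.measurable_ou k ht).aestronglyMeasurable ?_
  filter_upwards [h] with ω hω
  exact ((hω t ⟨ht, le_rfl⟩).2.1).trans (le_abs_self _)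

/-- The covariance of the Ornstein-Uhlenbeck process. -/
lemma cov_ou {k : ℝ} (hk : 0 < k) {t s : ℝ} (ht : 0 ≤ t) (hs : 0 ≤ s) :
    ∫ ω, ou k (fun r => g r ω) t * ou k (fun r => g r ω) s ∂P =
      ∫ p in Ioc 0 t ×ˢ Ioc 0 s,
        Real.exp (-(k * (t - p.1))) * Real.exp (-(k * (s - p.2))) * K p.1 p.2 := by
  obtain ⟨Y, hY, hY1, h⟩ := M.exists_dominating_ou hk (max t s)
  have hY2 : MemLp Y 2 P := hY.mono_exponent (by norm_num)
  have l1 : Tendsto (fun n => ∫ ω, ouSum k (fun r => g r ω) t n * ouSum k (fun r => g r ω) s n ∂P) atTop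
      (𝓝 (∫ ω, ou k (fun r => g r ω) t * ou k (fun r => g r ω) s ∂P)) := by
    refine tendsto_integral_of_dominated_convergence (fun ω => Y ω ^ 2) (fun n => ?_)
      hY2.integrable_sq (fun n => ?_) (ae_of_all _ fun ω => ?_)
    · exact ((M.measurable_of_span (M.ouSum_mem_span k t n)).mul
        (M.measurable_of_span (M.ouSum_mem_span k s n))).aestronglyMeasurable
    · filter_upwards [h] with ω hω
      rw [norm_mul, sq]
      exact mul_le_mul ((hω t ⟨ht, le_max_left _ _⟩).2.2 n) ((hω s ⟨hs, le_max_right _ _⟩).2.2 n)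
        (norm_nonneg _) (by linarith [hY1 ω])
    · exact (tendsto_ouSum k (M.cont ω) (M.zero ω) ht).mul (tendsto_ouSum k (M.cont ω) (M.zero ω) hs)
  have l2 := (tendsto_double_sum ht hs (f := fun u => Real.exp (-(k * (t - u))))
    (h := fun u => Real.exp (-(k * (s - u)))) (by fun_prop) (by fun_prop)
    (M.kernel_integrableOn (b := t) (d := s) le_rfl le_rfl)).comp tendsto_atTop_diagonal
  refine tendsto_nhds_unique l1 (l2.congr fun n => ?_)
  have hi : ∀ i j : ℕ, Integrable (fun ω => Real.exp (-(k * (t - i * t / n))) *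
      (g ((i + 1) * t / n) ω - g (i * t / n) ω) * (Real.exp (-(k * (s - j * s / n))) *
      (g ((j + 1) * s / n) ω - g (j * s / n) ω))) P := fun i j =>
    ((M.memLp_sub _ _ (p := 2) (by simp)).const_mul _).integrable_mul
      ((M.memLp_sub _ _ (p := 2) (by simp)).const_mul _)
  simp only [Function.comp, ouSum, Finset.sum_mul_sum]
  rw [integral_finsetSum _ fun i _ => integrable_finsetSum _ fun j _ => hi i j]
  refine Finset.sum_congr rfl fun i _ => ?_
  rw [integral_finsetSum _ fun j _ => hi i j]
  refine Finset.sum_congr rfl fun j _ => ?_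
  rw [← M.cov _ _ _ _ (grid_nonneg ht n i) (grid_le ht n i) (grid_nonneg hs n j) (grid_le hs n j),
    ← integral_const_mul]
  congr 1; ext ω; ring

/-- Isserlis' formula for the Ornstein-Uhlenbeck process. -/
lemma integral_ou_sq_mul_sq {k : ℝ} (hk : 0 < k) {t s : ℝ} (ht : 0 ≤ t) (hs : 0 ≤ s) :
    ∫ ω, ou k (fun r => g r ω) t ^ 2 * ou k (fun r => g r ω) s ^ 2 ∂P =
      (∫ ω, ou k (fun r => g r ω) t ^ 2 ∂P) * (∫ ω, ou k (fun r => g r ω) s ^ 2 ∂P) +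
        2 * (∫ ω, ou k (fun r => g r ω) t * ou k (fun r => g r ω) s ∂P) ^ 2 := by
  refine isserlis_of_fourth (M.memLp_ou hk ht) (M.memLp_ou hk hs) fun a b => ?_
  obtain ⟨Y, hY, hY1, h⟩ := M.exists_dominating_ou hk (max t s)
  have hY2 : MemLp (fun ω => (|a| + |b|) * Y ω) 2 P := (hY.mono_exponent (by norm_num)).const_mul _
  have hmem : ∀ n, (fun ω => a * ouSum k (fun r => g r ω) t n + b * ouSum k (fun r => g r ω) s n) ∈
      Submodule.span ℝ (range g) := fun n =>
    Submodule.add_mem _ (Submodule.smul_mem _ a (M.ouSum_mem_span k t n))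
      (Submodule.smul_mem _ b (M.ouSum_mem_span k s n))
  have hm : AEMeasurable (fun ω => a * ou k (fun r => g r ω) t + b * ou k (fun r => g r ω) s) P :=
    (((M.measurable_ou k ht).const_mul a).add ((M.measurable_ou k hs).const_mul b)).aemeasurable
  have := map_eq_gaussianReal_of_tendsto (P := P) (Y := fun ω => (|a| + |b|) * Y ω)
    (V := fun ω => a * ou k (fun r => g r ω) t + b * ou k (fun r => g r ω) s)
    (fun n => M.hasGaussianLaw_of_span (hmem n)) (fun n => M.centered_of_span (hmem n)) hm
    (ae_of_all _ fun ω => ((tendsto_ouSum k (M.cont ω) (M.zero ω) ht).const_mul a).add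
      ((tendsto_ouSum k (M.cont ω) (M.zero ω) hs).const_mul b)) hY2.integrable_sq (fun n => ?_)
  · exact (fourth_moment_of_map_eq hm this).2
  · filter_upwards [h] with ω hω
    refine (abs_add_le _ _).trans ?_
    rw [abs_mul, abs_mul, add_mul]
    gcongr
    · exact (hω t ⟨ht, le_max_left _ _⟩).2.2 n
    · exact (hω s ⟨hs, le_max_right _ _⟩).2.2 n

end KernelGaussian
end Prob

/-! ### The limiting variance and the negligible remainder -/

section Analysis

lemma exp_neg_integrableOn_Ioi' {k : ℝ} (hk : 0 < k) (c : ℝ) :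
    IntegrableOn (fun x : ℝ => Real.exp (-(k * x))) (Ioi c) := by
  simpa using integrableOn_exp_mul_Ioi (a := -k) (by linarith) c

lemma lintegral_exp_neg_Ioi {k : ℝ} (hk : 0 < k) :
    ∫⁻ x in Ioi (0 : ℝ), ENNReal.ofReal (Real.exp (-(k * x))) = ENNReal.ofReal (1 / k) := by
  rw [← ofReal_integral_eq_lintegral_ofReal (exp_neg_integrableOn_Ioi' hk 0)
    (ae_of_all _ fun x => (Real.exp_pos _).le)]
  congr 1
  have := integral_exp_mul_Ioi (a := -k) (by linarith) 0
  simp only [neg_mul] at this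
  rw [this]; simp

/-- The integral of `e^{-k (a + b)} |a - b|^(2 β - 2)` over the quadrant. -/
lemma lintegral_exp_exp_rpow {k β : ℝ} (hk : 0 < k) (hβ : 1 / 2 < β) :
    ∫⁻ a in Ioi (0 : ℝ), ∫⁻ b in Ioi (0 : ℝ), ENNReal.ofReal
      (Real.exp (-(k * a)) * Real.exp (-(k * b)) * |a - b| ^ (2 * β - 2)) =
      ENNReal.ofReal (Real.Gamma (2 * β - 1) * k ^ (-(2 * β))) := by
  set F : ℝ → ℝ → ENNReal := fun a b => ENNReal.ofReal
      (Real.exp (-(k * a)) * Real.exp (-(k * b)) * |a - b| ^ (2 * β - 2)) with hF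
  have hFm : Measurable (Function.uncurry F) := by
    simp only [hF, Function.uncurry_def]; fun_prop
  have hΓ : 0 < Real.Gamma (2 * β - 1) := Real.Gamma_pos_of_pos (by linarith)
  set c : ℝ := (1 / k) ^ (2 * β - 1) * Real.Gamma (2 * β - 1) with hc
  have hc0 : 0 < c := by positivity
  have hgam : ∫⁻ r in Ioi (0 : ℝ), ENNReal.ofReal (r ^ (2 * β - 2) * Real.exp (-(k * r))) =
      ENNReal.ofReal c := by
    have key := Real.integral_rpow_mul_exp_neg_mul_Ioi (a := 2 * β - 1) (by linarith) hk
    rw [show 2 * β - 1 - 1 = 2 * β - 2 by ring] at key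
    rw [← ofReal_integral_eq_lintegral_ofReal, key]
    · exact .of_integral_ne_zero (by rw [key]; positivity)
    · filter_upwards [ae_restrict_mem measurableSet_Ioi] with r hr
      have : (0 : ℝ) < r := hr
      show (0 : ℝ) ≤ _
      positivity
  -- Above the diagonal the substitution r = b - a separates the integrand into e^{-2ka} and the
  -- integrand of a Gamma integral.
  have hL1 : ∀ a, 0 < a → ∫⁻ b in Ioi a, F a b = ENNReal.ofReal (Real.exp (-(2 * k * a))) *
      ENNReal.ofReal c := by
    intro a ha
    rw [← hgam, ← lintegral_const_mul _ (by fun_prop)]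
    rw [← lintegral_indicator measurableSet_Ioi, ← lintegral_indicator measurableSet_Ioi,
      ← lintegral_sub_right_eq_self ((Ioi (0 : ℝ)).indicator fun r =>
        ENNReal.ofReal (Real.exp (-(2 * k * a))) *
          ENNReal.ofReal (r ^ (2 * β - 2) * Real.exp (-(k * r)))) a]
    congr 1; ext b
    by_cases hb : a < b
    · have hb' : b - a ∈ Ioi (0 : ℝ) := sub_pos.2 hb
      rw [indicator_of_mem (show b ∈ Ioi a from hb), indicator_of_mem hb',
        ← ENNReal.ofReal_mul (Real.exp_pos _).le]
      simp only [hF]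
      rw [abs_sub_comm, abs_of_pos (sub_pos.2 hb)]
      congr 1
      have : Real.exp (-(k * a)) * Real.exp (-(k * b)) =
          Real.exp (-(2 * k * a)) * Real.exp (-(k * (b - a))) := by
        rw [← Real.exp_add, ← Real.exp_add]; congr 1; ring
      rw [this]; ring
    · have hb' : b - a ∉ Ioi (0 : ℝ) := fun h => hb (sub_pos.1 h)
      rw [indicator_of_notMem (show b ∉ Ioi a from hb), indicator_of_notMem hb']
  have hsplit : ∀ a ∈ Ioi (0 : ℝ), ∫⁻ b in Ioi (0 : ℝ), F a b =
      (∫⁻ b in Ioc 0 a, F a b) + ∫⁻ b in Ioi a, F a b := by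
    intro a ha
    rw [← lintegral_union measurableSet_Ioi Ioc_disjoint_Ioi_same, Ioc_union_Ioi_eq_Ioi (le_of_lt ha)]
  -- By symmetry of the integrand the part below the diagonal equals the part above it; the total is
  -- 2 · (1/(2k)) · c.
  have hswap : ∫⁻ a in Ioi (0 : ℝ), ∫⁻ b in Ioc 0 a, F a b = ∫⁻ b in Ioi (0 : ℝ), ∫⁻ a in Ioi b, F b a := by
    have e1 : ∀ a, ∫⁻ b in Ioc 0 a, F a b = ∫⁻ b in Ioi (0 : ℝ), {p : ℝ × ℝ | p.2 ≤ p.1}.indicator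
        (Function.uncurry F) (a, b) := by
      intro a
      rw [← lintegral_indicator measurableSet_Ioc, ← lintegral_indicator measurableSet_Ioi]
      congr 1; ext b
      by_cases h1 : 0 < b <;> by_cases h2 : b ≤ a <;> simp [indicator, h1, h2]
    have e2 : ∀ b ∈ Ioi (0 : ℝ), ∫⁻ a in Ioi b, F b a = ∫⁻ a in Ioi (0 : ℝ), {p : ℝ × ℝ | p.2 ≤ p.1}.indicator
        (Function.uncurry F) (a, b) := by
      intro b hb
      rw [setLIntegral_congr Ioi_ae_eq_Ici, ← lintegral_indicator measurableSet_Ici,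
        ← lintegral_indicator measurableSet_Ioi]
      congr 1; ext a
      have hb' : 0 < b := hb
      by_cases h2 : b ≤ a
      · have h1 : 0 < a := hb'.trans_le h2
        simp only [indicator, mem_Ici, h2, if_true, mem_Ioi, h1, mem_ofPred_eq, Function.uncurry, hF]
        rw [abs_sub_comm]; congr 1; ring
      · simp [indicator, h2]
    simp only [e1]
    rw [setLIntegral_congr_fun measurableSet_Ioi e2]
    refine lintegral_lintegral_swap ?_
    refine Measurable.aemeasurable ?_
    exact hFm.indicator (measurableSet_le measurable_snd measurable_fst)
  have hm1 : Measurable fun a => ∫⁻ b in Ioi a, F a b := by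
    have : (fun a => ∫⁻ b in Ioi a, F a b) = fun a => ∫⁻ b, {p : ℝ × ℝ | p.1 < p.2}.indicator
        (Function.uncurry F) (a, b) := by
      ext a
      rw [← lintegral_indicator measurableSet_Ioi]
      rfl
    rw [this]
    exact (hFm.indicator (measurableSet_lt measurable_fst measurable_snd)).lintegral_prod_right'
  rw [setLIntegral_congr_fun measurableSet_Ioi hsplit, lintegral_add_right _ hm1, hswap,
    setLIntegral_congr_fun measurableSet_Ioi (fun a ha => hL1 a ha),
    lintegral_mul_const _ (by fun_prop), lintegral_exp_neg_Ioi (by linarith : 0 < 2 * k),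
    ← ENNReal.ofReal_mul (by positivity), ← ENNReal.ofReal_add (by positivity) (by positivity)]
  congr 1
  rw [hc, Real.div_rpow zero_le_one hk.le, Real.one_rpow, Real.rpow_neg hk.le,
    show (2 * β) = (2 * β - 1) + 1 by ring, Real.rpow_add_one hk.ne', show 2 * β - 1 + 1 - 1 = 2 * β - 1 by ring]
  field_simp; ring

lemma integrableOn_exp_exp_rpow {k β : ℝ} (hk : 0 < k) (hβ : 1 / 2 < β) :
    IntegrableOn (fun p : ℝ × ℝ => Real.exp (-(k * p.1)) * Real.exp (-(k * p.2)) *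
      |p.1 - p.2| ^ (2 * β - 2)) (Ioi 0 ×ˢ Ioi 0) ∧
    ∫ p in Ioi (0 : ℝ) ×ˢ Ioi (0 : ℝ), Real.exp (-(k * p.1)) * Real.exp (-(k * p.2)) *
      |p.1 - p.2| ^ (2 * β - 2) = Real.Gamma (2 * β - 1) * k ^ (-(2 * β)) := by
  have hm : Measurable (fun p : ℝ × ℝ => Real.exp (-(k * p.1)) * Real.exp (-(k * p.2)) *
      |p.1 - p.2| ^ (2 * β - 2)) := by fun_prop
  have hΓ : 0 < Real.Gamma (2 * β - 1) := Real.Gamma_pos_of_pos (by linarith)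
  have hl : ∫⁻ p in Ioi (0 : ℝ) ×ˢ Ioi (0 : ℝ), ENNReal.ofReal (Real.exp (-(k * p.1)) *
      Real.exp (-(k * p.2)) * |p.1 - p.2| ^ (2 * β - 2)) =
      ENNReal.ofReal (Real.Gamma (2 * β - 1) * k ^ (-(2 * β))) := by
    rw [Measure.volume_eq_prod, ← Measure.prod_restrict, lintegral_prod _ (by fun_prop)]
    exact lintegral_exp_exp_rpow hk hβ
  have hnn : ∀ p : ℝ × ℝ, 0 ≤ Real.exp (-(k * p.1)) * Real.exp (-(k * p.2)) *
      |p.1 - p.2| ^ (2 * β - 2) := fun p => by positivity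
  constructor
  · refine ⟨hm.aestronglyMeasurable, ?_⟩
    rw [hasFiniteIntegral_iff_ofReal (ae_of_all _ hnn), hl]
    exact ENNReal.ofReal_lt_top
  · rw [integral_eq_lintegral_of_nonneg_ae (ae_of_all _ hnn) hm.aestronglyMeasurable, hl,
      ENNReal.toReal_ofReal (by positivity)]

lemma reflect_integral {t : ℝ} (ht : 0 ≤ t) {f : ℝ × ℝ → ℝ} (hf : IntegrableOn f (Ioc 0 t ×ˢ Ioc 0 t))
    (hf' : IntegrableOn (fun p : ℝ × ℝ => f (t - p.1, t - p.2)) (Ioc 0 t ×ˢ Ioc 0 t)) :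
    ∫ p in Ioc 0 t ×ˢ Ioc 0 t, f (t - p.1, t - p.2) = ∫ p in Ioc 0 t ×ˢ Ioc 0 t, f p := by
  rw [Measure.volume_eq_prod] at hf hf' ⊢
  rw [setIntegral_prod _ hf, setIntegral_prod _ hf']
  simp only [← intervalIntegral.integral_of_le ht]
  have e : ∀ x, ∫ y in 0..t, f (t - x, t - y) = ∫ y in 0..t, f (t - x, y) := by
    intro x
    have := intervalIntegral.integral_comp_sub_left (a := 0) (b := t) (fun y => f (t - x, y)) t
    simpa using this
  simp only [e]
  have := intervalIntegral.integral_comp_sub_left (a := 0) (b := t)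
    (fun x => ∫ y in 0..t, f (x, y)) t
  simpa using this

/-- The reflection (u,v) ↦ (t-u,t-v) makes the integrand independent of t; what remains is a fixed
integrable function over squares that increase to the quadrant. -/
lemma tendsto_integral_reflected {k β : ℝ} (hk : 0 < k) (h1 : 1 / 2 < β) (h2 : β < 1) :
    Tendsto (fun t : ℝ => ∫ p in Ioc 0 t ×ˢ Ioc 0 t,
      Real.exp (-(k * (t - p.1))) * Real.exp (-(k * (t - p.2))) * |p.1 - p.2| ^ (2 * β - 2)) atTop
      (𝓝 (Real.Gamma (2 * β - 1) * k ^ (-(2 * β)))) := by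
  obtain ⟨hi, hv⟩ := integrableOn_exp_exp_rpow hk h1
  have hU : (⋃ t : ℝ, Ioc 0 t ×ˢ Ioc 0 t) = Ioi (0 : ℝ) ×ˢ Ioi (0 : ℝ) := by
    ext p
    simp only [mem_iUnion, mem_prod, mem_Ioc, mem_Ioi]
    constructor
    · rintro ⟨t, h⟩; exact ⟨h.1.1, h.2.1⟩
    · rintro ⟨h, h'⟩
      exact ⟨max p.1 p.2, ⟨h, le_max_left _ _⟩, h', le_max_right _ _⟩
  have hmono : Monotone fun t : ℝ => Ioc 0 t ×ˢ Ioc 0 t := fun s t hst =>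
    prod_mono (Ioc_subset_Ioc_right hst) (Ioc_subset_Ioc_right hst)
  have := tendsto_setIntegral_of_monotone (μ := volume) (s := fun t : ℝ => Ioc 0 t ×ˢ Ioc 0 t)
    (fun t => measurableSet_Ioc.prod measurableSet_Ioc) hmono (hU ▸ hi)
  rw [hU, hv] at this
  refine this.congr' ?_
  filter_upwards [eventually_ge_atTop 0] with t ht
  have hsub : Ioc 0 t ×ˢ Ioc 0 t ⊆ Ioi (0 : ℝ) ×ˢ Ioi (0 : ℝ) :=
    prod_mono Ioc_subset_Ioi_self Ioc_subset_Ioi_self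
  rw [← reflect_integral ht (hi.mono_set hsub)]
  · congr 1; ext p
    simp only
    congr 2
    rw [abs_sub_comm p.1]; congr 1; ring
  · have := (integrableOn_abs_sub_rpow h1 h2 0 t ht).1
    rw [Measure.prod_restrict, ← Measure.volume_eq_prod] at this
    have h3 : IntegrableOn (fun p : ℝ × ℝ =>
        (Real.exp (-(k * (t - p.1))) * Real.exp (-(k * (t - p.2)))) * |p.1 - p.2| ^ (2 * β - 2))
        (Ioc 0 t ×ˢ Ioc 0 t) := by
      refine Integrable.bdd_mul (c := 1) this (by fun_prop) ?_
      filter_upwards [ae_restrict_mem (measurableSet_Ioc.prod measurableSet_Ioc)] with p hp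
      rw [norm_mul, Real.norm_of_nonneg (Real.exp_pos _).le, Real.norm_of_nonneg (Real.exp_pos _).le,
        ← Real.exp_add, Real.exp_le_one_iff]
      have e1 := hp.1.2
      have e2 := hp.2.2
      nlinarith
    refine h3.congr (ae_of_all _ fun p => ?_)
    simp only
    congr 2
    rw [abs_sub_comm p.1]; congr 1; ring

/-- The remainder term is negligible. -/
lemma tendsto_integral_exp_rpow {k β : ℝ} (hk : 0 < k) (h0 : 0 < β) (h1 : β < 1) :
    Tendsto (fun t : ℝ => ∫ u in 0..t, Real.exp (-(k * (t - u))) * |u| ^ (β - 1)) atTop (𝓝 0) := by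
  have hii : ∀ a b c : ℝ, IntervalIntegrable (fun u => Real.exp (-(k * (c - u))) * |u| ^ (β - 1))
      volume a b := fun a b c =>
    (intervalIntegrable_abs_rpow (by linarith) a b).continuousOn_mul (by fun_prop)
  -- Split at t/2: on the left half the exponential is at most e^{-kt/2}, on the right half the
  -- power is at most (t/2)^{β-1}.
  have hb : ∀ t : ℝ, 0 < t → ∫ u in 0..t, Real.exp (-(k * (t - u))) * |u| ^ (β - 1) ≤
      Real.exp (-(k / 2) * t) * t ^ β * (1 / β) + (2 : ℝ) ^ (1 - β) * (1 / k) * t ^ (-(1 - β)) := by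
    intro t ht
    rw [← intervalIntegral.integral_add_adjacent_intervals (hii 0 (t / 2) t) (hii (t / 2) t t)]
    refine add_le_add ?_ ?_
    · calc ∫ u in 0..(t / 2), Real.exp (-(k * (t - u))) * |u| ^ (β - 1)
          ≤ ∫ u in 0..(t / 2), Real.exp (-(k / 2) * t) * |u| ^ (β - 1) := by
            refine intervalIntegral.integral_mono_on (by linarith) (hii _ _ _)
              ((intervalIntegrable_abs_rpow (by linarith) _ _).const_mul _) fun u hu => ?_
            have := hu.2
            gcongr
            nlinarith
        _ = Real.exp (-(k / 2) * t) * ∫ u in 0..(t / 2), |u| ^ (β - 1) := by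
            rw [intervalIntegral.integral_const_mul]
        _ ≤ Real.exp (-(k / 2) * t) * ((t / 2 - 0) ^ β / β) := by
            gcongr
            exact integral_rpow_le h0 h1.le le_rfl (by linarith)
        _ ≤ Real.exp (-(k / 2) * t) * (t ^ β / β) := by
            gcongr <;> linarith
        _ = _ := by ring
    · calc ∫ u in (t / 2)..t, Real.exp (-(k * (t - u))) * |u| ^ (β - 1)
          ≤ ∫ u in (t / 2)..t, (t / 2) ^ (β - 1) * (Real.exp (-(k * t)) * Real.exp (k * u)) := by
            refine intervalIntegral.integral_mono_on (by linarith) (hii _ _ _)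
              (Continuous.intervalIntegrable (by fun_prop) _ _) fun u hu => ?_
            rw [← Real.exp_add, mul_comm, show -(k * t) + k * u = -(k * (t - u)) by ring]
            refine mul_le_mul_of_nonneg_right ?_ (Real.exp_pos _).le
            exact Real.rpow_le_rpow_of_nonpos (by linarith) (hu.1.trans (le_abs_self u)) (by linarith)
        _ = (t / 2) ^ (β - 1) * (Real.exp (-(k * t)) * ((Real.exp (k * t) - Real.exp (k * (t / 2))) / k)) := by
            rw [intervalIntegral.integral_const_mul, intervalIntegral.integral_const_mul]
            congr 2
            have e1 := integral_exp_mul k hk.ne' t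
            have e2 := integral_exp_mul k hk.ne' (t / 2)
            rw [← intervalIntegral.integral_interval_sub_left (a := 0)
              (Continuous.intervalIntegrable (by fun_prop) _ _)
              (Continuous.intervalIntegrable (by fun_prop) _ _), e1, e2]
            ring
        _ ≤ (t / 2) ^ (β - 1) * (1 / k) := by
            gcongr
            have e3 : Real.exp (-(k * t)) * Real.exp (k * t) = 1 := by rw [← Real.exp_add]; simp
            have e4 : 0 ≤ Real.exp (-(k * t)) * Real.exp (k * (t / 2)) := by positivity
            rw [mul_div_assoc', mul_sub, e3]
            gcongr
            linarith
        _ = _ := by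
            rw [Real.div_rpow ht.le (by norm_num), show -(1 - β) = β - 1 by ring,
              show (1 - β) = -(β - 1) by ring, Real.rpow_neg (by norm_num : (0 : ℝ) ≤ 2)]
            field_simp
  have hlim : Tendsto (fun t : ℝ => Real.exp (-(k / 2) * t) * t ^ β * (1 / β) +
      (2 : ℝ) ^ (1 - β) * (1 / k) * t ^ (-(1 - β))) atTop (𝓝 0) := by
    have l1 := (tendsto_rpow_mul_exp_neg_mul_atTop_nhds_zero β (k / 2) (by linarith)).mul_const (1 / β)
    have l2 := (tendsto_rpow_neg_atTop (by linarith : 0 < 1 - β)).const_mul ((2 : ℝ) ^ (1 - β) * (1 / k))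
    have := l1.add l2
    simp only [zero_mul, mul_zero, add_zero] at this
    refine this.congr fun t => ?_
    ring
  refine squeeze_zero' ?_ ?_ hlim
  · filter_upwards [eventually_ge_atTop 0] with t ht
    exact intervalIntegral.integral_nonneg ht fun u _ => by positivity
  · filter_upwards [eventually_gt_atTop 0] with t ht using hb t ht

end Analysis

/-! ### Almost sure convergence from summable moments; Fubini for squared time integrals -/

section
variable {Ω : Type*} [MeasurableSpace Ω] {P : Measure Ω} [IsProbabilityMeasure P]

/-- By Tonelli the series of the F_n has finite mean, hence converges almost surely, and its terms
tend to zero. -/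
lemma tendsto_zero_of_summable_lintegral {F : ℕ → Ω → ENNReal} (hF : ∀ n, Measurable (F n))
    (h : ∑' n, ∫⁻ ω, F n ω ∂P ≠ ⊤) : ∀ᵐ ω ∂P, Tendsto (fun n => F n ω) atTop (𝓝 0) := by
  rw [← lintegral_tsum fun n => (hF n).aemeasurable] at h
  filter_upwards [ae_lt_top (Measurable.tsum fun n => hF n) h] with ω hω
  exact ENNReal.tendsto_atTop_zero_of_tsum_ne_top hω.ne

lemma tendsto_zero_of_second_moment {F : ℕ → Ω → ℝ} (hF : ∀ n, Measurable (F n)) {c : ℝ}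
    (hi : ∀ n, Integrable (fun ω => F n ω ^ 2) P)
    (h : ∀ n : ℕ, ∫ ω, F n ω ^ 2 ∂P ≤ c * (1 / (n : ℝ) ^ 2)) :
    ∀ᵐ ω ∂P, Tendsto (fun n => F n ω) atTop (𝓝 0) := by
  have hs : Summable fun n : ℕ => c * (1 / (n : ℝ) ^ 2) :=
    (Real.summable_one_div_nat_pow.2 (by norm_num)).mul_left c
  have hnn : ∀ n : ℕ, 0 ≤ c * (1 / (n : ℝ) ^ 2) := fun n =>
    (integral_nonneg fun ω => by positivity).trans (h n)
  have := tendsto_zero_of_summable_lintegral (P := P) (F := fun n ω => ENNReal.ofReal (F n ω ^ 2))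
    (fun n => ((hF n).pow_const 2).ennreal_ofReal) (ne_top_of_le_ne_top
      (b := ∑' n : ℕ, ENNReal.ofReal (c * (1 / (n : ℝ) ^ 2))) ?_ (ENNReal.tsum_le_tsum fun n => ?_))
  · filter_upwards [this] with ω hω
    have h2 := (ENNReal.tendsto_toReal ENNReal.zero_ne_top).comp hω
    have h3 : Tendsto (fun n => F n ω ^ 2) atTop (𝓝 0) := by
      refine h2.congr fun n => ?_
      exact ENNReal.toReal_ofReal (by positivity)
    have h4 := h3.sqrt
    simp only [Real.sqrt_zero, Real.sqrt_sq_eq_abs] at h4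
    exact (tendsto_zero_iff_abs_tendsto_zero _).2 h4
  · rw [← ENNReal.ofReal_tsum_of_nonneg hnn hs]; exact ENNReal.ofReal_ne_top
  · rw [← ofReal_integral_eq_lintegral_ofReal (hi n) (ae_of_all _ fun ω => by positivity)]
    exact ENNReal.ofReal_le_ofReal (h n)

/-- Fubini for the square of a time integral. -/
lemma integral_sq_time_integral {W : ℝ → Ω → ℝ} (hW : Measurable (Function.uncurry W)) {T : ℝ}
    {Y : Ω → ℝ} (hY : MemLp Y 2 P) (hdom : ∀ᵐ ω ∂P, ∀ t ∈ Icc 0 T, |W t ω| ≤ Y ω) :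
    Integrable (fun ω => (∫ t in Ioc 0 T, W t ω) ^ 2) P ∧
    Integrable (fun p : ℝ × ℝ => ∫ ω, W p.1 ω * W p.2 ω ∂P)
      (volume.restrict (Ioc 0 T ×ˢ Ioc 0 T)) ∧
    ∫ ω, (∫ t in Ioc 0 T, W t ω) ^ 2 ∂P =
      ∫ p in Ioc 0 T ×ˢ Ioc 0 T, ∫ ω, W p.1 ω * W p.2 ω ∂P := by
  have hm : Measurable fun q : Ω × (ℝ × ℝ) => W q.2.1 q.1 * W q.2.2 q.1 := by
    have h1 : Measurable fun q : Ω × (ℝ × ℝ) => W q.2.1 q.1 :=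
      hW.comp (f := fun q : Ω × (ℝ × ℝ) => (q.2.1, q.1)) (by fun_prop)
    have h2 : Measurable fun q : Ω × (ℝ × ℝ) => W q.2.2 q.1 :=
      hW.comp (f := fun q : Ω × (ℝ × ℝ) => (q.2.2, q.1)) (by fun_prop)
    exact h1.mul h2
  have hfin : IsFiniteMeasure ((volume : Measure (ℝ × ℝ)).restrict (Ioc 0 T ×ˢ Ioc 0 T)) := by
    constructor
    rw [Measure.restrict_apply_univ, Measure.volume_eq_prod, Measure.prod_prod]
    simp [ENNReal.mul_lt_top]
  have hint : Integrable (fun q : Ω × (ℝ × ℝ) => W q.2.1 q.1 * W q.2.2 q.1)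
      (P.prod (volume.restrict (Ioc 0 T ×ˢ Ioc 0 T))) := by
    have hb : Integrable (fun q : Ω × (ℝ × ℝ) => Y q.1 ^ 2 * 1)
        (P.prod (volume.restrict (Ioc 0 T ×ˢ Ioc 0 T))) :=
      hY.integrable_sq.mul_prod (integrable_const 1)
    refine hb.mono' hm.aestronglyMeasurable ?_
    have h1 : ∀ᵐ q : Ω × (ℝ × ℝ) ∂(P.prod (volume.restrict (Ioc 0 T ×ˢ Ioc 0 T))),
        ∀ t ∈ Icc 0 T, |W t q.1| ≤ Y q.1 := Measure.quasiMeasurePreserving_fst.ae hdom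
    have h2 : ∀ᵐ q : Ω × (ℝ × ℝ) ∂(P.prod (volume.restrict (Ioc 0 T ×ˢ Ioc 0 T))),
        q.2 ∈ Ioc 0 T ×ˢ Ioc 0 T := Measure.quasiMeasurePreserving_snd.ae
          (ae_restrict_mem (measurableSet_Ioc.prod measurableSet_Ioc))
    filter_upwards [h1, h2] with q hq1 hq2
    rw [norm_mul, mul_one, sq]
    have a1 := hq1 _ (Ioc_subset_Icc_self hq2.1)
    have a2 := hq1 _ (Ioc_subset_Icc_self hq2.2)
    exact mul_le_mul a1 a2 (abs_nonneg _) ((abs_nonneg _).trans a1)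
  have e : ∀ ω, (∫ t in Ioc 0 T, W t ω) ^ 2 = ∫ p in Ioc 0 T ×ˢ Ioc 0 T, W p.1 ω * W p.2 ω := by
    intro ω
    rw [Measure.volume_eq_prod, ← Measure.prod_restrict,
      integral_prod_mul (fun t => W t ω) (fun t => W t ω), sq]
  simp only [e]
  exact ⟨hint.integral_prod_left, hint.integral_prod_right, integral_integral_swap hint⟩

end

/-! ### Deterministic limit theorems for paths -/

section Interpolation

/-- With N = ⌊T^{1/p}⌋ one has N^p ≤ T ≤ (N+1)^p, and the ratio of the two ends tends to 1;
monotonicity of A squeezes A(T)/T between its values along the sequence. -/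
lemma tendsto_div_of_monotoneOn {A : ℝ → ℝ} (hA : MonotoneOn A (Ici 0)) (hA0 : 0 ≤ A 0) {p : ℕ}
    (hp : p ≠ 0) {L : ℝ}
    (h : Tendsto (fun n : ℕ => A ((n : ℝ) ^ p) / (n : ℝ) ^ p) atTop (𝓝 L)) :
    Tendsto (fun T => A T / T) atTop (𝓝 L) := by
  have hAnn : ∀ x, 0 ≤ x → 0 ≤ A x := fun x hx => hA0.trans (hA self_mem_Ici hx hx)
  set N : ℝ → ℕ := fun T => ⌊T ^ ((1 : ℝ) / p)⌋₊ with hN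
  have hp' : (0 : ℝ) < p := by positivity
  have hNt : Tendsto N atTop atTop :=
    tendsto_nat_floor_atTop.comp (tendsto_rpow_atTop (by positivity))
  have hr : Tendsto (fun n : ℕ => ((n : ℝ) / (n + 1)) ^ p) atTop (𝓝 1) := by
    have := (tendsto_natCast_div_add_atTop (1 : ℝ)).pow p
    simpa using this
  have hlow : Tendsto (fun n : ℕ => A ((n : ℝ) ^ p) / (n : ℝ) ^ p * ((n : ℝ) / (n + 1)) ^ p) atTop
      (𝓝 L) := by simpa using h.mul hr
  have hup : Tendsto (fun n : ℕ => A (((n : ℝ) + 1) ^ p) / ((n : ℝ) + 1) ^ p *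
      (((n : ℝ) / (n + 1)) ^ p)⁻¹) atTop (𝓝 L) := by
    have h1 := (h.comp (tendsto_add_atTop_nat 1)).mul (hr.inv₀ one_ne_zero)
    simpa [Function.comp] using h1
  refine tendsto_of_tendsto_of_tendsto_of_le_of_le' (hlow.comp hNt) (hup.comp hNt) ?_ ?_
  · filter_upwards [eventually_ge_atTop 1, hNt.eventually_ge_atTop 1] with T hT hN1
    have hNpos : (0 : ℝ) < N T := by exact_mod_cast hN1
    have hroot : (T ^ ((1 : ℝ) / p)) ^ p = T := by
      rw [← Real.rpow_natCast, ← Real.rpow_mul (by linarith), one_div, inv_mul_cancel₀ hp'.ne',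
        Real.rpow_one]
    have l1 : (N T : ℝ) ^ p ≤ T := by
      calc (N T : ℝ) ^ p ≤ (T ^ ((1 : ℝ) / p)) ^ p :=
            pow_le_pow_left₀ hNpos.le (Nat.floor_le (by positivity)) p
        _ = T := hroot
    have l2 : T ≤ ((N T : ℝ) + 1) ^ p := by
      calc T = (T ^ ((1 : ℝ) / p)) ^ p := hroot.symm
        _ ≤ _ := pow_le_pow_left₀ (by positivity) (Nat.lt_floor_add_one _).le p
    have l3 : A ((N T : ℝ) ^ p) ≤ A T := hA (mem_Ici.2 (by positivity)) (mem_Ici.2 (by linarith)) l1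
    have e : A ((N T : ℝ) ^ p) / (N T : ℝ) ^ p * ((N T : ℝ) / (N T + 1)) ^ p =
        A ((N T : ℝ) ^ p) / ((N T : ℝ) + 1) ^ p := by
      rw [div_pow]; field_simp
    simp only [Function.comp]
    rw [e]
    have := hAnn ((N T : ℝ) ^ p) (by positivity)
    have := hAnn T (by linarith)
    gcongr
  · filter_upwards [eventually_ge_atTop 1, hNt.eventually_ge_atTop 1] with T hT hN1
    have hNpos : (0 : ℝ) < N T := by exact_mod_cast hN1
    have hroot : (T ^ ((1 : ℝ) / p)) ^ p = T := by
      rw [← Real.rpow_natCast, ← Real.rpow_mul (by linarith), one_div, inv_mul_cancel₀ hp'.ne',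
        Real.rpow_one]
    have l1 : (N T : ℝ) ^ p ≤ T := by
      calc (N T : ℝ) ^ p ≤ (T ^ ((1 : ℝ) / p)) ^ p :=
            pow_le_pow_left₀ hNpos.le (Nat.floor_le (by positivity)) p
        _ = T := hroot
    have l2 : T ≤ ((N T : ℝ) + 1) ^ p := by
      calc T = (T ^ ((1 : ℝ) / p)) ^ p := hroot.symm
        _ ≤ _ := pow_le_pow_left₀ (by positivity) (Nat.lt_floor_add_one _).le p
    have l3 : A T ≤ A (((N T : ℝ) + 1) ^ p) := hA (mem_Ici.2 (by linarith)) (mem_Ici.2 (by positivity)) l2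
    have e : A (((N T : ℝ) + 1) ^ p) / ((N T : ℝ) + 1) ^ p * (((N T : ℝ) / (N T + 1)) ^ p)⁻¹ =
        A (((N T : ℝ) + 1) ^ p) / (N T : ℝ) ^ p := by
      rw [div_pow]; field_simp
    simp only [Function.comp]
    rw [e]
    have := hAnn (((N T : ℝ) + 1) ^ p) (by positivity)
    gcongr

lemma tendsto_zero_of_contraction {w ε : ℕ → ℝ} {q : ℝ} (hq : 0 ≤ q) (hq1 : q < 1)
    (hw : ∀ n, 0 ≤ w n) (h : ∀ n, w (n + 1) ≤ q * w n + ε n) (hε : Tendsto ε atTop (𝓝 0)) :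
    Tendsto w atTop (𝓝 0) := by
  have hq' : 0 < 1 - q := by linarith
  refine tendsto_order.2 ⟨fun a ha => Eventually.of_forall fun n => ha.trans_le (hw n),
    fun δ hδ => ?_⟩
  -- With ε_n below (1-q)δ/2 the level δ/2 is preserved by w ↦ qw + ε_n, so only the geometric term
  -- q^m w(n₀) is left.
  obtain ⟨n₀, hn₀⟩ := eventually_atTop.1 (hε.eventually_lt_const (u := (1 - q) * (δ / 2)) (by positivity))
  have hind : ∀ m, w (n₀ + m) ≤ δ / 2 + q ^ m * w n₀ := by
    intro m
    induction m with
    | zero => simp; linarith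
    | succ m ih =>
      have h1 := h (n₀ + m)
      have h2 := hn₀ (n₀ + m) (by omega)
      have h3 := mul_le_mul_of_nonneg_left ih hq
      rw [← add_assoc, pow_succ]
      nlinarith
  have hlim : Tendsto (fun m : ℕ => q ^ m * w n₀) atTop (𝓝 0) := by
    simpa using (tendsto_pow_atTop_nhds_zero_of_lt_one hq hq1).mul_const (w n₀)
  obtain ⟨m₀, hm₀⟩ := eventually_atTop.1 (hlim.eventually_lt_const (u := δ / 2) (by positivity))
  filter_upwards [eventually_ge_atTop (n₀ + m₀)] with n hn
  obtain ⟨m, rfl⟩ := Nat.exists_eq_add_of_le (le_trans (Nat.le_add_right _ _) hn)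
  have := hind m
  have := hm₀ m (by omega)
  linarith

/-- A path whose oscillation on `[n, n + 1]` is `o(√n)` has an Ornstein-Uhlenbeck transform that
is `o(√t)`. -/
lemma tendsto_ou_sq_div {k : ℝ} (hk : 0 < k) {a : ℝ → ℝ} (ha : Continuous a) {y : ℕ → ℝ}
    (hy0 : ∀ n, 0 ≤ y n) (hy : ∀ n : ℕ, ∀ t ∈ Icc (n : ℝ) (n + 1), |a t - a n| ≤ y n)
    (hlim : Tendsto (fun n : ℕ => y n / √((n : ℝ) + 1)) atTop (𝓝 0)) :
    Tendsto (fun t => ou k a t ^ 2 / t) atTop (𝓝 0) := by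
  -- Flow property restarted at n: the old value decays exponentially and the new increments
  -- contribute at most 2 y_n.
  have hblock : ∀ n : ℕ, ∀ r ∈ Icc (0 : ℝ) 1,
      |ou k a (n + r)| ≤ Real.exp (-(k * r)) * |ou k a n| + 2 * y n := by
    intro n r hr
    rw [ou_add hk ha]
    refine (abs_add_le _ _).trans ?_
    rw [abs_mul, abs_of_pos (Real.exp_pos _)]
    gcongr
    refine abs_ou_le hk (by fun_prop) (by simp) hr.1 (hy0 n) fun x hx => ?_
    exact hy n _ ⟨by linarith [hx.1], by linarith [hx.2, hr.2]⟩
  set w : ℕ → ℝ := fun n => |ou k a n| / √((n : ℝ) + 1) with hw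
  -- At r = 1 the block estimate, divided by √(n+1), is a contraction with ratio e^{-k} and a
  -- vanishing perturbation.
  have hw0 : Tendsto w atTop (𝓝 0) := by
    refine tendsto_zero_of_contraction (q := Real.exp (-k)) (ε := fun n => 2 * (y n / √((n : ℝ) + 1)))
      (Real.exp_pos _).le (by rw [Real.exp_lt_one_iff]; linarith) (fun n => by positivity) (fun n => ?_)
      (by simpa using hlim.const_mul 2)
    have h1 := hblock n 1 (by simp)
    rw [mul_one] at h1
    have hs : √((n : ℝ) + 1) ≤ √(((n + 1 : ℕ) : ℝ) + 1) := Real.sqrt_le_sqrt (by push_cast; linarith)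
    have hs0 : 0 < √((n : ℝ) + 1) := by positivity
    simp only [hw]
    push_cast at hs ⊢
    calc |ou k a (n + 1)| / √((n : ℝ) + 1 + 1) ≤ |ou k a (n + 1)| / √((n : ℝ) + 1) := by gcongr
      _ ≤ (Real.exp (-k) * |ou k a n| + 2 * y n) / √((n : ℝ) + 1) := by gcongr
      _ = _ := by ring
  have hb : Tendsto (fun n : ℕ => 2 * (w n + 2 * (y n / √((n : ℝ) + 1))) ^ 2) atTop (𝓝 0) := by
    have := ((hw0.add (hlim.const_mul 2)).pow 2).const_mul 2
    simpa using this
  refine squeeze_zero' ?_ ?_ (hb.comp (tendsto_nat_floor_atTop (α := ℝ)))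
  · filter_upwards [eventually_gt_atTop 0] with t ht
    positivity
  · filter_upwards [eventually_ge_atTop 1] with t ht
    set n := ⌊t⌋₊ with hn
    have hn1 : 1 ≤ n := Nat.one_le_floor_iff t |>.2 ht
    have hn1' : (1 : ℝ) ≤ n := by exact_mod_cast hn1
    have hnt : (n : ℝ) ≤ t := Nat.floor_le (by linarith)
    have htn : t < n + 1 := Nat.lt_floor_add_one t
    have h1 := hblock n (t - n) ⟨by linarith, by linarith⟩
    rw [add_sub_cancel] at h1
    have h2 : Real.exp (-(k * (t - n))) ≤ 1 := by
      rw [Real.exp_le_one_iff]; nlinarith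
    have h3 : |ou k a t| ≤ |ou k a n| + 2 * y n := by
      have := abs_nonneg (ou k a n)
      nlinarith
    have hs0 : 0 < √((n : ℝ) + 1) := by positivity
    have e : w n + 2 * (y n / √((n : ℝ) + 1)) = (|ou k a n| + 2 * y n) / √((n : ℝ) + 1) := by
      simp only [hw]; ring
    simp only [Function.comp]
    rw [e, div_pow, Real.sq_sqrt (by positivity), ← sq_abs (ou k a t), mul_div_assoc']
    rw [div_le_div_iff₀ (by linarith) (by linarith)]
    have h4 : |ou k a t| ^ 2 ≤ (|ou k a n| + 2 * y n) ^ 2 := by gcongr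
    have h5 : 0 ≤ (|ou k a n| + 2 * y n) ^ 2 := by positivity
    have h6 : (n : ℝ) + 1 ≤ 2 * t := by linarith
    calc |ou k a t| ^ 2 * ((n : ℝ) + 1) ≤ (|ou k a n| + 2 * y n) ^ 2 * (2 * t) := by gcongr
      _ = _ := by ring

/-- Cesàro means of a convergent function. -/
lemma tendsto_cesaro {v : ℝ → ℝ} {L : ℝ} (hv : ∀ T, 0 ≤ T → IntervalIntegrable v volume 0 T)
    (h : Tendsto v atTop (𝓝 L)) :
    Tendsto (fun T => (∫ t in 0..T, v t) / T) atTop (𝓝 L) := by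
  rw [Metric.tendsto_nhds]
  intro ε hε
  obtain ⟨S, hS⟩ := eventually_atTop.1 ((Metric.tendsto_nhds.1 h) (ε / 2) (by positivity))
  set S' := max S 0 with hS'
  have hS0 : 0 ≤ S' := le_max_right _ _
  set D := |(∫ t in 0..S', v t) - L * S'| with hD
  have hlim : Tendsto (fun T : ℝ => D / T) atTop (𝓝 0) := tendsto_const_nhds.div_atTop tendsto_id
  filter_upwards [hlim.eventually_lt_const (u := ε / 2) (by positivity), eventually_gt_atTop S',
    eventually_gt_atTop 0] with T hT1 hT2 hT0
  rw [Real.dist_eq]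
  have hi1 := hv S' hS0
  have hi2 : IntervalIntegrable v volume S' T := (hi1.symm).trans (hv T hT0.le)
  have e : (∫ t in 0..T, v t) / T - L =
      (((∫ t in 0..S', v t) - L * S') + ∫ t in S'..T, (v t - L)) / T := by
    rw [intervalIntegral.integral_sub hi2 (by simp), intervalIntegral.integral_const,
      ← intervalIntegral.integral_add_adjacent_intervals hi1 hi2, smul_eq_mul]
    field_simp; ring
  have hb : |∫ t in S'..T, (v t - L)| ≤ ε / 2 * |T - S'| := by
    rw [← Real.norm_eq_abs (∫ t in S'..T, (v t - L))]
    refine intervalIntegral.norm_integral_le_of_norm_le_const fun t ht => ?_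
    rw [uIoc_of_le hT2.le] at ht
    have := hS t ((le_max_left _ _).trans ht.1.le)
    rw [Real.dist_eq] at this
    exact this.le
  rw [abs_of_pos (sub_pos.2 hT2)] at hb
  rw [e, abs_div, abs_of_pos hT0, div_lt_iff₀ hT0]
  rw [div_lt_iff₀ hT0] at hT1
  calc _ ≤ D + |∫ t in S'..T, (v t - L)| := abs_add_le _ _
    _ < ε * T := by nlinarith

end Interpolation

/-! ### Variance asymptotics and second moments of time integrals -/

section Asymptotics
variable {Ω : Type*} [MeasurableSpace Ω] {P : Measure Ω} [IsProbabilityMeasure P]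

/-- The covariance function of the Ornstein-Uhlenbeck process driven by `g`. -/
noncomputable def ouCov (P : Measure Ω) (g : ℝ → Ω → ℝ) (k t s : ℝ) : ℝ :=
  ∫ ω, ou k (fun r => g r ω) t * ou k (fun r => g r ω) s ∂P

/-- The exponential kernel bounds the effect of smoothing a measure on the quadrant. -/
lemma lintegral_exp_smoothing {k : ℝ} (hk : 0 < k) {κ : ℝ × ℝ → ENNReal} (hκ : Measurable κ)
    {T : ℝ} {ρ : ℝ × ℝ → ENNReal}
    (h : ∀ p ∈ Ioc 0 T ×ˢ Ioc 0 T, ρ p ≤ ∫⁻ q in Ioc 0 p.1 ×ˢ Ioc 0 p.2,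
      ENNReal.ofReal (Real.exp (-(k * (p.1 - q.1)))) *
        ENNReal.ofReal (Real.exp (-(k * (p.2 - q.2)))) * κ q) :
    ∫⁻ p in Ioc 0 T ×ˢ Ioc 0 T, ρ p ≤
      ENNReal.ofReal (1 / k) ^ 2 * ∫⁻ q in Ioc 0 T ×ˢ Ioc 0 T, κ q := by
  -- Cutting the exponential to the half line lets the domain of q be enlarged to the full square;
  -- after Tonelli each of the two factors integrates to at most 1/k.
  set E : ℝ → ENNReal := (Ici (0 : ℝ)).indicator fun x => ENNReal.ofReal (Real.exp (-(k * x))) with hE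
  have hEm : Measurable E := by
    rw [hE]; exact Measurable.indicator (by fun_prop) measurableSet_Ici
  have hEi : ∫⁻ x, E x = ENNReal.ofReal (1 / k) := by
    rw [hE, lintegral_indicator measurableSet_Ici, ← lintegral_exp_neg_Ioi hk]
    exact setLIntegral_congr Ioi_ae_eq_Ici.symm
  have hm : MeasurableSet (Ioc 0 T ×ˢ Ioc 0 T : Set (ℝ × ℝ)) := measurableSet_Ioc.prod measurableSet_Ioc
  calc ∫⁻ p in Ioc 0 T ×ˢ Ioc 0 T, ρ p
      ≤ ∫⁻ p in Ioc 0 T ×ˢ Ioc 0 T, ∫⁻ q in Ioc 0 T ×ˢ Ioc 0 T,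
          E (p.1 - q.1) * E (p.2 - q.2) * κ q := by
        refine setLIntegral_mono' hm fun p hp => (h p hp).trans ?_
        refine le_trans ?_ (lintegral_mono_set (prod_mono (Ioc_subset_Ioc_right hp.1.2)
          (Ioc_subset_Ioc_right hp.2.2)))
        refine setLIntegral_mono' (measurableSet_Ioc.prod measurableSet_Ioc) fun q hq => ?_
        have h1 : p.1 - q.1 ∈ Ici (0 : ℝ) := mem_Ici.2 (by linarith [hq.1.2])
        have h2 : p.2 - q.2 ∈ Ici (0 : ℝ) := mem_Ici.2 (by linarith [hq.2.2])
        simp only [hE, indicator_of_mem h1, indicator_of_mem h2, le_refl]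
    _ = ∫⁻ q in Ioc 0 T ×ˢ Ioc 0 T, ∫⁻ p in Ioc 0 T ×ˢ Ioc 0 T,
          E (p.1 - q.1) * E (p.2 - q.2) * κ q := by
        refine lintegral_lintegral_swap (Measurable.aemeasurable ?_)
        simp only [Function.uncurry_def]
        fun_prop
    _ ≤ ∫⁻ q in Ioc 0 T ×ˢ Ioc 0 T, ENNReal.ofReal (1 / k) ^ 2 * κ q := by
        refine lintegral_mono fun q => ?_
        rw [lintegral_mul_const _ (by fun_prop)]
        gcongr
        refine (setLIntegral_le_lintegral _ _).trans ?_
        rw [Measure.volume_eq_prod, lintegral_prod_mul (f := fun x => E (x - q.1))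
          (g := fun x => E (x - q.2)) (by fun_prop) (by fun_prop), lintegral_sub_right_eq_self,
          lintegral_sub_right_eq_self, hEi, sq]
    _ = _ := lintegral_const_mul _ hκ

namespace KernelGaussian
variable {g : ℝ → Ω → ℝ} {K : ℝ → ℝ → ℝ} {β C C' : ℝ} (M : KernelGaussian P g K β C C')
include M

lemma measurable_uncurry_ou (k : ℝ) :
    Measurable (Function.uncurry fun t ω => ou k (fun s => g s ω) (max t 0)) := by
  refine measurable_uncurry_of_continuous_of_measurable (fun ω => ?_)
    fun t => M.measurable_ou k (le_max_right _ _)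
  exact (continuous_ou k (M.cont ω)).comp (by fun_prop)

/-- The diagonal may be included because 0 raised to the nonzero exponent 2β-2 is 0 by convention,
which reduces the claim there to `boundK`. -/
lemma abs_kernel_sub_le (u v : ℝ) (hu : 0 < u) (hv : 0 < v) :
    |K u v - C * |u - v| ^ (2 * β - 2)| ≤ C' * (|u| ^ (β - 1) * |v| ^ (β - 1)) := by
  by_cases h : u = v
  · subst h
    have h1 := M.boundK u u
    have h2 : 2 * β - 2 ≠ 0 := by linarith [M.lt_one]
    simp only [kernelBound, sub_self, abs_zero, Real.zero_rpow h2, mul_zero, zero_add, sub_zero] at h1 ⊢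
    exact h1
  · exact M.closeK u v hu hv h

/-- The bound on the remainder kernel is a product in u and v, so its double integral is the square
of the one-dimensional integral in `tendsto_integral_exp_rpow`; the main term is
`tendsto_integral_reflected`. -/
lemma tendsto_ouCov_self {k : ℝ} (hk : 0 < k) :
    Tendsto (fun t => ouCov P g k t t) atTop
      (𝓝 (C * (Real.Gamma (2 * β - 1) * k ^ (-(2 * β))))) := by
  have h1 := (tendsto_integral_reflected hk M.half_lt M.lt_one).const_mul C
  have h2 := ((tendsto_integral_exp_rpow hk (by linarith [M.half_lt]) M.lt_one).pow 2).const_mul C'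
  rw [zero_pow two_ne_zero, mul_zero] at h2
  refine tendsto_of_tendsto_of_dist h1 (squeeze_zero' (Eventually.of_forall fun t => dist_nonneg)
    ?_ h2)
  filter_upwards [eventually_ge_atTop 0] with t ht
  have hI : IntervalIntegrable (fun u => Real.exp (-(k * (t - u))) * |u| ^ (β - 1)) volume 0 t :=
    (intervalIntegrable_abs_rpow (by linarith [M.half_lt]) 0 t).continuousOn_mul (by fun_prop)
  have hI' : IntegrableOn (fun u => Real.exp (-(k * (t - u))) * |u| ^ (β - 1)) (Ioc 0 t) :=
    (intervalIntegrable_iff_integrableOn_Ioc_of_le ht).1 hI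
  have hexp : ∀ u, u ≤ t → Real.exp (-(k * (t - u))) ≤ 1 := fun u hu => by
    rw [Real.exp_le_one_iff]; nlinarith
  have hb : ∀ p ∈ Ioc 0 t ×ˢ Ioc 0 t,
      ‖Real.exp (-(k * (t - p.1))) * Real.exp (-(k * (t - p.2)))‖ ≤ 1 := fun p hp => by
    rw [norm_mul, Real.norm_of_nonneg (Real.exp_pos _).le, Real.norm_of_nonneg (Real.exp_pos _).le]
    exact mul_le_one₀ (hexp _ hp.1.2) (Real.exp_pos _).le (hexp _ hp.2.2)
  have hms : MeasurableSet (Ioc 0 t ×ˢ Ioc 0 t : Set (ℝ × ℝ)) :=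
    measurableSet_Ioc.prod measurableSet_Ioc
  have i1 : IntegrableOn (fun p : ℝ × ℝ => Real.exp (-(k * (t - p.1))) * Real.exp (-(k * (t - p.2))) *
      K p.1 p.2) (Ioc 0 t ×ˢ Ioc 0 t) :=
    (M.kernel_integrableOn le_rfl le_rfl).bdd_mul (c := 1) (by fun_prop)
      ((ae_restrict_mem hms).mono hb)
  have i2 : IntegrableOn (fun p : ℝ × ℝ => Real.exp (-(k * (t - p.1))) * Real.exp (-(k * (t - p.2))) *
      |p.1 - p.2| ^ (2 * β - 2)) (Ioc 0 t ×ˢ Ioc 0 t) := by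
    have h3 := (integrableOn_abs_sub_rpow M.half_lt M.lt_one 0 t ht).1
    rw [Measure.prod_restrict, ← Measure.volume_eq_prod] at h3
    exact h3.bdd_mul (c := 1) (by fun_prop) ((ae_restrict_mem hms).mono hb)
  have e : (∫ u in 0..t, Real.exp (-(k * (t - u))) * |u| ^ (β - 1)) ^ 2 =
      ∫ p in Ioc 0 t ×ˢ Ioc 0 t, (Real.exp (-(k * (t - p.1))) * |p.1| ^ (β - 1)) *
        (Real.exp (-(k * (t - p.2))) * |p.2| ^ (β - 1)) := by
    rw [Measure.volume_eq_prod, ← Measure.prod_restrict,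
      integral_prod_mul (fun u => Real.exp (-(k * (t - u))) * |u| ^ (β - 1))
        (fun u => Real.exp (-(k * (t - u))) * |u| ^ (β - 1)), sq,
      intervalIntegral.integral_of_le ht]
  have i3 : IntegrableOn (fun p : ℝ × ℝ => (Real.exp (-(k * (t - p.1))) * |p.1| ^ (β - 1)) *
        (Real.exp (-(k * (t - p.2))) * |p.2| ^ (β - 1))) (Ioc 0 t ×ˢ Ioc 0 t) := by
    rw [IntegrableOn, Measure.volume_eq_prod, ← Measure.prod_restrict]
    exact hI'.mul_prod hI'
  rw [ouCov, M.cov_ou hk ht ht, dist_comm, Real.dist_eq, ← integral_const_mul,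
    ← integral_sub i1 (i2.const_mul C), e, ← integral_const_mul, ← Real.norm_eq_abs]
  refine norm_integral_le_of_norm_le (i3.const_mul C') ((ae_restrict_mem hms).mono fun p hp => ?_)
  have := M.abs_kernel_sub_le p.1 p.2 hp.1.1 hp.2.1
  have e2 : Real.exp (-(k * (t - p.1))) * Real.exp (-(k * (t - p.2))) * K p.1 p.2 -
      C * (Real.exp (-(k * (t - p.1))) * Real.exp (-(k * (t - p.2))) * |p.1 - p.2| ^ (2 * β - 2)) =
      (Real.exp (-(k * (t - p.1))) * Real.exp (-(k * (t - p.2)))) *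
        (K p.1 p.2 - C * |p.1 - p.2| ^ (2 * β - 2)) := by ring
  rw [e2, norm_mul, Real.norm_of_nonneg (by positivity), Real.norm_eq_abs]
  calc _ ≤ _ := mul_le_mul_of_nonneg_left this (by positivity)
    _ = _ := by ring

lemma exists_ouCov_self_le {k : ℝ} (hk : 0 < k) :
    ∃ B : ℝ, 0 ≤ B ∧ ∀ t, 0 ≤ t → ouCov P g k t t ≤ B := by
  obtain ⟨T, hT⟩ := eventually_atTop.1 ((M.tendsto_ouCov_self hk).eventually_le_const (lt_add_one _))
  obtain ⟨Y, hY, -, h⟩ := M.exists_dominating_ou hk T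
  have hY2 : MemLp Y 2 P := hY.mono_exponent (by norm_num)
  set L := C * (Real.Gamma (2 * β - 1) * k ^ (-(2 * β))) + 1
  refine ⟨max L (∫ ω, Y ω ^ 2 ∂P), le_max_of_le_right (integral_nonneg fun ω => sq_nonneg _),
    fun t ht => ?_⟩
  rcases le_total T t with h1 | h1
  · exact (hT t h1).trans (le_max_left _ _)
  · refine le_max_of_le_right ?_
    have hZ : MemLp (fun ω => ou k (fun s => g s ω) t) 2 P :=
      (M.memLp_ou hk ht).mono_exponent (by norm_num)
    refine integral_mono_ae (hZ.integrable_mul hZ) hY2.integrable_sq ?_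
    filter_upwards [h] with ω hω
    have := (hω t ⟨ht, h1⟩).2.1
    rw [← sq, ← sq_abs]
    exact pow_le_pow_left₀ (abs_nonneg _) this 2

lemma abs_ouCov_le {k : ℝ} (hk : 0 < k) {B : ℝ} (hB : ∀ t, 0 ≤ t → ouCov P g k t t ≤ B) {t s : ℝ}
    (ht : 0 ≤ t) (hs : 0 ≤ s) : |ouCov P g k t s| ≤ B := by
  have hZ : ∀ {t}, 0 ≤ t → MemLp (fun ω => ou k (fun s => g s ω) t) 2 P := fun ht =>
    (M.memLp_ou hk ht).mono_exponent (by norm_num)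
  have h1 := hB t ht
  have h2 := hB s hs
  have it : Integrable (fun ω => ou k (fun r => g r ω) t * ou k (fun r => g r ω) t) P :=
    (hZ ht).integrable_mul (hZ ht)
  have is : Integrable (fun ω => ou k (fun r => g r ω) s * ou k (fun r => g r ω) s) P :=
    (hZ hs).integrable_mul (hZ hs)
  have : |ouCov P g k t s| ≤ ∫ ω, ((1 / 2) * (ou k (fun r => g r ω) t * ou k (fun r => g r ω) t) +
      (1 / 2) * (ou k (fun r => g r ω) s * ou k (fun r => g r ω) s)) ∂P := by
    rw [ouCov, ← Real.norm_eq_abs]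
    refine norm_integral_le_of_norm_le ((it.const_mul _).add (is.const_mul _))
      (ae_of_all _ fun ω => ?_)
    rw [Real.norm_eq_abs, abs_le]
    constructor <;> nlinarith [sq_nonneg (ou k (fun r => g r ω) t + ou k (fun r => g r ω) s),
      sq_nonneg (ou k (fun r => g r ω) t - ou k (fun r => g r ω) s)]
  rw [integral_add (it.const_mul _) (is.const_mul _), integral_const_mul, integral_const_mul] at this
  unfold ouCov at *
  linarith

/-- The growth T^{2β} of ∫∫|K| survives the smoothing up to the factor k^{-2}. As 2β < 2, this is
the decorrelation that drives the law of large numbers. -/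
lemma exists_lintegral_ouCov_le {k : ℝ} (hk : 0 < k) : ∃ c : ℝ, 0 ≤ c ∧ ∀ T, 0 ≤ T →
    ∫⁻ p in Ioc 0 T ×ˢ Ioc 0 T, ENNReal.ofReal |ouCov P g k p.1 p.2| ≤
      ENNReal.ofReal (c * T ^ (2 * β)) := by
  obtain ⟨c, hc, h⟩ := M.exists_integral_abs_kernel_le
  refine ⟨(1 / k) ^ 2 * c, by positivity, fun T hT => ?_⟩
  refine (lintegral_exp_smoothing hk (κ := fun q => ENNReal.ofReal |K q.1 q.2|)
    M.measK.abs.ennreal_ofReal fun p hp => ?_).trans ?_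
  · rw [ouCov, M.cov_ou hk hp.1.1.le hp.2.1.le, ← Real.norm_eq_abs, ofReal_norm]
    refine (enorm_integral_le_lintegral_enorm _).trans (lintegral_mono fun q => le_of_eq ?_)
    rw [enorm_mul, enorm_mul, Real.enorm_eq_ofReal (Real.exp_pos _).le,
      Real.enorm_eq_ofReal (Real.exp_pos _).le, Real.enorm_eq_ofReal_abs]
  · have := h 0 T le_rfl hT
    rw [sub_zero] at this
    rw [← ofReal_integral_eq_lintegral_ofReal (M.kernel_integrableOn le_rfl le_rfl).abs
      (ae_of_all _ fun _ => abs_nonneg _), ← ENNReal.ofReal_pow (by positivity),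
      ← ENNReal.ofReal_mul (by positivity), mul_assoc]
    gcongr

/-- Second moments of the time averages of the Ornstein-Uhlenbeck process. -/
lemma exists_moment_time_integral_le {k : ℝ} (hk : 0 < k) : ∃ c : ℝ, 0 ≤ c ∧ ∀ T, 0 ≤ T →
    (Integrable (fun ω => (∫ t in Ioc 0 T, ou k (fun s => g s ω) (max t 0)) ^ 2) P ∧
      ∫ ω, (∫ t in Ioc 0 T, ou k (fun s => g s ω) (max t 0)) ^ 2 ∂P ≤ c * T ^ (2 * β)) ∧
    (Integrable (fun ω => (∫ t in Ioc 0 T, (ou k (fun s => g s ω) (max t 0) ^ 2 -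
        ouCov P g k (max t 0) (max t 0))) ^ 2) P ∧
      ∫ ω, (∫ t in Ioc 0 T, (ou k (fun s => g s ω) (max t 0) ^ 2 -
        ouCov P g k (max t 0) (max t 0))) ^ 2 ∂P ≤ c * T ^ (2 * β)) := by
  obtain ⟨B, hB0, hB⟩ := M.exists_ouCov_self_le hk
  obtain ⟨c, hc, hcT⟩ := M.exists_lintegral_ouCov_le hk
  -- One constant for both estimates: c alone would do for the process, and 2Bc for its square.
  refine ⟨(1 + 2 * B) * c, by positivity, fun T hT => ?_⟩
  obtain ⟨Y, hY, hY1, h⟩ := M.exists_dominating_ou hk T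
  have hY2 : MemLp Y 2 P := hY.mono_exponent (by norm_num)
  have hms : MeasurableSet (Ioc 0 T ×ˢ Ioc 0 T : Set (ℝ × ℝ)) :=
    measurableSet_Ioc.prod measurableSet_Ioc
  have hm := M.measurable_uncurry_ou k
  have hTβ : 0 ≤ c * T ^ (2 * β) := by positivity
  obtain ⟨a1, a2, a3⟩ := integral_sq_time_integral (P := P) (T := T) hm hY2 (by
    filter_upwards [h] with ω hω t ht
    rw [max_eq_left ht.1]
    exact (hω t ht).2.1)
  have hρ : ∀ p ∈ Ioc 0 T ×ˢ Ioc 0 T, ∫ ω, ou k (fun s => g s ω) (max p.1 0) *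
      ou k (fun s => g s ω) (max p.2 0) ∂P = ouCov P g k p.1 p.2 := fun p hp => by
    rw [max_eq_left hp.1.1.le, max_eq_left hp.2.1.le, ouCov]
  have a4 : IntegrableOn (fun p : ℝ × ℝ => ouCov P g k p.1 p.2) (Ioc 0 T ×ˢ Ioc 0 T) :=
    a2.congr ((ae_restrict_mem hms).mono hρ)
  have a5 : ∫ p in Ioc 0 T ×ˢ Ioc 0 T, |ouCov P g k p.1 p.2| ≤ c * T ^ (2 * β) := by
    have := hcT T hT
    rwa [← ofReal_integral_eq_lintegral_ofReal a4.abs (ae_of_all _ fun _ => abs_nonneg _),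
      ENNReal.ofReal_le_ofReal_iff hTβ] at this
  have hvm : Measurable fun t => ouCov P g k (max t 0) (max t 0) := by
    have : StronglyMeasurable (Function.uncurry fun (t : ℝ) (ω : Ω) =>
        ou k (fun s => g s ω) (max t 0) * ou k (fun s => g s ω) (max t 0)) :=
      (hm.mul hm).stronglyMeasurable
    exact this.integral_prod_right.measurable
  have hWm : Measurable (Function.uncurry fun (t : ℝ) (ω : Ω) => ou k (fun s => g s ω) (max t 0) ^ 2 -
        ouCov P g k (max t 0) (max t 0)) := (hm.pow_const 2).sub (hvm.comp measurable_fst)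
  obtain ⟨b1, b2, b3⟩ := integral_sq_time_integral (P := P) (T := T) (Y := fun ω => Y ω ^ 2 + B)
    hWm (hY.sq_of_four.add (memLp_const B)) (by
    filter_upwards [h] with ω hω t ht
    rw [max_eq_left ht.1]
    have h1 := (hω t ht).2.1
    have h2 := M.abs_ouCov_le hk hB ht.1 ht.1
    refine (abs_sub _ _).trans (add_le_add ?_ h2)
    rw [abs_of_nonneg (sq_nonneg _), ← sq_abs]
    exact pow_le_pow_left₀ (abs_nonneg _) h1 2)
  refine ⟨⟨a1, ?_⟩, ⟨b1, ?_⟩⟩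
  · rw [a3, setIntegral_congr_fun hms hρ]
    refine (le_abs_self _).trans (abs_integral_le_integral_abs.trans (a5.trans ?_))
    nlinarith
  · rw [b3]
    refine (le_abs_self _).trans ?_
    have : |∫ p in Ioc 0 T ×ˢ Ioc 0 T, ∫ ω, (ou k (fun s => g s ω) (max p.1 0) ^ 2 -
        ouCov P g k (max p.1 0) (max p.1 0)) * (ou k (fun s => g s ω) (max p.2 0) ^ 2 -
        ouCov P g k (max p.2 0) (max p.2 0)) ∂P| ≤
        ∫ p in Ioc 0 T ×ˢ Ioc 0 T, 2 * B * |ouCov P g k p.1 p.2| := by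
      rw [← Real.norm_eq_abs]
      refine norm_integral_le_of_norm_le (a4.abs.const_mul _) ((ae_restrict_mem hms).mono fun p hp => ?_)
      rw [max_eq_left hp.1.1.le, max_eq_left hp.2.1.le]
      set U := fun ω => ou k (fun s => g s ω) p.1
      set V := fun ω => ou k (fun s => g s ω) p.2
      have hU : MemLp U 4 P := M.memLp_ou hk hp.1.1.le
      have hV : MemLp V 4 P := M.memLp_ou hk hp.2.1.le
      have is := M.integral_ou_sq_mul_sq hk hp.1.1.le hp.2.1.le
      have eU : ouCov P g k p.1 p.1 = ∫ ω, U ω ^ 2 ∂P := by simp only [ouCov, sq, U]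
      have eV : ouCov P g k p.2 p.2 = ∫ ω, V ω ^ 2 ∂P := by simp only [ouCov, sq, V]
      have i1 : Integrable (fun ω => U ω ^ 2 * V ω ^ 2) P := hU.sq_of_four.integrable_mul hV.sq_of_four
      have i2 : Integrable (fun ω => -(ouCov P g k p.2 p.2) * U ω ^ 2 +
          -(ouCov P g k p.1 p.1) * V ω ^ 2) P :=
        ((hU.sq_of_four.integrable (by norm_num)).const_mul _).add
          ((hV.sq_of_four.integrable (by norm_num)).const_mul _)
      -- Isserlis' formula: the covariance of U² and V² is 2ρ², later bounded by 2B|ρ|.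
      have e : ∫ ω, (U ω ^ 2 - ouCov P g k p.1 p.1) * (V ω ^ 2 - ouCov P g k p.2 p.2) ∂P =
          2 * ouCov P g k p.1 p.2 ^ 2 := by
        have : ∀ ω, (U ω ^ 2 - ouCov P g k p.1 p.1) * (V ω ^ 2 - ouCov P g k p.2 p.2) =
            U ω ^ 2 * V ω ^ 2 + (-(ouCov P g k p.2 p.2) * U ω ^ 2 +
          -(ouCov P g k p.1 p.1) * V ω ^ 2) + ouCov P g k p.1 p.1 * ouCov P g k p.2 p.2 := fun ω => by
          ring
        simp only [this]
        rw [integral_add_add i1 i2 (integrable_const _), is,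
          integral_add ((hU.sq_of_four.integrable (by norm_num)).const_mul _)
          ((hV.sq_of_four.integrable (by norm_num)).const_mul _), integral_const_mul,
          integral_const_mul, integral_const, ← eU, ← eV]
        simp only [ouCov, probReal_univ, one_smul]
        ring
      rw [e, norm_mul, Real.norm_eq_abs, Real.norm_eq_abs, abs_pow, abs_two, sq]
      have := M.abs_ouCov_le hk hB hp.1.1.le hp.2.1.le
      nlinarith [abs_nonneg (ouCov P g k p.1 p.2)]
    refine this.trans ?_
    rw [integral_const_mul]
    nlinarith

end KernelGaussian
end Asymptotics

/-! ### The law of large numbers and sublinear growth -/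

section Ergodic
variable {Ω : Type*} [MeasurableSpace Ω] {P : Measure Ω} [IsProbabilityMeasure P]

/-- Almost sure convergence of time averages along a polynomial sequence. -/
lemma tendsto_time_average_of_moment {W : ℝ → Ω → ℝ} (hW : Measurable (Function.uncurry W))
    {c β : ℝ} (hc : 0 ≤ c) {p : ℕ} (hp : p ≠ 0) (hpβ : 2 ≤ p * (2 - 2 * β))
    (h : ∀ T, 0 ≤ T → Integrable (fun ω => (∫ t in Ioc 0 T, W t ω) ^ 2) P ∧
      ∫ ω, (∫ t in Ioc 0 T, W t ω) ^ 2 ∂P ≤ c * T ^ (2 * β)) :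
    ∀ᵐ ω ∂P, Tendsto (fun n : ℕ => (∫ t in Ioc 0 ((n : ℝ) ^ p), W t ω) / (n : ℝ) ^ p) atTop
      (𝓝 0) := by
  refine tendsto_zero_of_second_moment (c := c) (fun n => ?_) (fun n => ?_) fun n => ?_
  · have : StronglyMeasurable (Function.uncurry fun ω t => W t ω) :=
      (hW.comp measurable_swap).stronglyMeasurable
    exact (this.integral_prod_right (ν := volume.restrict (Ioc 0 ((n : ℝ) ^ p)))).measurable.div_const _
  · simp only [div_pow]
    exact (h _ (by positivity)).1.div_const _
  · simp only [div_pow]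
    rw [integral_div]
    -- At n = 0 both sides vanish, since division by zero yields zero.
    rcases Nat.eq_zero_or_pos n with rfl | hn
    · simp [hp]
    have hn1 : (1 : ℝ) ≤ n := by exact_mod_cast hn
    have hn0 : (0 : ℝ) < n := by linarith
    rw [div_le_iff₀ (by positivity)]
    refine (h _ (by positivity)).2.trans ?_
    rw [mul_assoc]
    refine mul_le_mul_of_nonneg_left ?_ hc
    rw [one_div, ← Real.rpow_natCast n 2, ← Real.rpow_neg hn0.le, ← Real.rpow_natCast n p,
      ← Real.rpow_natCast _ 2, ← Real.rpow_mul hn0.le, ← Real.rpow_mul hn0.le, ← Real.rpow_add hn0]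
    refine Real.rpow_le_rpow_of_exponent_le hn1 ?_
    push_cast
    linarith

namespace KernelGaussian
variable {g : ℝ → Ω → ℝ} {K : ℝ → ℝ → ℝ} {β C C' : ℝ} (M : KernelGaussian P g K β C C')
include M

/-- The law of large numbers for the Ornstein-Uhlenbeck process and its square. -/
theorem tendsto_time_average {k : ℝ} (hk : 0 < k) : ∀ᵐ ω ∂P,
    Tendsto (fun T => (∫ t in 0..T, ou k (fun s => g s ω) t) / T) atTop (𝓝 0) ∧
    Tendsto (fun T => (∫ t in 0..T, ou k (fun s => g s ω) t ^ 2) / T) atTop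
      (𝓝 (C * (Real.Gamma (2 * β - 1) * k ^ (-(2 * β))))) := by
  obtain ⟨c, hc, h⟩ := M.exists_moment_time_integral_le hk
  set σ := C * (Real.Gamma (2 * β - 1) * k ^ (-(2 * β))) with hσ
  have hβ : 0 < 2 - 2 * β := by linarith [M.lt_one]
  -- Along T = n^p the average has second moment of order n^{-p(2-2β)}, so this p makes it at most a
  -- multiple of n^{-2}.
  obtain ⟨p, hp⟩ := exists_nat_ge (2 / (2 - 2 * β))
  rw [div_le_iff₀ hβ] at hp
  have hp0 : p ≠ 0 := by rintro rfl; norm_num at hp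
  have hm := M.measurable_uncurry_ou k
  have hvm : Measurable fun t => ouCov P g k (max t 0) (max t 0) := by
    have : StronglyMeasurable (Function.uncurry fun (t : ℝ) (ω : Ω) =>
        ou k (fun s => g s ω) (max t 0) * ou k (fun s => g s ω) (max t 0)) :=
      (hm.mul hm).stronglyMeasurable
    exact this.integral_prod_right.measurable
  have hWm : Measurable (Function.uncurry fun (t : ℝ) (ω : Ω) => ou k (fun s => g s ω) (max t 0) ^ 2 -
        ouCov P g k (max t 0) (max t 0)) := (hm.pow_const 2).sub (hvm.comp measurable_fst)
  obtain ⟨B, hB0, hB⟩ := M.exists_ouCov_self_le hk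
  have hvb : ∀ t, ‖ouCov P g k (max t 0) (max t 0)‖ ≤ B := fun t =>
    M.abs_ouCov_le hk hB (le_max_right _ _) (le_max_right _ _)
  have hvi : ∀ a b, IntervalIntegrable (fun t => ouCov P g k (max t 0) (max t 0)) volume a b :=
    fun a b => (intervalIntegrable_const (c := B)).mono_fun' hvm.aestronglyMeasurable
      (ae_of_all _ hvb)
  have hvlim : Tendsto (fun t => ouCov P g k (max t 0) (max t 0)) atTop (𝓝 σ) := by
    refine (M.tendsto_ouCov_self hk).congr' ?_
    filter_upwards [eventually_ge_atTop 0] with t ht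
    rw [max_eq_left ht]
  have hces := tendsto_cesaro (fun T _ => hvi 0 T) hvlim
  have hnp : Tendsto (fun n : ℕ => (n : ℝ) ^ p) atTop atTop :=
    (tendsto_pow_atTop hp0).comp tendsto_natCast_atTop_atTop
  filter_upwards [tendsto_time_average_of_moment hm hc hp0 hp fun T hT => (h T hT).1,
    tendsto_time_average_of_moment hWm hc hp0 hp fun T hT => (h T hT).2] with ω h1 h2
  set z := fun t => ou k (fun s => g s ω) t with hz
  have hzc : Continuous z := continuous_ou k (M.cont ω)
  have hzi : ∀ a b, IntervalIntegrable z volume a b := fun a b => hzc.intervalIntegrable a b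
  have hz2 : ∀ a b, IntervalIntegrable (fun t => z t ^ 2) volume a b := fun a b =>
    (hzc.pow 2).intervalIntegrable a b
  have f1 : ∀ T, 0 ≤ T → ∫ t in Ioc 0 T, z (max t 0) = ∫ t in 0..T, z t := fun T hT => by
    rw [intervalIntegral.integral_of_le hT]
    refine setIntegral_congr_fun measurableSet_Ioc fun t ht => ?_
    simp only [max_eq_left ht.1.le]
  have f2 : ∀ T, 0 ≤ T → ∫ t in Ioc 0 T, (z (max t 0) ^ 2 - ouCov P g k (max t 0) (max t 0)) =
      (∫ t in 0..T, z t ^ 2) - ∫ t in 0..T, ouCov P g k (max t 0) (max t 0) := fun T hT => by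
    rw [← intervalIntegral.integral_sub (hz2 _ _) (hvi _ _), intervalIntegral.integral_of_le hT]
    refine setIntegral_congr_fun measurableSet_Ioc fun t ht => ?_
    simp only [max_eq_left ht.1.le]
  have g1 : Tendsto (fun n : ℕ => (∫ t in 0..((n : ℝ) ^ p), z t) / (n : ℝ) ^ p) atTop (𝓝 0) := by
    refine h1.congr fun n => ?_
    rw [← f1 _ (by positivity)]
  have g2 : Tendsto (fun n : ℕ => (∫ t in 0..((n : ℝ) ^ p), z t ^ 2) / (n : ℝ) ^ p) atTop (𝓝 σ) := by
    have h3 := h2.add (hces.comp hnp)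
    rw [zero_add] at h3
    refine h3.congr fun n => ?_
    have := f2 ((n : ℝ) ^ p) (by positivity)
    simp only [hz] at this
    rw [this, Function.comp, ← add_div, sub_add_cancel]
  have mono : ∀ w : ℝ → ℝ, Continuous w → (∀ t, 0 ≤ w t) →
      MonotoneOn (fun T => ∫ t in 0..T, w t) (Ici 0) := fun w hw h0 S hS T hT hST => by
    refine intervalIntegral.integral_mono_interval le_rfl hS hST (ae_of_all _ h0)
      (hw.intervalIntegrable _ _)
  have r2 := tendsto_div_of_monotoneOn (mono (fun t => z t ^ 2) (hzc.pow 2) fun t => sq_nonneg _)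
    (by simp) hp0 g2
  -- The integral of z is not monotone in T, but that of (z+1)² is; the average of z is recovered by
  -- subtracting the averages of z² and 1.
  have e : ∀ T, ∫ t in 0..T, (z t + 1) ^ 2 = (∫ t in 0..T, z t ^ 2) + 2 * (∫ t in 0..T, z t) + T := by
    intro T
    have : ∀ t, (z t + 1) ^ 2 = z t ^ 2 + 2 * z t + 1 := fun t => by ring
    simp only [this]
    rw [intervalIntegral.integral_add ((hz2 _ _).add ((hzi _ _).const_mul 2)) (by simp),
      intervalIntegral.integral_add (hz2 _ _) ((hzi _ _).const_mul 2),
      intervalIntegral.integral_const_mul]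
    simp
  have g3 : Tendsto (fun n : ℕ => (∫ t in 0..((n : ℝ) ^ p), (z t + 1) ^ 2) / (n : ℝ) ^ p) atTop
      (𝓝 (σ + 2 * 0 + 1)) := by
    refine ((g2.add (g1.const_mul 2)).add_const 1).congr' ?_
    filter_upwards [eventually_gt_atTop 0] with n hn
    have : (0 : ℝ) < n := by exact_mod_cast hn
    rw [e]
    field_simp
  have r3 := tendsto_div_of_monotoneOn (mono (fun t => (z t + 1) ^ 2) (by fun_prop)
    fun t => sq_nonneg _) (by simp) hp0 g3
  refine ⟨?_, r2⟩
  have r1 := ((r3.sub r2).sub_const 1).div_const 2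
  have e0 : (σ + 2 * 0 + 1 - σ - 1) / 2 = 0 := by ring
  rw [e0] at r1
  refine r1.congr' ?_
  filter_upwards [eventually_gt_atTop 0] with T hT
  simp only [e]
  field_simp
  ring

/-- The Ornstein-Uhlenbeck process grows more slowly than `√t`. -/
theorem tendsto_ou_sq_div_atTop {k : ℝ} (hk : 0 < k) : ∀ᵐ ω ∂P,
    Tendsto (fun t => ou k (fun s => g s ω) t ^ 2 / t) atTop (𝓝 0) := by
  obtain ⟨c, hc, h⟩ := M.exists_block_bound
  have h' : ∀ n : ℕ, ∃ N : Ω → ENNReal, Measurable N ∧ ∫⁻ ω, N ω ∂P ≤ ENNReal.ofReal c ∧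
      ∀ ω, ∀ t ∈ Icc (n : ℝ) (n + 1), ENNReal.ofReal ((g t ω - g n ω) ^ 4) ≤ N ω := fun n => by
    simpa using h n 1 (Nat.cast_nonneg n) one_pos
  choose N hNm hNi hN using h'
  have hs : Summable fun n : ℕ => 1 / ((n : ℝ) + 1) ^ 2 := by
    have := (summable_nat_add_iff 1).2 (Real.summable_one_div_nat_pow.2 (one_lt_two))
    simpa using this
  -- N_n dominates the fourth power of the oscillation on [n, n+1] and has bounded mean, so
  -- N_n/(n+1)² is almost surely null and the oscillation is o(√n).
  have hF := tendsto_zero_of_summable_lintegral (P := P)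
    (F := fun n ω => ENNReal.ofReal (1 / ((n : ℝ) + 1) ^ 2) * N n ω)
    (fun n => (hNm n).const_mul _) (ne_top_of_le_ne_top
      (b := ∑' n : ℕ, ENNReal.ofReal (1 / ((n : ℝ) + 1) ^ 2) * ENNReal.ofReal c) ?_
      (ENNReal.tsum_le_tsum fun n => ?_))
  · have hfin : ∀ᵐ ω ∂P, ∀ n, N n ω < ⊤ := ae_all_iff.2 fun n =>
      ae_lt_top (hNm n) ((hNi n).trans_lt ENNReal.ofReal_lt_top).ne
    filter_upwards [hF, hfin] with ω hω hω'
    refine tendsto_ou_sq_div hk (M.cont ω) (y := fun n => (N n ω).toReal ^ ((1 : ℝ) / 4))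
      (fun n => by positivity) (fun n t ht => ?_) ?_
    · have h1 := ENNReal.toReal_mono (hω' n).ne (hN n ω t ht)
      rw [ENNReal.toReal_ofReal (by positivity)] at h1
      have h2 := Real.rpow_le_rpow (by positivity) h1 (z := (1 : ℝ) / 4) (by norm_num)
      refine le_trans (le_of_eq ?_) h2
      rw [← Even.pow_abs (by decide : Even 4), ← Real.rpow_natCast, ← Real.rpow_mul (abs_nonneg _)]
      norm_num
    · have h2 := (ENNReal.tendsto_toReal ENNReal.zero_ne_top).comp hω
      have h3 := h2.rpow_const (p := (1 : ℝ) / 4) (Or.inr (by norm_num))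
      rw [ENNReal.toReal_zero, Real.zero_rpow (by norm_num)] at h3
      refine h3.congr fun n => ?_
      have hn : (0 : ℝ) < n + 1 := by positivity
      simp only [Function.comp]
      rw [ENNReal.toReal_mul, ENNReal.toReal_ofReal (by positivity),
        Real.mul_rpow (by positivity) (by positivity), one_div (_ ^ 2),
        Real.inv_rpow (by positivity), ← Real.rpow_natCast, ← Real.rpow_mul hn.le, Real.sqrt_eq_rpow,
        ← div_eq_inv_mul]
      norm_num
  · rw [ENNReal.tsum_mul_right, ← ENNReal.ofReal_tsum_of_nonneg (fun n => by positivity) hs]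
    exact ENNReal.mul_ne_top ENNReal.ofReal_ne_top ENNReal.ofReal_ne_top
  · rw [lintegral_const_mul _ (hNm n)]
    exact mul_le_mul_right (hNi n) _

end KernelGaussian
end Ergodic

/-! ### Gaussian integration by parts -/

section Stein
variable {Ω : Type*} [MeasurableSpace Ω] {P : Measure Ω} [IsProbabilityMeasure P]

/-- Stein's formula conditionally on an independent random variable. -/
lemma stein_of_indepFun {E : Type*} [MeasurableSpace E] {Y : Ω → E} {V : Ω → ℝ}
    (hY : Measurable Y) (hV : Measurable V) (hind : IndepFun Y V P) {v : NNReal}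
    (hlaw : P.map V = gaussianReal 0 v) {H H' : E → ℝ → ℝ} (hH : Measurable (Function.uncurry H))
    (hH' : Measurable (Function.uncurry H')) (hd : ∀ y x, HasDerivAt (H y) (H' y x) x)
    (i1 : Integrable (fun ω => V ω * H (Y ω) (V ω)) P) (i2 : Integrable (fun ω => H' (Y ω) (V ω)) P)
    (i3 : Integrable (fun ω => H (Y ω) (V ω)) P) :
    ∫ ω, V ω * H (Y ω) (V ω) ∂P = v * ∫ ω, H' (Y ω) (V ω) ∂P := by
  have hYV : Measurable fun ω => (Y ω, V ω) := hY.prodMk hV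
  have hmap := hind.map_prod_eq_prod_map_map hY.aemeasurable hV.aemeasurable
  rw [hlaw] at hmap
  have hpY : IsProbabilityMeasure (P.map Y) := Measure.isProbabilityMeasure_map hY.aemeasurable
  have m1 : Measurable fun p : E × ℝ => p.2 * H p.1 p.2 := measurable_snd.mul hH
  have m2 : Measurable fun p : E × ℝ => H' p.1 p.2 := hH'
  have m3 : Measurable fun p : E × ℝ => H p.1 p.2 := hH
  have j1 := (integrable_map_measure m1.aestronglyMeasurable hYV.aemeasurable).2 i1
  have j2 := (integrable_map_measure m2.aestronglyMeasurable hYV.aemeasurable).2 i2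
  have j3 := (integrable_map_measure m3.aestronglyMeasurable hYV.aemeasurable).2 i3
  have e1 := integral_map hYV.aemeasurable m1.aestronglyMeasurable (μ := P)
  have e2 := integral_map hYV.aemeasurable m2.aestronglyMeasurable (μ := P)
  rw [hmap] at j1 j2 j3 e1 e2
  simp only at e1 e2
  rw [← e1, ← e2, integral_prod _ j1, integral_prod _ j2, ← integral_const_mul]
  refine integral_congr_ae ?_
  filter_upwards [j1.prod_right_ae, j2.prod_right_ae, j3.prod_right_ae] with y k1 k2 k3
  exact gaussianReal_stein (hd y) k1 k2 k3

lemma IsCbSmooth.exists_bound {m : ℕ} {F : (Fin m → ℝ) → ℝ} (hF : IsCbSmooth F) :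
    ∃ B, 0 ≤ B ∧ (∀ x, |F x| ≤ B) ∧ ∀ x, ‖fderiv ℝ F x‖ ≤ B := by
  obtain ⟨B0, h0⟩ := hF.2 0
  obtain ⟨B1, h1⟩ := hF.2 1
  simp only [norm_iteratedFDeriv_zero] at h0
  simp only [norm_iteratedFDeriv_one] at h1
  exact ⟨max B0 B1, ((norm_nonneg _).trans (h0 0)).trans (le_max_left _ _),
    fun x => (h0 x).trans (le_max_left _ _), fun x => (h1 x).trans (le_max_right _ _)⟩

lemma IsCbSmooth.continuous {m : ℕ} {F : (Fin m → ℝ) → ℝ} (hF : IsCbSmooth F) : Continuous F :=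
  hF.1.continuous

lemma IsCbSmooth.continuous_fderiv {m : ℕ} {F : (Fin m → ℝ) → ℝ} (hF : IsCbSmooth F) :
    Continuous (fderiv ℝ F) := hF.1.continuous_fderiv (by simp)

lemma IsCbSmooth.abs_partial_le {m : ℕ} {F : (Fin m → ℝ) → ℝ} {B : ℝ}
    (h : ∀ x, ‖fderiv ℝ F x‖ ≤ B) (x : Fin m → ℝ) (i : Fin m) :
    |fderiv ℝ F x (Pi.single i 1)| ≤ B := by
  refine ((fderiv ℝ F x).le_opNorm _).trans ?_
  rw [Pi.norm_single, norm_one, mul_one]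
  exact h x

/-- If E[V²] = 0 then V = 0 almost surely and both sides vanish; the regression coefficient can
therefore be used without a nondegeneracy assumption. -/
lemma integral_mul_eq_regression {W V : Ω → ℝ} (hV : MemLp V 2 P) :
    ∫ ω, W ω * V ω ∂P = (∫ ω, V ω ^ 2 ∂P) * ((∫ ω, W ω * V ω ∂P) / ∫ ω, V ω ^ 2 ∂P) := by
  by_cases h : ∫ ω, V ω ^ 2 ∂P = 0
  · rw [h, zero_mul]
    rw [integral_eq_zero_iff_of_nonneg (fun ω => sq_nonneg _) hV.integrable_sq] at h
    refine integral_eq_zero_of_ae ?_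
    filter_upwards [h] with ω hω
    have : V ω = 0 := by simpa using hω
    simp [this]
  · rw [mul_div_cancel₀ _ h]

namespace KernelGaussian
variable {g : ℝ → Ω → ℝ} {K : ℝ → ℝ → ℝ} {β C C' : ℝ} (M : KernelGaussian P g K β C C')
include M

lemma memLp_of_span {Y : Ω → ℝ} (h : Y ∈ Submodule.span ℝ (range g)) {p : ENNReal} (hp : p ≠ ⊤) :
    MemLp Y p P := (M.hasGaussianLaw_of_span h).memLp hp

/-- The residuals of the regression on V are uncorrelated with V, and jointly Gaussian with it,
hence independent of it. -/
lemma indepFun_regression {ι : Type*} {W : ι → Ω → ℝ} {V : Ω → ℝ}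
    (hW : ∀ i, W i ∈ Submodule.span ℝ (range g)) (hV : V ∈ Submodule.span ℝ (range g)) :
    IndepFun (fun ω i => W i ω - ((∫ ω, W i ω * V ω ∂P) / ∫ ω, V ω ^ 2 ∂P) * V ω) V P := by
  set c : ι → ℝ := fun i => (∫ ω, W i ω * V ω ∂P) / ∫ ω, V ω ^ 2 ∂P with hc
  set W' : ι → Ω → ℝ := fun i ω => W i ω - c i * V ω with hW'
  have hmem : ∀ i, W' i ∈ Submodule.span ℝ (range g) := fun i =>
    Submodule.sub_mem _ (hW i) (Submodule.smul_mem _ (c i) hV)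
  have hgp : IsGaussianProcess (Sum.elim W' fun _ : Unit => V) P :=
    M.isGaussianProcess_of_span (by rintro (i | i); exacts [hmem i, hV])
  have hV2 := M.memLp_of_span hV (p := 2) (by simp)
  have := hgp.indepFun_of_covariance_eq_zero (fun i => (M.measurable_of_span (hmem i)).aemeasurable)
    (fun _ => (M.measurable_of_span hV).aemeasurable) (fun i _ => ?_)
  · exact this.comp (φ := id) (ψ := fun y : Unit → ℝ => y ()) measurable_id (measurable_pi_apply _)
  · have hi2 := M.memLp_of_span (hW i) (p := 2) (by simp)
    rw [covariance_eq_sub (M.memLp_of_span (hmem i) (by simp)) hV2, M.centered_of_span hV, mul_zero,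
      sub_zero]
    have e : ∀ ω, (W' i * V) ω = W i ω * V ω - c i * V ω ^ 2 := fun ω => by
      simp only [Pi.mul_apply, hW']; ring
    simp only [e]
    have hi : Integrable (fun ω => W i ω * V ω) P := hi2.integrable_mul hV2
    rw [integral_sub hi (hV2.integrable_sq.const_mul _), integral_const_mul,
      integral_mul_eq_regression hV2]
    ring

/-- Gaussian integration by parts. -/
theorem integral_smooth_mul_mul {m : ℕ} {F : (Fin m → ℝ) → ℝ} (hF : IsCbSmooth F)
    {W : Fin m → Ω → ℝ} (hW : ∀ i, W i ∈ Submodule.span ℝ (range g)) {U V : Ω → ℝ} (a : ℝ)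
    (hU : U ∈ Submodule.span ℝ (range g)) (hV : V ∈ Submodule.span ℝ (range g)) :
    ∫ ω, F (fun i => W i ω) * ((a + U ω) * V ω) ∂P =
      (∑ i, (∫ ω, fderiv ℝ F (fun i => W i ω) (Pi.single i 1) * (a + U ω) ∂P) *
        ∫ ω, W i ω * V ω ∂P) +
      (∫ ω, F (fun i => W i ω) ∂P) * ∫ ω, (a + U ω) * V ω ∂P := by
  obtain ⟨B, hB, hb, hb'⟩ := hF.exists_bound
  set v := ∫ ω, V ω ^ 2 ∂P with hv
  have hv0 : 0 ≤ v := integral_nonneg fun ω => sq_nonneg _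
  -- The index `none` carries U and `some i` carries W_i, so that all of them are regressed on V at
  -- once.
  set X : Option (Fin m) → Ω → ℝ := fun o => o.elim U W with hX
  have hXmem : ∀ o, X o ∈ Submodule.span ℝ (range g) := by rintro (_ | i); exacts [hU, hW i]
  set c : Option (Fin m) → ℝ := fun o => (∫ ω, X o ω * V ω ∂P) / v with hc
  have hV2 := M.memLp_of_span hV (p := 2) (by simp)
  have hU2 := M.memLp_of_span hU (p := 2) (by simp)
  have hcv : ∀ o, ∫ ω, X o ω * V ω ∂P = v * c o := fun o =>
    integral_mul_eq_regression hV2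
  have hmV := M.measurable_of_span hV
  have hmW : ∀ i, Measurable (W i) := fun i => M.measurable_of_span (hW i)
  have hmWp : Measurable fun ω => fun i => W i ω := measurable_pi_lambda _ hmW
  set Y : Ω → Option (Fin m) → ℝ := fun ω o => X o ω - c o * V ω with hY
  have hYm : Measurable Y := measurable_pi_lambda _ fun o =>
    (M.measurable_of_span (hXmem o)).sub (hmV.const_mul _)
  have hind : IndepFun Y V P := M.indepFun_regression hXmem hV
  have hlaw := (M.hasGaussianLaw_of_span hV).map_eq_of_centered (M.centered_of_span hV)
  set c' : Fin m → ℝ := fun i => c (some i) with hc'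
  -- H(y, x) rebuilds the factor F(W)(a+U) from the residuals y and the value x of V; Stein's
  -- identity in x, with y frozen, is then available by independence.
  set H : (Option (Fin m) → ℝ) → ℝ → ℝ := fun y x =>
    F (fun i => y (some i) + c (some i) * x) * (a + y none + c none * x) with hH
  set H' : (Option (Fin m) → ℝ) → ℝ → ℝ := fun y x =>
    fderiv ℝ F (fun i => y (some i) + c (some i) * x) c' * (a + y none + c none * x) +
    F (fun i => y (some i) + c (some i) * x) * c none with hH'
  have hFc := hF.continuous
  have hF'c := hF.continuous_fderiv
  have hHc : Continuous (Function.uncurry H) := by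
    simp only [Function.uncurry_def, hH]; fun_prop
  have hHc' : Continuous (Function.uncurry H') := by
    simp only [Function.uncurry_def, hH']
    have : Continuous fun p : (Option (Fin m) → ℝ) × ℝ =>
        fderiv ℝ F (fun i => p.1 (some i) + c (some i) * p.2) c' :=
      (hF'c.comp (by fun_prop)).clm_apply continuous_const
    fun_prop
  have hYs : ∀ ω i, Y ω (some i) + c (some i) * V ω = W i ω := fun ω i => by simp [hY, hX]
  have hYn : ∀ ω, a + Y ω none + c none * V ω = a + U ω := fun ω => by simp [hY, hX, add_assoc]
  have eH : ∀ ω, H (Y ω) (V ω) = F (fun i => W i ω) * (a + U ω) := fun ω => by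
    simp only [hH, hYs, hYn]
  have eH' : ∀ ω, H' (Y ω) (V ω) = fderiv ℝ F (fun i => W i ω) c' * (a + U ω) +
      F (fun i => W i ω) * c none := fun ω => by
    simp only [hH', hYs, hYn]
  have hd : ∀ y x, HasDerivAt (H y) (H' y x) x := fun y x => by
    have h1 : HasDerivAt (fun x => fun i => y (some i) + c (some i) * x) c' x := by
      rw [hasDerivAt_pi]
      intro i
      exact (((hasDerivAt_id x).const_mul (c (some i))).const_add _).congr_deriv (by simp [hc'])
    have h2 : HasDerivAt (fun x => a + y none + c none * x) (c none) x :=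
      (((hasDerivAt_id x).const_mul (c none)).const_add _).congr_deriv (by simp)
    have h3 := (hF.1.differentiable (by simp)
      (fun i => y (some i) + c (some i) * x)).hasFDerivAt.comp_hasDerivAt x h1
    exact h3.mul h2
  have haU2 : MemLp (fun ω => a + U ω) 2 P := (memLp_const a).add hU2
  have iU : Integrable (fun ω => a + U ω) P := haU2.integrable (by norm_num)
  have mF : AEStronglyMeasurable (fun ω => F (fun i => W i ω)) P :=
    (hFc.measurable.comp hmWp).aestronglyMeasurable
  have mF' : ∀ w : Fin m → ℝ, AEStronglyMeasurable (fun ω => fderiv ℝ F (fun i => W i ω) w) P :=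
    fun w => ((hF'c.clm_apply continuous_const).measurable.comp hmWp).aestronglyMeasurable
  have iF' : ∀ w : Fin m → ℝ, Integrable (fun ω => fderiv ℝ F (fun i => W i ω) w * (a + U ω)) P :=
    fun w => iU.bdd_mul (c := B * ‖w‖) (mF' w)
      (ae_of_all _ fun ω => ((fderiv ℝ F _).le_opNorm w).trans (by gcongr; exact hb' _))
  have iF : Integrable (fun ω => F (fun i => W i ω)) P :=
    (integrable_const (1 : ℝ)).bdd_mul (c := B) mF (ae_of_all _ fun ω => hb _) |>.congr
      (ae_of_all _ fun ω => by simp)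
  have key := stein_of_indepFun hYm hmV hind hlaw hHc.measurable hHc'.measurable hd ?_ ?_ ?_
  · simp only [eH, eH'] at key
    rw [Real.coe_toNNReal _ hv0, integral_add (iF' c') (iF.mul_const _), integral_mul_const] at key
    have e1 : ∫ ω, F (fun i => W i ω) * ((a + U ω) * V ω) ∂P =
        ∫ ω, V ω * (F (fun i => W i ω) * (a + U ω)) ∂P := by congr 1; ext ω; ring
    have e2 : ∫ ω, (a + U ω) * V ω ∂P = v * c none := by
      rw [← hcv none]
      have hi : Integrable (fun ω => U ω * V ω) P := hU2.integrable_mul hV2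
      simp only [add_mul, hX, Option.elim]
      rw [integral_add ((hV2.integrable (by norm_num)).const_mul a) hi,
        integral_const_mul, M.centered_of_span hV, mul_zero, zero_add]
    have e3 : ∀ ω, fderiv ℝ F (fun i => W i ω) c' * (a + U ω) =
        ∑ i, c' i * (fderiv ℝ F (fun i => W i ω) (Pi.single i 1) * (a + U ω)) := fun ω => by
      rw [← (fderiv ℝ F fun i => W i ω).coe_coe, LinearMap.pi_apply_eq_sum_univ, Finset.sum_mul]
      refine Finset.sum_congr rfl fun i _ => ?_
      have : (fun j => if i = j then (1 : ℝ) else 0) = Pi.single i 1 := by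
        ext j; simp [Pi.single_apply, eq_comm]
      rw [smul_eq_mul, mul_assoc, this, ContinuousLinearMap.coe_coe]
    rw [e1, e2, key]
    simp only [e3]
    rw [integral_finsetSum _ fun i _ => (iF' _).const_mul _, mul_add, Finset.mul_sum]
    congr 1
    · refine Finset.sum_congr rfl fun i _ => ?_
      have := hcv (some i)
      simp only [hX, Option.elim] at this
      rw [this, integral_const_mul]
      ring
    · ring
  · simp only [eH]
    have : Integrable (fun ω => F (fun i => W i ω) * ((a + U ω) * V ω)) P :=
      (haU2.integrable_mul hV2).bdd_mul (c := B) mF (ae_of_all _ fun ω => hb _)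
    exact this.congr (ae_of_all _ fun ω => by simp only; ring)
  · simp only [eH']
    exact (iF' c').add (iF.mul_const _)
  · simp only [eH]
    exact iU.bdd_mul (c := B) mF (ae_of_all _ fun ω => hb _)

/-- Gaussian integration by parts with a factor from the Ornstein-Uhlenbeck process. -/
theorem integral_smooth_mul_ou_mul {k : ℝ} (hk : 0 < k) {m : ℕ} {F : (Fin m → ℝ) → ℝ}
    (hF : IsCbSmooth F) {W : Fin m → Ω → ℝ} (hW : ∀ i, W i ∈ Submodule.span ℝ (range g)) (a : ℝ)
    {s : ℝ} (hs : 0 ≤ s) {V : Ω → ℝ} (hV : V ∈ Submodule.span ℝ (range g)) :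
    ∫ ω, F (fun i => W i ω) * ((a + ou k (fun r => g r ω) s) * V ω) ∂P =
      (∑ i, (∫ ω, fderiv ℝ F (fun i => W i ω) (Pi.single i 1) * (a + ou k (fun r => g r ω) s) ∂P) *
        ∫ ω, W i ω * V ω ∂P) +
      (∫ ω, F (fun i => W i ω) ∂P) * ∫ ω, (a + ou k (fun r => g r ω) s) * V ω ∂P := by
  obtain ⟨B, hB, hb, hb'⟩ := hF.exists_bound
  obtain ⟨Y, hY, hY1, h⟩ := M.exists_dominating_ou hk s
  have hY2 : MemLp Y 2 P := hY.mono_exponent (by norm_num)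
  have hV2 := M.memLp_of_span hV (p := 2) (by simp)
  have hmV := M.measurable_of_span hV
  have hmWp : Measurable fun ω => fun i => W i ω :=
    measurable_pi_lambda _ fun i => M.measurable_of_span (hW i)
  have mF : Measurable (fun ω => F (fun i => W i ω)) := hF.continuous.measurable.comp hmWp
  have mF' : ∀ w : Fin m → ℝ, Measurable (fun ω => fderiv ℝ F (fun i => W i ω) w) :=
    fun w => (hF.continuous_fderiv.clm_apply continuous_const).measurable.comp hmWp
  have hdom : MemLp (fun ω => |a| + Y ω) 2 P := (memLp_const |a|).add hY2
  have hbd : ∀ᵐ ω ∂P, ∀ n, |a + ouSum k (fun r => g r ω) s n| ≤ |a| + Y ω := by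
    filter_upwards [h] with ω hω n
    have := (hω s ⟨hs, le_rfl⟩).2.2 n
    have h2 := abs_add_le a (ouSum k (fun r => g r ω) s n)
    linarith
  have hl : ∀ ω, Tendsto (fun n => a + ouSum k (fun r => g r ω) s n) atTop
      (𝓝 (a + ou k (fun r => g r ω) s)) := fun ω =>
    tendsto_const_nhds.add (tendsto_ouSum k (M.cont ω) (M.zero ω) hs)
  have lim : ∀ D : Ω → ℝ, Measurable D → Integrable (fun ω => (|a| + Y ω) * |D ω|) P →
      Tendsto (fun n => ∫ ω, (a + ouSum k (fun r => g r ω) s n) * D ω ∂P) atTop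
        (𝓝 (∫ ω, (a + ou k (fun r => g r ω) s) * D ω ∂P)) := fun D hD hi => by
    refine tendsto_integral_of_dominated_convergence _ (fun n => ?_) hi (fun n => ?_)
      (ae_of_all _ fun ω => (hl ω).mul_const _)
    · exact (((M.measurable_of_span (M.ouSum_mem_span k s n)).const_add a).mul hD).aestronglyMeasurable
    · filter_upwards [hbd] with ω hω
      rw [norm_mul]
      exact mul_le_mul_of_nonneg_right (hω n) (norm_nonneg _)
  have iV : Integrable (fun ω => (|a| + Y ω) * |V ω|) P := hdom.integrable_mul hV2.norm
  have l1 := lim (fun ω => F (fun i => W i ω) * V ω) (mF.mul hmV) (by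
    have := iV.bdd_mul (c := B) mF.norm.aestronglyMeasurable (ae_of_all _ fun ω => by
      rw [norm_norm]; exact hb _)
    refine this.congr (ae_of_all _ fun ω => ?_)
    simp only [abs_mul, Real.norm_eq_abs]; ring)
  have l2 := fun i => lim (fun ω => fderiv ℝ F (fun i => W i ω) (Pi.single i 1)) (mF' _) (by
    have := (hdom.integrable (by norm_num)).bdd_mul (c := B) (mF' (Pi.single i 1)).norm.aestronglyMeasurable
      (ae_of_all _ fun ω => by rw [norm_norm]; exact IsCbSmooth.abs_partial_le hb' _ _)
    refine this.congr (ae_of_all _ fun ω => ?_)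
    simp only [Real.norm_eq_abs]; ring)
  have l3 := lim V hmV iV
  have l4 := (tendsto_finsetSum Finset.univ fun i _ =>
    (l2 i).mul_const (∫ ω, W i ω * V ω ∂P)).add (l3.const_mul (∫ ω, F (fun i => W i ω) ∂P))
  have c1 : ∀ x : Ω → ℝ, ∫ ω, F (fun i => W i ω) * (x ω * V ω) ∂P =
      ∫ ω, x ω * (F (fun i => W i ω) * V ω) ∂P := fun x => by congr 1; ext ω; ring
  have c2 : ∀ (x : Ω → ℝ) i, ∫ ω, fderiv ℝ F (fun i => W i ω) (Pi.single i 1) * x ω ∂P =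
      ∫ ω, x ω * fderiv ℝ F (fun i => W i ω) (Pi.single i 1) ∂P := fun x i => by
    congr 1; ext ω; ring
  -- The formula holds for the Riemann sums, which lie in the span of g; every term passes to the
  -- limit by domination.
  have key := fun n => M.integral_smooth_mul_mul hF hW a (M.ouSum_mem_span k s n) hV
  simp only [c1 fun ω => a + _, c2 fun ω => a + _] at key ⊢
  refine tendsto_nhds_unique l1 ?_
  simp only [key]
  exact l4

end KernelGaussian
end Stein

/-! ### Pathwise Riemann sums of ∫ X dg -/

section Path

/-- The solution of the Vasicek equation driven by the path `a`, started at zero. -/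
noncomputable def vasicekPath (k μ : ℝ) (a : ℝ → ℝ) (t : ℝ) : ℝ := meanPath k μ t + ou k a t

/-- The pathwise part of the Skorohod integral of the Vasicek process. -/
noncomputable def pathIntegral (k μ : ℝ) (x : ℝ → ℝ) (T : ℝ) : ℝ :=
  x T ^ 2 / 2 - ∫ t in 0..T, x t * (k * (μ - x t))

lemma continuous_vasicekPath (k μ : ℝ) {a : ℝ → ℝ} (ha : Continuous a) :
    Continuous (vasicekPath k μ a) := (continuous_meanPath k μ).add (continuous_ou k ha)

lemma abs_meanPath_le {k : ℝ} (hk : 0 < k) (μ : ℝ) {t : ℝ} (ht : 0 ≤ t) : |meanPath k μ t| ≤ |μ| := by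
  rw [meanPath, abs_mul]
  have h1 : Real.exp (-(k * t)) ≤ 1 := Real.exp_le_one_iff.2 (by nlinarith)
  have h2 := Real.exp_pos (-(k * t))
  have : |1 - Real.exp (-(k * t))| ≤ 1 := abs_le.2 ⟨by linarith, by linarith⟩
  nlinarith [abs_nonneg μ]

lemma meanPath_eq {k : ℝ} (hk : 0 < k) (μ t : ℝ) :
    meanPath k μ t = ∫ s in 0..t, k * (μ - meanPath k μ s) := by
  have e : ∀ s, k * (μ - meanPath k μ s) = k * μ * Real.exp (-k * s) := fun s => by
    rw [meanPath, ← neg_mul]; ring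
  simp only [e]
  rw [intervalIntegral.integral_const_mul, integral_exp_mul (-k) (by linarith), meanPath, neg_mul]
  field_simp
  ring

lemma vasicekPath_eq {k : ℝ} (hk : 0 < k) (μ : ℝ) {a : ℝ → ℝ} (ha : Continuous a) (t : ℝ) :
    vasicekPath k μ a t = (∫ s in 0..t, k * (μ - vasicekPath k μ a s)) + a t := by
  have h1 := meanPath_eq hk μ t
  have h2 := ou_eq_sub_integral (k := k) ha t
  have i1 : IntervalIntegrable (fun s => k * (μ - meanPath k μ s)) volume 0 t :=
    ((continuous_const.sub (continuous_meanPath k μ)).const_mul k).intervalIntegrable _ _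
  have i2 : IntervalIntegrable (fun s => k * ou k a s) volume 0 t :=
    ((continuous_ou k ha).const_mul k).intervalIntegrable _ _
  have e : ∀ s, k * (μ - vasicekPath k μ a s) = k * (μ - meanPath k μ s) - k * ou k a s := fun s => by
    rw [vasicekPath]; ring
  simp only [e]
  rw [intervalIntegral.integral_sub i1 i2, ← h1, intervalIntegral.integral_const_mul, vasicekPath]
  linarith

lemma vasicekPath_zero (k μ : ℝ) {a : ℝ → ℝ} (ha0 : a 0 = 0) : vasicekPath k μ a 0 = 0 := by
  simp [vasicekPath, meanPath, ou, ha0]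

lemma sum_mul_sub (x : ℕ → ℝ) (n : ℕ) :
    ∑ i ∈ Finset.range n, x i * (x (i + 1) - x i) + 1 / 2 * ∑ i ∈ Finset.range n, (x (i + 1) - x i) ^ 2 =
      (x n ^ 2 - x 0 ^ 2) / 2 := by
  induction n with
  | zero => simp
  | succ n ih => rw [Finset.sum_range_succ, Finset.sum_range_succ]; linarith

variable {k μ T : ℝ} {a : ℝ → ℝ}

lemma vasicekPath_sub (hk : 0 < k) (ha : Continuous a) (s t : ℝ) :
    vasicekPath k μ a t - vasicekPath k μ a s =
      (∫ r in s..t, k * (μ - vasicekPath k μ a r)) + (a t - a s) := by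
  have hc : Continuous fun r => k * (μ - vasicekPath k μ a r) :=
    (continuous_const.sub (continuous_vasicekPath k μ ha)).const_mul k
  rw [vasicekPath_eq hk μ ha t, vasicekPath_eq hk μ ha s, ← intervalIntegral.integral_interval_sub_left
    (hc.intervalIntegrable 0 t) (hc.intervalIntegrable 0 s)]
  ring

/-- Adding half the quadratic variation turns the left sum of X dX into X_T²/2 exactly, so only the
Riemann sum of the drift remains. Its convergence needs no regularity of a beyond continuity; the
quadratic term is removed separately, in mean. -/
lemma ito_sum_eq (hk : 0 < k) (ha : Continuous a) (ha0 : a 0 = 0) {n : ℕ} (hn : 0 < n) :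
    ∑ i ∈ Finset.range n, vasicekPath k μ a (i * T / n) * (a ((i + 1) * T / n) - a (i * T / n)) +
      1 / 2 * ∑ i ∈ Finset.range n,
        (vasicekPath k μ a ((i + 1) * T / n) - vasicekPath k μ a (i * T / n)) ^ 2 =
    vasicekPath k μ a T ^ 2 / 2 - ∑ i ∈ Finset.range n, vasicekPath k μ a (i * T / n) *
      ∫ r in (i * T / n)..((i + 1) * T / n), k * (μ - vasicekPath k μ a r) := by
  have h := sum_mul_sub (fun i : ℕ => vasicekPath k μ a (i * T / n)) n
  have hn' : (n : ℝ) ≠ 0 := by positivity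
  simp only [Nat.cast_add, Nat.cast_one, Nat.cast_zero, zero_mul, zero_div, vasicekPath_zero k μ ha0,
    mul_div_cancel_left₀ T hn'] at h
  have e : ∀ i : ℕ, vasicekPath k μ a (i * T / n) * (a ((i + 1) * T / n) - a (i * T / n)) =
      vasicekPath k μ a (i * T / n) *
        (vasicekPath k μ a ((i + 1) * T / n) - vasicekPath k μ a (i * T / n)) -
      vasicekPath k μ a (i * T / n) *
        ∫ r in (i * T / n)..((i + 1) * T / n), k * (μ - vasicekPath k μ a r) := fun i => by
    rw [vasicekPath_sub hk ha]; ring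
  simp only [e, Finset.sum_sub_distrib]
  linarith

lemma tendsto_ito_sum (hk : 0 < k) (ha : Continuous a) (ha0 : a 0 = 0) (hT : 0 ≤ T) :
    Tendsto (fun n : ℕ => ∑ i ∈ Finset.range n, vasicekPath k μ a (i * T / n) *
        (a ((i + 1) * T / n) - a (i * T / n)) + 1 / 2 * ∑ i ∈ Finset.range n,
        (vasicekPath k μ a ((i + 1) * T / n) - vasicekPath k μ a (i * T / n)) ^ 2) atTop
      (𝓝 (pathIntegral k μ (vasicekPath k μ a) T)) := by
  have hx := continuous_vasicekPath k μ ha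
  have hc : Continuous fun r => k * (μ - vasicekPath k μ a r) := (continuous_const.sub hx).const_mul k
  have h := tendsto_riemann (θ := 0) (by simp) hT hx
    (hc.integrableOn_Icc (a := 0) (b := T) |>.mono_set Ioc_subset_Icc_self)
  simp only [add_zero] at h
  refine (tendsto_const_nhds.sub h).congr' ?_
  filter_upwards [eventually_gt_atTop 0] with n hn
  rw [ito_sum_eq hk ha ha0 hn]

lemma abs_drift_integral_le (hk : 0 < k) {D : ℝ} (hD : ∀ t ∈ Icc 0 T, |vasicekPath k μ a t| ≤ D)
    {s t : ℝ} (hs : 0 ≤ s) (hst : s ≤ t) (ht : t ≤ T) :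
    |∫ r in s..t, k * (μ - vasicekPath k μ a r)| ≤ k * (|μ| + D) * (t - s) := by
  rw [← Real.norm_eq_abs, ← abs_of_nonneg (sub_nonneg.2 hst)]
  refine intervalIntegral.norm_integral_le_of_norm_le_const fun r hr => ?_
  rw [uIoc_of_le hst] at hr
  rw [norm_mul, Real.norm_of_nonneg hk.le]
  refine mul_le_mul_of_nonneg_left ((abs_sub _ _).trans ?_) hk.le
  linarith [hD r ⟨hs.trans hr.1.le, hr.2.trans ht⟩]

/-- The bound is uniform in n and quadratic in D, so a dominating variable D with fourth moment
gives a square integrable majorant. -/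
lemma abs_ito_sum_le (hk : 0 < k) (ha : Continuous a) (ha0 : a 0 = 0) (hT : 0 ≤ T) {D : ℝ}
    (hD : ∀ t ∈ Icc 0 T, |vasicekPath k μ a t| ≤ D) {n : ℕ} (hn : 0 < n) :
    |∑ i ∈ Finset.range n, vasicekPath k μ a (i * T / n) *
        (a ((i + 1) * T / n) - a (i * T / n)) + 1 / 2 * ∑ i ∈ Finset.range n,
        (vasicekPath k μ a ((i + 1) * T / n) - vasicekPath k μ a (i * T / n)) ^ 2| ≤
      D ^ 2 / 2 + D * (k * (|μ| + D) * T) := by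
  rw [ito_sum_eq hk ha ha0 hn]
  have hn' : (0 : ℝ) < n := by exact_mod_cast hn
  have h0 := hD T ⟨hT, le_rfl⟩
  have hD0 : 0 ≤ D := (abs_nonneg _).trans h0
  refine (abs_sub _ _).trans (add_le_add ?_ ?_)
  · rw [abs_of_nonneg (by positivity), ← sq_abs]
    gcongr
  · refine (Finset.abs_sum_le_sum_abs _ _).trans ?_
    have : ∀ i ∈ Finset.range n, |vasicekPath k μ a (i * T / n) *
      ∫ r in (i * T / n)..((i + 1) * T / n), k * (μ - vasicekPath k μ a r)| ≤
        D * (k * (|μ| + D) * T) / n := fun i hi => by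
      have hi' := Finset.mem_range.1 hi
      rw [abs_mul]
      have h1 := hD _ (grid_mem_Icc hT hi'.le)
      have h3 := (grid_mem_Icc hT (Nat.succ_le_of_lt hi')).2
      push_cast at h3
      have h2 := abs_drift_integral_le hk hD (grid_nonneg hT n i) (grid_le hT n i) h3
      have e : ((i : ℝ) + 1) * T / n - i * T / n = T / n := by ring
      rw [e] at h2
      calc _ ≤ D * (k * (|μ| + D) * (T / n)) := mul_le_mul h1 h2 (abs_nonneg _) hD0
        _ = _ := by ring
    refine (Finset.sum_le_sum this).trans (le_of_eq ?_)
    rw [Finset.sum_const, Finset.card_range, nsmul_eq_mul]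
    field_simp

lemma sq_increment_le (hk : 0 < k) (ha : Continuous a) (hT : 0 ≤ T) {D : ℝ}
    (hD : ∀ t ∈ Icc 0 T, |vasicekPath k μ a t| ≤ D) {n i : ℕ} (hi : i < n) :
    (vasicekPath k μ a ((i + 1) * T / n) - vasicekPath k μ a (i * T / n)) ^ 2 ≤
      2 * (a ((i + 1) * T / n) - a (i * T / n)) ^ 2 + 2 * ((k * (|μ| + D)) ^ 2 * (T / n) ^ 2) := by
  have h3 := (grid_mem_Icc hT (Nat.succ_le_of_lt hi)).2
  push_cast at h3
  have h2 := abs_drift_integral_le hk hD (grid_nonneg hT n i) (grid_le hT n i) h3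
  have e : ((i : ℝ) + 1) * T / n - i * T / n = T / n := by ring
  rw [e] at h2
  have h4 := pow_le_pow_left₀ (abs_nonneg _) h2 2
  rw [sq_abs, mul_pow] at h4
  rw [vasicekPath_sub hk ha]
  refine (add_sq_le).trans ?_
  linarith

end Path

/-! ### Vanishing quadratic variation -/

section Quadratic
variable {Ω : Type*} [MeasurableSpace Ω] {P : Measure Ω} [IsProbabilityMeasure P]

namespace KernelGaussian
variable {g : ℝ → Ω → ℝ} {K : ℝ → ℝ → ℝ} {β C C' : ℝ} (M : KernelGaussian P g K β C C')
include M

lemma measurable_vasicekPath (k μ : ℝ) {t : ℝ} (ht : 0 ≤ t) :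
    Measurable fun ω => vasicekPath k μ (fun s => g s ω) t := (M.measurable_ou k ht).const_add _

lemma exists_dominating_vasicekPath {k : ℝ} (hk : 0 < k) (μ T : ℝ) : ∃ D : Ω → ℝ, MemLp D 4 P ∧
    (∀ ω, 1 ≤ D ω) ∧
    ∀ᵐ ω ∂P, ∀ t ∈ Icc 0 T, |vasicekPath k μ (fun s => g s ω) t| ≤ D ω := by
  obtain ⟨Y, hY, hY1, h⟩ := M.exists_dominating_ou hk T
  refine ⟨fun ω => |μ| + Y ω, (memLp_const |μ|).add hY, fun ω => by
    linarith [hY1 ω, abs_nonneg μ], ?_⟩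
  filter_upwards [h] with ω hω t ht
  exact (abs_add_le _ _).trans (add_le_add (abs_meanPath_le hk μ ht.1) (hω t ht).2.1)

lemma memLp_vasicekPath {k : ℝ} (hk : 0 < k) (μ : ℝ) {t : ℝ} (ht : 0 ≤ t) :
    MemLp (fun ω => vasicekPath k μ (fun s => g s ω) t) 4 P :=
  (memLp_const (meanPath k μ t)).add (M.memLp_ou hk ht)

lemma integrable_sq_vasicekPath_sub {k : ℝ} (hk : 0 < k) (μ : ℝ) {s t : ℝ} (hs : 0 ≤ s) (ht : 0 ≤ t) :
    Integrable (fun ω => (vasicekPath k μ (fun s => g s ω) t -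
      vasicekPath k μ (fun s => g s ω) s) ^ 2) P :=
  MemLp.integrable_sq (((M.memLp_vasicekPath hk μ ht).sub
    (M.memLp_vasicekPath hk μ hs)).mono_exponent (by norm_num))

/-- The quadratic variation of the Vasicek process vanishes. -/
lemma tendsto_integral_quadratic {k : ℝ} (hk : 0 < k) (μ : ℝ) {T : ℝ} (hT : 0 ≤ T) :
    Tendsto (fun n : ℕ => ∫ ω, ∑ i ∈ Finset.range n,
        (vasicekPath k μ (fun s => g s ω) ((i + 1) * T / n) -
          vasicekPath k μ (fun s => g s ω) (i * T / n)) ^ 2 ∂P) atTop (𝓝 0) := by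
  obtain ⟨D, hD, hD1, h⟩ := M.exists_dominating_vasicekPath hk μ T
  obtain ⟨c, hc, hcg⟩ := M.exists_second_moment_le
  have hD2 : MemLp (fun ω => k * (|μ| + D ω)) 2 P :=
    (((memLp_const |μ|).add hD).mono_exponent (by norm_num)).const_mul k
  set E := ∫ ω, (k * (|μ| + D ω)) ^ 2 ∂P with hE
  have hE0 : 0 ≤ E := integral_nonneg fun ω => sq_nonneg _
  -- There are n increments with second moment of order (T/n)^{2β}; the sum is of order n^{1-2β},
  -- null because β > 1/2, and the drift adds a term of order 1/n.
  have hlim : Tendsto (fun n : ℕ => 2 * c * T ^ (2 * β) * (n : ℝ) ^ (-(2 * β - 1)) +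
      2 * E * T ^ 2 * (n : ℝ)⁻¹) atTop (𝓝 0) := by
    have h1 := (tendsto_rpow_neg_atTop (y := 2 * β - 1) (by linarith [M.half_lt])).comp
      tendsto_natCast_atTop_atTop
    have h2 := tendsto_inv_atTop_nhds_zero_nat (𝕜 := ℝ)
    simpa using (h1.const_mul (2 * c * T ^ (2 * β))).add (h2.const_mul (2 * E * T ^ 2))
  refine squeeze_zero' (Eventually.of_forall fun n => integral_nonneg fun ω =>
    Finset.sum_nonneg fun i _ => sq_nonneg _) ?_ hlim
  filter_upwards [eventually_gt_atTop 0] with n hn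
  have hn' : (0 : ℝ) < n := by exact_mod_cast hn
  rw [integral_finsetSum _ fun i _ => M.integrable_sq_vasicekPath_sub hk μ (grid_nonneg hT n i)
    ((grid_nonneg hT n i).trans (grid_le hT n i))]
  have hb : ∀ i ∈ Finset.range n, ∫ ω, (vasicekPath k μ (fun s => g s ω) ((i + 1) * T / n) -
          vasicekPath k μ (fun s => g s ω) (i * T / n)) ^ 2 ∂P ≤
      2 * (c * (T / n) ^ (2 * β)) + 2 * (E * (T / n) ^ 2) := fun i hi => by
    have i1 := (M.memLp_sub (i * T / n) ((i + 1) * T / n) (p := 2) (by simp)).integrable_sq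
    have i2 := hD2.integrable_sq.mul_const ((T / n) ^ 2)
    have h1 := hcg _ _ (grid_nonneg hT n i) (grid_le hT n i)
    have e : ((i : ℝ) + 1) * T / n - i * T / n = T / n := by ring
    rw [e] at h1
    refine (integral_mono_ae (M.integrable_sq_vasicekPath_sub hk μ (grid_nonneg hT n i)
      ((grid_nonneg hT n i).trans (grid_le hT n i))) ((i1.const_mul 2).add (i2.const_mul 2)) ?_).trans ?_
    · filter_upwards [h] with ω hω
      exact sq_increment_le hk (M.cont ω) hT hω (Finset.mem_range.1 hi)
    · simp only [Pi.add_apply]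
      rw [integral_add (i1.const_mul 2) (i2.const_mul 2), integral_const_mul, integral_const_mul,
        integral_mul_const]
      linarith
  refine (Finset.sum_le_sum hb).trans (le_of_eq ?_)
  rw [Finset.sum_const, Finset.card_range, nsmul_eq_mul, Real.div_rpow hT hn'.le, neg_sub,
    Real.rpow_sub hn', Real.rpow_one]
  have : (0 : ℝ) < (n : ℝ) ^ (2 * β) := by positivity
  field_simp

end KernelGaussian
end Quadratic

/-! ### Measurability with respect to the σ-algebra of the path up to time T -/

section SubAlgebra
variable {Ω : Type*} {m m0 : MeasurableSpace Ω} {P : Measure[m0] Ω}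

/-- The sub-σ-algebra m need not contain the null sets of P, so the limit is formed from
m-measurable versions and agrees with h only almost everywhere. -/
lemma aestronglyMeasurable_sub_of_tendsto {f : ℕ → Ω → ℝ} {h : Ω → ℝ}
    (hf : ∀ n, AEStronglyMeasurable[m] (f n) P)
    (hlim : ∀ᵐ ω ∂P, Tendsto (fun n => f n ω) atTop (𝓝 (h ω))) : AEStronglyMeasurable[m] h P := by
  choose f' hf' hff' using hf
  refine ⟨fun ω => limUnder atTop fun n => f' n ω,
    @StronglyMeasurable.limUnder _ _ _ m _ _ _ _ _ _ _ hf', ?_⟩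
  filter_upwards [hlim, ae_all_iff.2 hff'] with ω h1 h2
  refine (Tendsto.limUnder_eq (h1.congr fun n => h2 n)).symm

lemma aestronglyMeasurable_sub_sum {f : ℕ → Ω → ℝ} {n : ℕ}
    (hf : ∀ i < n, AEStronglyMeasurable[m] (f i) P) :
    AEStronglyMeasurable[m] (fun ω => ∑ i ∈ Finset.range n, f i ω) P := by
  induction n with
  | zero =>
    simp only [Finset.range_zero, Finset.sum_empty]
    exact ⟨_, stronglyMeasurable_const, EventuallyEq.rfl⟩
  | succ n ih =>
    simp only [Finset.sum_range_succ]
    exact (ih fun i hi => hf i (by omega)).add (hf n (by omega))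

lemma aestronglyMeasurable_vasicekPath {g : ℝ → Ω → ℝ} (hc : ∀ ω, Continuous fun t => g t ω)
    (h0 : ∀ ω, g 0 ω = 0) (k μ : ℝ) {T : ℝ}
    (hg : ∀ s ∈ Icc 0 T, AEStronglyMeasurable[m] (g s) P) {t : ℝ} (ht : t ∈ Icc 0 T) :
    AEStronglyMeasurable[m] (fun ω => vasicekPath k μ (fun s => g s ω) t) P := by
  have h1 : AEStronglyMeasurable[m] (fun ω => ou k (fun s => g s ω) t) P := by
    refine aestronglyMeasurable_sub_of_tendsto (f := fun n ω => ouSum k (fun s => g s ω) t n)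
      (fun n => aestronglyMeasurable_sub_sum fun i hi => ?_)
      (ae_of_all _ fun ω => tendsto_ouSum k (hc ω) (h0 ω) ht.1)
    have a1 := grid_mem_Icc ht.1 (Nat.succ_le_of_lt hi)
    have a2 := grid_mem_Icc ht.1 hi.le
    push_cast at a1
    exact ((hg _ ⟨a1.1, a1.2.trans ht.2⟩).sub (hg _ ⟨a2.1, a2.2.trans ht.2⟩)).const_mul _
  have h2 : AEStronglyMeasurable[m] (fun _ : Ω => meanPath k μ t) P :=
    ⟨_, stronglyMeasurable_const, EventuallyEq.rfl⟩
  exact h2.add h1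

/-- The approximating sums of `tendsto_ito_sum` involve g only at times in [0,T]. -/
lemma aestronglyMeasurable_pathIntegral {g : ℝ → Ω → ℝ} (hc : ∀ ω, Continuous fun t => g t ω)
    (h0 : ∀ ω, g 0 ω = 0) {k : ℝ} (hk : 0 < k) (μ : ℝ) {T : ℝ}
    (hT : 0 ≤ T) (hg : ∀ s ∈ Icc 0 T, AEStronglyMeasurable[m] (g s) P) :
    AEStronglyMeasurable[m]
      (fun ω => pathIntegral k μ (vasicekPath k μ fun s => g s ω) T) P := by
  refine aestronglyMeasurable_sub_of_tendsto (fun n => ?_)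
    (ae_of_all _ fun ω => tendsto_ito_sum hk (hc ω) (h0 ω) hT)
  have hx := fun t (ht : t ∈ Icc 0 T) => aestronglyMeasurable_vasicekPath hc h0 k μ hg ht
  have h1 : ∀ i < n, ((i : ℝ) + 1) * T / n ∈ Icc 0 T := fun i hi => by
    have a1 := grid_mem_Icc hT (Nat.succ_le_of_lt hi)
    push_cast at a1
    exact a1
  refine AEStronglyMeasurable.add (aestronglyMeasurable_sub_sum fun i hi => ?_)
    (AEStronglyMeasurable.const_mul (aestronglyMeasurable_sub_sum fun i hi => ?_) _)
  · exact (hx _ (grid_mem_Icc hT hi.le)).mul ((hg _ (h1 i hi)).sub (hg _ (grid_mem_Icc hT hi.le)))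
  · exact ((hx _ (h1 i hi)).sub (hx _ (grid_mem_Icc hT hi.le))).pow 2

end SubAlgebra

/-! ### The Skorohod integral as a centered pathwise integral -/

section Existence
variable {Ω : Type*} [MeasurableSpace Ω] {P : Measure Ω} [IsProbabilityMeasure P]

namespace KernelGaussian
variable {g : ℝ → Ω → ℝ} {K : ℝ → ℝ → ℝ} {β C C' : ℝ} (M : KernelGaussian P g K β C C')
include M

lemma integrable_vasicekPath_mul_sub {k : ℝ} (hk : 0 < k) (μ : ℝ) {t : ℝ} (ht : 0 ≤ t) (a b : ℝ) :
    Integrable (fun ω => vasicekPath k μ (fun s => g s ω) t * (g b ω - g a ω)) P :=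
  ((M.memLp_vasicekPath hk μ ht).mono_exponent (q := 4) (p := 2) (by norm_num)).integrable_mul
    (M.memLp_sub a b (p := 2) (by simp))

lemma measurable_smoothRV {m : ℕ} {F : (Fin m → ℝ) → ℝ} (hF : IsCbSmooth F) (t : Fin m → ℝ) :
    Measurable (smoothRV g F t) :=
  hF.continuous.measurable.comp (measurable_pi_lambda _ fun i => M.meas (t i))

lemma measurable_partial {m : ℕ} {F : (Fin m → ℝ) → ℝ} (hF : IsCbSmooth F) (t : Fin m → ℝ)
    (w : Fin m → ℝ) : Measurable fun ω => fderiv ℝ F (fun j => g (t j) ω) w :=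
  (hF.continuous_fderiv.clm_apply continuous_const).measurable.comp
    (measurable_pi_lambda _ fun i => M.meas (t i))

/-- Duality between the Malliavin derivative and the Riemann sums of the Skorohod integral. -/
lemma integral_smooth_mul_riemann_sum {k : ℝ} (hk : 0 < k) (μ : ℝ) {T : ℝ} (hT : 0 ≤ T) {m : ℕ}
    {F : (Fin m → ℝ) → ℝ} (hF : IsCbSmooth F) {t : Fin m → ℝ} (ht : ∀ i, t i ∈ Icc 0 T) (n : ℕ) :
    (∫ ω, smoothRV g F t ω * ∑ j ∈ Finset.range n, vasicekPath k μ (fun s => g s ω) (j * T / n) *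
        (g ((j + 1) * T / n) ω - g (j * T / n) ω) ∂P) -
      (∫ ω, smoothRV g F t ω ∂P) * ∫ ω, ∑ j ∈ Finset.range n,
        vasicekPath k μ (fun s => g s ω) (j * T / n) *
        (g ((j + 1) * T / n) ω - g (j * T / n) ω) ∂P =
    ∫ ω, inner ℝ (malliavinD P g F t ω) (stepH P g T (vasicekPath k μ fun s => g s ω) n) ∂P := by
  obtain ⟨B, hB, hb, hb'⟩ := hF.exists_bound
  have mF := (M.measurable_smoothRV hF t).aestronglyMeasurable (μ := P)
  have i1 := fun j : ℕ => M.integrable_vasicekPath_mul_sub hk μ (grid_nonneg hT n j) (j * T / n)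
    ((j + 1) * T / n)
  have i2 : ∀ j : ℕ, Integrable (fun ω => smoothRV g F t ω *
      (vasicekPath k μ (fun s => g s ω) (j * T / n) * (g ((j + 1) * T / n) ω - g (j * T / n) ω))) P :=
    fun j => (i1 j).bdd_mul (c := B) mF (ae_of_all _ fun ω => hb _)
  have i3 : ∀ (i : Fin m) (j : ℕ), Integrable (fun ω =>
      fderiv ℝ F (fun l => g (t l) ω) (Pi.single i 1) *
      vasicekPath k μ (fun s => g s ω) (j * T / n)) P := fun i j =>
    ((M.memLp_vasicekPath hk μ (grid_nonneg hT n j)).integrable (by norm_num)).bdd_mul (c := B)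
      (M.measurable_partial hF t _).aestronglyMeasurable
      (ae_of_all _ fun ω => IsCbSmooth.abs_partial_le hb' _ _)
  have hin : ∀ (i : Fin m) (j : ℕ), inner ℝ (indH P g 0 (t i)) (indH P g (j * T / n) ((j + 1) * T / n)) =
      ∫ ω, g (t i) ω * (g ((j + 1) * T / n) ω - g (j * T / n) ω) ∂P := fun i j => by
    rw [M.inner_indH le_rfl (ht i).1 (grid_nonneg hT n j) (grid_le hT n j),
      ← M.cov _ _ _ _ le_rfl (ht i).1 (grid_nonneg hT n j) (grid_le hT n j)]
    simp only [M.zero, sub_zero]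
  -- In each summand the derivative falls either on F, giving a term of ⟨DF, X⟩, or on X, whose
  -- derivative is deterministic, giving E[F] times the mean of the summand. The latter is the term
  -- subtracted on the left.
  have key := fun j : ℕ => M.integral_smooth_mul_ou_mul hk hF
    (W := fun i => g (t i)) (fun i => Submodule.subset_span ⟨t i, rfl⟩)
    (meanPath k μ (j * T / n)) (grid_nonneg hT n j) (M.sub_mem_span (j * T / n) ((j + 1) * T / n))
  have e1 : ∀ ω, inner ℝ (malliavinD P g F t ω) (stepH P g T (vasicekPath k μ fun s => g s ω) n) =
      ∑ j ∈ Finset.range n, ∑ i, fderiv ℝ F (fun l => g (t l) ω) (Pi.single i 1) *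
        vasicekPath k μ (fun s => g s ω) (j * T / n) *
        ∫ ω, g (t i) ω * (g ((j + 1) * T / n) ω - g (j * T / n) ω) ∂P := fun ω => by
    rw [malliavinD, stepH, inner_sum]
    refine Finset.sum_congr rfl fun j _ => ?_
    rw [sum_inner]
    refine Finset.sum_congr rfl fun i _ => ?_
    rw [inner_smul_left, inner_smul_right, hin]
    simp only [conj_trivial]
    ring
  simp only [e1, Finset.mul_sum]
  rw [integral_finsetSum _ fun j _ => i2 j, integral_finsetSum _ fun j _ => i1 j, Finset.mul_sum,
    ← Finset.sum_sub_distrib,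
    integral_finsetSum _ fun j _ => integrable_finsetSum _ fun i _ => (i3 i j).mul_const _]
  refine Finset.sum_congr rfl fun j _ => ?_
  rw [integral_finsetSum _ fun i _ => (i3 i j).mul_const _]
  simp only [integral_mul_const]
  rw [sub_eq_iff_eq_add]
  exact key j

lemma exists_pathIntegral_bound {k : ℝ} (hk : 0 < k) (μ : ℝ) {T : ℝ} (hT : 0 ≤ T) :
    ∃ Y : Ω → ℝ, MemLp Y 2 P ∧ ∀ᵐ ω ∂P,
      (∀ n : ℕ, 0 < n → |∑ i ∈ Finset.range n, vasicekPath k μ (fun s => g s ω) (i * T / n) *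
        (g ((i + 1) * T / n) ω - g (i * T / n) ω) + 1 / 2 * ∑ i ∈ Finset.range n,
        (vasicekPath k μ (fun s => g s ω) ((i + 1) * T / n) -
          vasicekPath k μ (fun s => g s ω) (i * T / n)) ^ 2| ≤ Y ω) ∧
      |pathIntegral k μ (vasicekPath k μ fun s => g s ω) T| ≤ Y ω := by
  obtain ⟨D, hD, hD1, h⟩ := M.exists_dominating_vasicekPath hk μ T
  refine ⟨fun ω => (1 / 2 + k * T) * D ω ^ 2 + (k * T * |μ|) * D ω,
    (hD.sq_of_four.const_mul _).add ((hD.mono_exponent (by norm_num)).const_mul _), ?_⟩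
  filter_upwards [h] with ω hω
  have h1 : ∀ n : ℕ, 0 < n → |∑ i ∈ Finset.range n, vasicekPath k μ (fun s => g s ω) (i * T / n) *
        (g ((i + 1) * T / n) ω - g (i * T / n) ω) + 1 / 2 * ∑ i ∈ Finset.range n,
        (vasicekPath k μ (fun s => g s ω) ((i + 1) * T / n) -
          vasicekPath k μ (fun s => g s ω) (i * T / n)) ^ 2| ≤
      (1 / 2 + k * T) * D ω ^ 2 + (k * T * |μ|) * D ω := fun n hn => by
    refine (abs_ito_sum_le hk (M.cont ω) (M.zero ω) hT hω hn).trans (le_of_eq ?_)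
    ring
  refine ⟨h1, le_of_tendsto (tendsto_ito_sum hk (M.cont ω) (M.zero ω) hT).abs ?_⟩
  filter_upwards [eventually_gt_atTop 0] with n hn using h1 n hn

lemma memLp_pathIntegral {k : ℝ} (hk : 0 < k) (μ : ℝ) {T : ℝ} (hT : 0 ≤ T) :
    MemLp (fun ω => pathIntegral k μ (vasicekPath k μ fun s => g s ω) T) 2 P := by
  obtain ⟨Y, hY, h⟩ := M.exists_pathIntegral_bound hk μ hT
  refine hY.mono (aestronglyMeasurable_pathIntegral M.cont M.zero hk μ hT fun s _ =>
    (M.meas s).aestronglyMeasurable) ?_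
  filter_upwards [h] with ω hω
  exact hω.2.trans (le_abs_self _)

/-- The Skorohod integral of the Vasicek process. -/
theorem integral_smooth_mul_pathIntegral {k : ℝ} (hk : 0 < k) (μ : ℝ) {T : ℝ} (hT : 0 ≤ T) :
    ∃ u : Ω → Lp ℝ 2 P, MemLp u 2 P ∧
      (∀ ω, RepresentsH P g T (vasicekPath k μ fun s => g s ω) (u ω)) ∧
      ∀ (m : ℕ) (F : (Fin m → ℝ) → ℝ) (t : Fin m → ℝ), IsCbSmooth F → (∀ i, t i ∈ Icc 0 T) →
        ∫ ω, smoothRV g F t ω * (pathIntegral k μ (vasicekPath k μ fun s => g s ω) T -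
          ∫ ω, pathIntegral k μ (vasicekPath k μ fun s => g s ω) T ∂P) ∂P =
        ∫ ω, inner ℝ (malliavinD P g F t ω) (u ω) ∂P := by
  choose u hu using fun ω => M.exists_representsH hT (continuous_vasicekPath k μ (M.cont ω))
  obtain ⟨c, hc, hcb⟩ := M.exists_norm_stepH_le T hT
  obtain ⟨D, hD, hD1, h⟩ := M.exists_dominating_vasicekPath hk μ T
  obtain ⟨Y, hY, hYb⟩ := M.exists_pathIntegral_bound hk μ hT
  have hD2 : MemLp (fun ω => c * D ω) 2 P := (hD.mono_exponent (by norm_num)).const_mul c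
  have hsm : ∀ n, StronglyMeasurable fun ω => stepH P g T (vasicekPath k μ fun s => g s ω) n :=
    fun n => by
      unfold stepH
      exact Finset.stronglyMeasurable_fun_sum _ fun i _ =>
        (M.measurable_vasicekPath k μ (grid_nonneg hT n i)).stronglyMeasurable.smul_const _
  have hum : StronglyMeasurable u := stronglyMeasurable_of_tendsto atTop hsm (tendsto_pi_nhds.2 hu)
  have hsb : ∀ᵐ ω ∂P, ∀ n, ‖stepH P g T (vasicekPath k μ fun s => g s ω) n‖ ≤ c * D ω := by
    filter_upwards [h] with ω hω n
    exact hcb _ _ (by linarith [hD1 ω]) hω n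
  refine ⟨u, hD2.mono hum.aestronglyMeasurable ?_, hu, fun m F t hF ht => ?_⟩
  · filter_upwards [hsb] with ω hω
    exact (le_of_tendsto (hu ω).norm (Eventually.of_forall hω)).trans (le_abs_self _)
  obtain ⟨B, hB, hb, hb'⟩ := hF.exists_bound
  have mF := M.measurable_smoothRV hF t
  have hQ := (M.memLp_pathIntegral hk μ hT).integrable (by norm_num)
  have hY1 := hY.integrable (by norm_num)
  have mD : StronglyMeasurable (malliavinD P g F t) := by
    unfold malliavinD
    exact Finset.stronglyMeasurable_fun_sum _ fun i _ =>
      (M.measurable_partial hF t _).stronglyMeasurable.smul_const _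
  have hDb : ∀ ω, ‖malliavinD P g F t ω‖ ≤ ∑ i, B * ‖indH P g 0 (t i)‖ := fun ω => by
    refine (norm_sum_le _ _).trans (Finset.sum_le_sum fun i _ => ?_)
    rw [norm_smul]
    exact mul_le_mul_of_nonneg_right (IsCbSmooth.abs_partial_le hb' _ _) (norm_nonneg _)
  have r : Tendsto (fun n => ∫ ω, inner ℝ (malliavinD P g F t ω)
      (stepH P g T (vasicekPath k μ fun s => g s ω) n) ∂P) atTop
      (𝓝 (∫ ω, inner ℝ (malliavinD P g F t ω) (u ω) ∂P)) := by
    refine tendsto_integral_of_dominated_convergence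
      (fun ω => (∑ i, B * ‖indH P g 0 (t i)‖) * (c * D ω)) (fun n => ?_)
      ((hD2.integrable (by norm_num)).const_mul _) (fun n => ?_) (ae_of_all _ fun ω => ?_)
    · exact (mD.inner (hsm n)).aestronglyMeasurable
    · filter_upwards [hsb] with ω hω
      exact (norm_inner_le_norm _ _).trans (mul_le_mul (hDb ω) (hω n) (norm_nonneg _)
        ((norm_nonneg _).trans (hDb ω)))
    · exact tendsto_const_nhds.inner (hu ω)
  refine tendsto_nhds_unique ?_ r
  simp only [← M.integral_smooth_mul_riemann_sum hk μ hT hF ht]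
  have i1 := fun n j : ℕ => M.integrable_vasicekPath_mul_sub hk μ (grid_nonneg hT n j) (j * T / n)
    ((j + 1) * T / n)
  have iR : ∀ n : ℕ, Integrable (fun ω => ∑ i ∈ Finset.range n,
        (vasicekPath k μ (fun s => g s ω) ((i + 1) * T / n) -
          vasicekPath k μ (fun s => g s ω) (i * T / n)) ^ 2) P := fun n =>
    integrable_finsetSum _ fun i _ => M.integrable_sq_vasicekPath_sub hk μ (grid_nonneg hT n i)
      ((grid_nonneg hT n i).trans (grid_le hT n i))
  -- Tested against a bounded f, the sums with the quadratic correction converge by domination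
  -- (`l1`) and the correction itself tends to zero in mean (`l2`). It is needed for f = F and for f
  -- = 1.
  have lim : ∀ f : Ω → ℝ, Measurable f → ∀ b, (∀ ω, |f ω| ≤ b) → Tendsto (fun n : ℕ =>
      ∫ ω, f ω * ∑ j ∈ Finset.range n, vasicekPath k μ (fun s => g s ω) (j * T / n) *
        (g ((j + 1) * T / n) ω - g (j * T / n) ω) ∂P) atTop
      (𝓝 (∫ ω, f ω * pathIntegral k μ (vasicekPath k μ fun s => g s ω) T ∂P)) := by
    intro f hf b hfb
    have l1 : Tendsto (fun n : ℕ => ∫ ω, f ω * (∑ i ∈ Finset.range n,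
        vasicekPath k μ (fun s => g s ω) (i * T / n) *
        (g ((i + 1) * T / n) ω - g (i * T / n) ω) + 1 / 2 * ∑ i ∈ Finset.range n,
        (vasicekPath k μ (fun s => g s ω) ((i + 1) * T / n) -
          vasicekPath k μ (fun s => g s ω) (i * T / n)) ^ 2) ∂P) atTop
        (𝓝 (∫ ω, f ω * pathIntegral k μ (vasicekPath k μ fun s => g s ω) T ∂P)) := by
      refine tendsto_integral_filter_of_dominated_convergence (fun ω => b * Y ω)
        (Eventually.of_forall fun n => ?_) ?_ (hY1.const_mul b) (ae_of_all _ fun ω => ?_)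
      · exact hf.aestronglyMeasurable.mul ((integrable_finsetSum _ fun j _ =>
          i1 n j).add ((iR n).const_mul _)).aestronglyMeasurable
      · filter_upwards [eventually_gt_atTop 0] with n hn
        filter_upwards [hYb] with ω hω
        rw [norm_mul]
        exact mul_le_mul (hfb ω) (hω.1 n hn) (norm_nonneg _) ((abs_nonneg _).trans (hfb ω))
      · exact (tendsto_ito_sum hk (M.cont ω) (M.zero ω) hT).const_mul _
    have l2 : Tendsto (fun n : ℕ => ∫ ω, f ω * (1 / 2 * ∑ i ∈ Finset.range n,
        (vasicekPath k μ (fun s => g s ω) ((i + 1) * T / n) -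
          vasicekPath k μ (fun s => g s ω) (i * T / n)) ^ 2) ∂P) atTop (𝓝 0) := by
      have := (M.tendsto_integral_quadratic hk μ hT).const_mul (b * (1 / 2))
      rw [mul_zero] at this
      refine squeeze_zero_norm (fun n => ?_) this
      rw [← integral_const_mul]
      refine norm_integral_le_of_norm_le ((iR n).const_mul _) (ae_of_all _ fun ω => ?_)
      have hnn : 0 ≤ ∑ i ∈ Finset.range n, (vasicekPath k μ (fun s => g s ω) ((i + 1) * T / n) -
          vasicekPath k μ (fun s => g s ω) (i * T / n)) ^ 2 := Finset.sum_nonneg fun i _ => sq_nonneg _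
      rw [norm_mul, Real.norm_of_nonneg (by positivity : (0 : ℝ) ≤ 1 / 2 * _), mul_assoc]
      exact mul_le_mul_of_nonneg_right (hfb ω) (by positivity)
    have l3 := l1.sub l2
    rw [sub_zero] at l3
    refine l3.congr fun n => ?_
    have j1 : Integrable (fun ω => f ω * (∑ i ∈ Finset.range n,
        vasicekPath k μ (fun s => g s ω) (i * T / n) *
        (g ((i + 1) * T / n) ω - g (i * T / n) ω))) P :=
      (integrable_finsetSum _ fun j _ => i1 n j).bdd_mul (c := b) hf.aestronglyMeasurable
        (ae_of_all _ hfb)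
    have j2 : Integrable (fun ω => f ω * (1 / 2 * ∑ i ∈ Finset.range n,
        (vasicekPath k μ (fun s => g s ω) ((i + 1) * T / n) -
          vasicekPath k μ (fun s => g s ω) (i * T / n)) ^ 2)) P :=
      ((iR n).const_mul (1 / 2)).bdd_mul (c := b) hf.aestronglyMeasurable (ae_of_all _ hfb)
    simp only [mul_add (f _)]
    rw [integral_add j1 j2]
    ring
  have L1 := lim _ mF B fun ω => hb _
  have L2 := (lim (fun _ => 1) measurable_const 1 fun ω => by simp).const_mul
    (∫ ω, smoothRV g F t ω ∂P)
  simp only [one_mul] at L2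
  have e : ∫ ω, smoothRV g F t ω * (pathIntegral k μ (vasicekPath k μ fun s => g s ω) T -
          ∫ ω, pathIntegral k μ (vasicekPath k μ fun s => g s ω) T ∂P) ∂P =
      (∫ ω, smoothRV g F t ω * pathIntegral k μ (vasicekPath k μ fun s => g s ω) T ∂P) -
      (∫ ω, smoothRV g F t ω ∂P) *
        ∫ ω, pathIntegral k μ (vasicekPath k μ fun s => g s ω) T ∂P := by
    simp only [mul_sub]
    have j1 : Integrable (fun ω => smoothRV g F t ω *
        pathIntegral k μ (vasicekPath k μ fun s => g s ω) T) P :=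
      hQ.bdd_mul (c := B) mF.aestronglyMeasurable (ae_of_all _ fun ω => hb _)
    have j2 : Integrable (smoothRV g F t) P :=
      (integrable_const B).mono' mF.aestronglyMeasurable (ae_of_all _ fun ω => hb _)
    rw [integral_sub j1 (j2.mul_const _), integral_mul_const]
  rw [e]
  exact L1.sub L2

end KernelGaussian
end Existence

/-! ### Uniqueness of the Skorohod integral -/

section Uniqueness
variable {Ω : Type*} [MeasurableSpace Ω] {P : Measure Ω} [IsProbabilityMeasure P]

lemma isCbSmooth_of_hasCompactSupport {m : ℕ} {f : (Fin m → ℝ) → ℝ}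
    (hf : ContDiff ℝ ((⊤ : ℕ∞) : WithTop ℕ∞) f) (hc : HasCompactSupport f) : IsCbSmooth f :=
  ⟨hf, fun j => (hc.iteratedFDeriv (𝕜 := ℝ) j).exists_bound_of_continuous
    (hf.continuous_iteratedFDeriv (by exact_mod_cast le_top))⟩

/-- A random variable that is orthogonal to all smooth functions of a random vector has zero mean
on the events that this vector generates. -/
lemma setIntegral_preimage_eq_zero {m : ℕ} {W : Ω → Fin m → ℝ} (hW : Measurable W) {Y : Ω → ℝ}
    (hY : Integrable Y P) (h : ∀ f : (Fin m → ℝ) → ℝ, IsCbSmooth f → ∫ ω, f (W ω) * Y ω ∂P = 0)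
    {A : Set (Fin m → ℝ)} (hA : MeasurableSet A) : ∫ ω in W ⁻¹' A, Y ω ∂P = 0 := by
  have hle : MeasurableSpace.comap W inferInstance ≤ ‹MeasurableSpace Ω› := hW.comap_le
  -- The conditional expectation of Y given W factors as φ(W); orthogonality to smooth f(W) makes φ
  -- vanish almost everywhere for the law of W, as compactly supported smooth functions suffice to
  -- test it.
  obtain ⟨φ, hφ, hφe⟩ := (stronglyMeasurable_condExp (μ := P) (f := Y)
    (m := MeasurableSpace.comap W inferInstance)).exists_eq_measurable_comp
  have hci : Integrable (P[Y|MeasurableSpace.comap W inferInstance]) P := integrable_condExp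
  have hφi : Integrable φ (P.map W) := by
    rw [integrable_map_measure hφ.aestronglyMeasurable hW.aemeasurable, ← hφe]
    exact hci
  have hz : ∀ᵐ x ∂(P.map W), φ x = 0 := by
    refine ae_eq_zero_of_integral_contDiff_smul_eq_zero hφi.locallyIntegrable fun f hf hfc => ?_
    have hcb := isCbSmooth_of_hasCompactSupport hf hfc
    obtain ⟨B, hB, hb, -⟩ := hcb.exists_bound
    have hfm : StronglyMeasurable f := hcb.continuous.stronglyMeasurable
    have hfφ : StronglyMeasurable fun x => f x • φ x := hfm.smul hφ
    rw [integral_map hW.aemeasurable hfφ.aestronglyMeasurable, ← h f hcb]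
    have hfW : StronglyMeasurable[MeasurableSpace.comap W inferInstance] (f ∘ W) :=
      hfm.comp_measurable (comap_measurable W)
    have hfY : Integrable ((f ∘ W) * Y) P := hY.bdd_mul (c := B)
      (hfm.comp_measurable hW).aestronglyMeasurable (ae_of_all _ fun ω => hb _)
    have e := condExp_mul_of_stronglyMeasurable_left hfW hfY hY
    have e2 := integral_condExp (μ := P) (f := (f ∘ W) * Y) hle
    rw [integral_congr_ae e] at e2
    simp only [Pi.mul_apply, Function.comp_apply] at e2
    rw [← e2, hφe]
    rfl
  have hz' : ∀ᵐ ω ∂P, φ (W ω) = 0 := ae_of_ae_map hW.aemeasurable hz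
  rw [← setIntegral_condExp hle hY ⟨A, hA, rfl⟩, hφe]
  refine integral_eq_zero_of_ae (ae_restrict_of_ae ?_)
  exact hz'

/-- Smooth random variables are total in the square integrable functionals of `G`. -/
theorem ae_eq_zero_of_integral_smooth_mul_eq_zero {G : ℝ → Ω → ℝ} {T : ℝ}
    (hG : ∀ t ∈ Icc 0 T, Measurable (G t)) {Y : Ω → ℝ} (hY : Integrable Y P)
    (hYm : AEStronglyMeasurable[sigmaG G T] Y P)
    (h : ∀ (m : ℕ) (f : (Fin m → ℝ) → ℝ) (t : Fin m → ℝ), IsCbSmooth f → (∀ i, t i ∈ Icc 0 T) →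
      ∫ ω, smoothRV G f t ω * Y ω ∂P = 0) : Y =ᵐ[P] 0 := by
  have hle : sigmaG G T ≤ ‹MeasurableSpace Ω› := iSup₂_le fun t ht => (hG t ht).comap_le
  have hall : ∀ s, MeasurableSet[sigmaG G T] s → ∫ ω in s, Y ω ∂P = 0 := by
    intro s hs
    -- Finite intersections of events on single values of G form a π-system generating the
    -- σ-algebra; on these the previous lemma applies to a finite vector of values.
    refine MeasurableSpace.induction_on_inter (m := sigmaG G T)
      (C := fun s _ => ∫ ω in s, Y ω ∂P = 0)
      (generateFrom_piiUnionInter_measurableSet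
        (fun t => MeasurableSpace.comap (G t) inferInstance) (Icc 0 T)).symm
      (isPiSystem_piiUnionInter _
        (fun t => @MeasurableSpace.isPiSystem_measurableSet _ (MeasurableSpace.comap (G t) inferInstance))
        _) ?_ ?_ ?_ ?_ s hs
    · simp
    · rintro _ ⟨S, hS, f, hf, rfl⟩
      have hf' : ∀ x : S, ∃ A, MeasurableSet A ∧ G x ⁻¹' A = f x := fun x => hf x x.2
      choose A hA hAf using hf'
      have hW : Measurable fun ω (i : Fin S.card) => G (S.equivFin.symm i) ω :=
        measurable_pi_lambda _ fun i => hG _ (hS (S.equivFin.symm i).2)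
      have hset : (⋂ x ∈ S, f x) = (fun ω (i : Fin S.card) => G (S.equivFin.symm i) ω) ⁻¹'
          (Set.univ.pi fun i => A (S.equivFin.symm i)) := by
        ext ω
        simp only [mem_iInter, mem_preimage, Set.mem_pi, mem_univ, true_implies]
        constructor
        · intro h i
          have := h _ (S.equivFin.symm i).2
          rw [← hAf] at this
          exact this
        · intro h x hx
          have := h (S.equivFin ⟨x, hx⟩)
          rw [Equiv.symm_apply_apply] at this
          rw [← hAf ⟨x, hx⟩]
          exact this
      rw [hset]
      exact setIntegral_preimage_eq_zero hW hY
        (fun f hf => h _ f _ hf fun i => hS (S.equivFin.symm i).2)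
        (MeasurableSet.univ_pi fun i => hA _)
    · intro t ht h0
      -- The constant functional of no variables shows that Y has mean zero, which handles
      -- complements.
      have hu := h 0 (fun _ => 1) Fin.elim0 ⟨contDiff_const, fun j => by
        rcases j with - | j
        · exact ⟨1, fun x => by simp⟩
        · exact ⟨0, fun x => by simp [iteratedFDeriv_succ_const]⟩⟩ (fun i => i.elim0)
      simp only [smoothRV, one_mul] at hu
      have := integral_add_compl (hle _ ht) hY
      rw [h0, zero_add, hu] at this
      exact this
    · intro f hd hf h0
      rw [integral_iUnion (fun i => hle _ (hf i)) hd hY.integrableOn]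
      simp [h0]
  refine ae_eq_of_forall_setIntegral_eq_of_sigmaFinite' hle (fun s _ _ => hY.integrableOn)
    (fun s _ _ => integrableOn_zero) (fun s hs _ => ?_) hYm ?_
  · rw [hall s hs]; simp
  · exact ⟨_, (@stronglyMeasurable_zero _ _ (sigmaG G T) _ _), EventuallyEq.rfl⟩

/-- The Skorohod integral is unique up to null sets. -/
theorem IsSkorohodIntegral.ae_eq {G X : ℝ → Ω → ℝ} {T : ℝ}
    (hG : ∀ t ∈ Icc 0 T, Measurable (G t)) {Y Y' : Ω → ℝ} (h : IsSkorohodIntegral P G T X Y)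
    (h' : IsSkorohodIntegral P G T X Y') : Y =ᵐ[P] Y' := by
  obtain ⟨hY, hYm, u, hu, hru, hd⟩ := h
  obtain ⟨hY', hYm', u', hu', hru', hd'⟩ := h'
  have hY1 := hY.integrable (by norm_num)
  have hY1' := hY'.integrable (by norm_num)
  have huu : ∀ᵐ ω ∂P, u ω = u' ω := by
    filter_upwards [hru, hru'] with ω h1 h2 using tendsto_nhds_unique h1 h2
  have := ae_eq_zero_of_integral_smooth_mul_eq_zero (P := P) hG (Y := fun ω => Y ω - Y' ω)
    (hY1.sub hY1') (hYm.sub hYm') fun m f t hf ht => by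
      obtain ⟨B, hB, hb, -⟩ := hf.exists_bound
      have mF : AEStronglyMeasurable (smoothRV G f t) P :=
        (hf.continuous.measurable.comp (measurable_pi_lambda _ fun i => hG _ (ht i))).aestronglyMeasurable
      simp only [mul_sub]
      rw [integral_sub (hY1.bdd_mul (c := B) mF (ae_of_all _ fun ω => hb _))
        (hY1'.bdd_mul (c := B) mF (ae_of_all _ fun ω => hb _)), hd m f t hf ht, hd' m f t hf ht,
        sub_eq_zero]
      refine integral_congr_ae ?_
      filter_upwards [huu] with ω hω
      rw [hω]
  filter_upwards [this] with ω hω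
  exact sub_eq_zero.1 hω

/-- Two continuous versions of the Skorohod integral are indistinguishable. -/
theorem IsSkorohodProcess.indistinguishable {G X S S' : ℝ → Ω → ℝ}
    (hG : ∀ t, 0 ≤ t → Measurable (G t)) (h : IsSkorohodProcess P G X S)
    (h' : IsSkorohodProcess P G X S') : ∀ᵐ ω ∂P, ∀ T, 0 ≤ T → S T ω = S' T ω := by
  -- Almost sure equality holds simultaneously at countably many times, and continuity extends it to
  -- all T ≥ 0.
  have hq : ∀ᵐ ω ∂P, ∀ q : ℚ, S (max (q : ℝ) 0) ω = S' (max (q : ℝ) 0) ω := ae_all_iff.2 fun q =>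
    (h.1 _ (le_max_right _ _)).ae_eq (fun t ht => hG t ht.1) (h'.1 _ (le_max_right _ _))
  filter_upwards [hq, h.2, h'.2] with ω h1 h2 h3 T hT
  have hc : Continuous fun t : ℝ => max t 0 := by fun_prop
  have c2 : Continuous fun t : ℝ => S (max t 0) ω :=
    h2.comp_continuous hc fun t => mem_Ici.2 (le_max_right _ _)
  have c3 : Continuous fun t : ℝ => S' (max t 0) ω :=
    h3.comp_continuous hc fun t => mem_Ici.2 (le_max_right _ _)
  have := Rat.denseRange_cast (𝕜 := ℝ) |>.equalizer c2 c3 (funext h1)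
  have := congrFun this T
  simp only [max_eq_left hT] at this
  exact this

end Uniqueness

/-! ### Passing from the modification g back to G and X -/

section Transfer
variable {Ω : Type*} [MeasurableSpace Ω] {P : Measure Ω} [IsProbabilityMeasure P]

lemma indH_congr {g G : ℝ → Ω → ℝ} {a b : ℝ} (ha : g a =ᵐ[P] G a) (hb : g b =ᵐ[P] G b) :
    indH P g a b = indH P G a b := by
  have e : (fun ω => g b ω - g a ω) =ᵐ[P] fun ω => G b ω - G a ω := hb.sub ha
  unfold indH
  by_cases h : MemLp (fun ω => g b ω - g a ω) 2 P
  · rw [dif_pos h, dif_pos ((memLp_congr_ae e).1 h)]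
    exact MemLp.toLp_congr _ _ e
  · rw [dif_neg h, dif_neg fun h' => h ((memLp_congr_ae e).2 h')]

lemma stepH_congr {g G : ℝ → Ω → ℝ} (hg : ∀ t, 0 ≤ t → g t =ᵐ[P] G t) {T : ℝ} (hT : 0 ≤ T)
    {φ ψ : ℝ → ℝ} (h : ∀ t, 0 ≤ t → φ t = ψ t) : stepH P g T φ = stepH P G T ψ := by
  ext1 n
  refine Finset.sum_congr rfl fun i _ => ?_
  have h0 := grid_nonneg hT n i
  rw [h _ h0, indH_congr (hg _ h0) (hg _ (h0.trans (grid_le hT n i)))]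

namespace KernelGaussian
variable {g : ℝ → Ω → ℝ} {K : ℝ → ℝ → ℝ} {β C C' : ℝ} (M : KernelGaussian P g K β C C')
include M

/-- The elements of 𝔥 are classes in L²(P), and each smooth functional uses finitely many values of
G, so replacing g by G and the explicit path by X changes nothing outside a null set. -/
theorem isSkorohodIntegral {k : ℝ} (hk : 0 < k) (μ : ℝ) {G X : ℝ → Ω → ℝ}
    (hg : ∀ᵐ ω ∂P, ∀ t, 0 ≤ t → g t ω = G t ω)
    (hX : ∀ᵐ ω ∂P, ∀ t, 0 ≤ t → X t ω = vasicekPath k μ (fun s => g s ω) t) {T : ℝ} (hT : 0 ≤ T) :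
    IsSkorohodIntegral P G T X fun ω => pathIntegral k μ (vasicekPath k μ fun s => g s ω) T -
      ∫ ω, pathIntegral k μ (vasicekPath k μ fun s => g s ω) T ∂P := by
  have hg' : ∀ t, 0 ≤ t → g t =ᵐ[P] G t := fun t ht => by filter_upwards [hg] with ω h using h t ht
  obtain ⟨u, hu, hru, hd⟩ := M.integral_smooth_mul_pathIntegral hk μ hT
  refine ⟨(M.memLp_pathIntegral hk μ hT).sub (memLp_const _), ?_, u, hu, ?_, fun m f t hf ht => ?_⟩
  · have h1 : AEStronglyMeasurable[sigmaG G T]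
        (fun ω => pathIntegral k μ (vasicekPath k μ fun s => g s ω) T) P := by
      refine aestronglyMeasurable_pathIntegral M.cont M.zero hk μ hT fun s hs => ?_
      refine ⟨G s, ?_, hg' s hs.1⟩
      have hm : Measurable[sigmaG G T] (G s) :=
        Measurable.mono (comap_measurable (G s)) (le_iSup₂_of_le s hs le_rfl) le_rfl
      exact hm.stronglyMeasurable
    exact h1.sub ⟨_, (@stronglyMeasurable_const _ _ (sigmaG G T) _ _), EventuallyEq.rfl⟩
  · filter_upwards [hX] with ω hω
    unfold RepresentsH
    rw [← stepH_congr hg' hT fun t ht => (hω t ht).symm]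
    exact hru ω
  · have e1 : ∀ᵐ ω ∂P, (fun i => G (t i) ω) = fun i => g (t i) ω := by
      filter_upwards [hg] with ω hω
      ext i
      exact (hω _ (ht i).1).symm
    refine Eq.trans ?_ ((hd m f t hf ht).trans ?_)
    · refine integral_congr_ae ?_
      filter_upwards [e1] with ω hω
      simp only [smoothRV, hω]
    · refine integral_congr_ae ?_
      filter_upwards [e1] with ω hω
      simp only [malliavinD, hω, indH_congr (hg' 0 le_rfl) (hg' _ (ht _).1)]

end KernelGaussian
end Transfer

/-! ### Limits of the estimators along a fixed path -/

section PathLimits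

variable {k μ β C σ : ℝ} {x J : ℝ → ℝ}

lemma tendsto_muHat (hA : Tendsto (fun T => (∫ t in 0..T, x t) / T) atTop (𝓝 μ)) :
    Tendsto (muHat x) atTop (𝓝 μ) := by
  refine hA.congr fun T => ?_
  rw [muHat]; ring

lemma tendsto_kHat (hk : 0 < k) (hβ : 1 / 2 < β) (hC : 0 < C)
    (hA : Tendsto (fun T => (∫ t in 0..T, x t) / T) atTop (𝓝 μ))
    (hB : Tendsto (fun T => (∫ t in 0..T, x t ^ 2) / T) atTop
      (𝓝 (μ ^ 2 + C * (Real.Gamma (2 * β - 1) * k ^ (-(2 * β)))))) :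
    Tendsto (kHat β C x) atTop (𝓝 k) := by
  have hΓ : 0 < Real.Gamma (2 * β - 1) := Real.Gamma_pos_of_pos (by linarith)
  have h1 := (hB.sub (hA.pow 2)).div_const (C * Real.Gamma (2 * β - 1))
  have e : (μ ^ 2 + C * (Real.Gamma (2 * β - 1) * k ^ (-(2 * β))) - μ ^ 2) /
      (C * Real.Gamma (2 * β - 1)) = k ^ (-(2 * β)) := by field_simp; ring
  rw [e] at h1
  have h2 := h1.rpow_const (p := -(1 / (2 * β))) (Or.inl (by positivity))
  have e2 : (k ^ (-(2 * β))) ^ (-(1 / (2 * β))) = k := by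
    rw [← Real.rpow_mul hk.le]
    have : -(2 * β) * -(1 / (2 * β)) = 1 := by field_simp
    rw [this, Real.rpow_one]
  rw [e2] at h2
  refine h2.congr fun T => ?_
  rw [kHat]
  congr 2
  ring

lemma tendsto_div_of_sq_div {x : ℝ → ℝ} (h : Tendsto (fun T => x T ^ 2 / T) atTop (𝓝 0)) :
    Tendsto (fun T => x T / T) atTop (𝓝 0) := by
  have h1 := (h.mul tendsto_inv_atTop_zero).sqrt
  rw [mul_zero, Real.sqrt_zero] at h1
  refine (tendsto_zero_iff_abs_tendsto_zero _).2 (h1.congr fun T => ?_)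
  rw [Function.comp_apply, ← Real.sqrt_sq_eq_abs]
  congr 1
  simp only [div_eq_mul_inv]
  ring

/-- Numerator and denominator are divided by T². The product of X_T/T with the average of X
vanishes, leaving kσ over σ. -/
lemma tendsto_kHatLS (hσ : 0 < σ)
    (hA : Tendsto (fun T => (∫ t in 0..T, x t) / T) atTop (𝓝 μ))
    (hB : Tendsto (fun T => (∫ t in 0..T, x t ^ 2) / T) atTop (𝓝 (μ ^ 2 + σ)))
    (hx : Tendsto (fun T => x T ^ 2 / T) atTop (𝓝 0))
    (hJ : Tendsto (fun T => J T / T) atTop (𝓝 (-(k * σ)))) :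
    Tendsto (kHatLS x J) atTop (𝓝 k) := by
  have h1 := (((tendsto_div_of_sq_div hx).mul hA).sub hJ).div (hB.sub (hA.pow 2))
    (by simpa using hσ.ne')
  have e : (0 * μ - -(k * σ)) / (μ ^ 2 + σ - μ ^ 2) = k := by
    rw [add_sub_cancel_left]; field_simp; ring
  rw [e] at h1
  refine h1.congr' ?_
  filter_upwards [eventually_gt_atTop 0] with T hT
  have hT2 : T ^ 2 ≠ 0 := by positivity
  rw [kHatLS, Pi.div_apply, ← mul_div_mul_right _ _ hT2]
  congr 1 <;> field_simp

/-- After division by T² the terms with X_T/T vanish and the quotient is kσμ over kσ; here the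
denominator requires kσ ≠ 0. -/
lemma tendsto_muHatLS (hk : 0 < k) (hσ : 0 < σ)
    (hA : Tendsto (fun T => (∫ t in 0..T, x t) / T) atTop (𝓝 μ))
    (hB : Tendsto (fun T => (∫ t in 0..T, x t ^ 2) / T) atTop (𝓝 (μ ^ 2 + σ)))
    (hx : Tendsto (fun T => x T ^ 2 / T) atTop (𝓝 0))
    (hJ : Tendsto (fun T => J T / T) atTop (𝓝 (-(k * σ)))) :
    Tendsto (muHatLS x J) atTop (𝓝 μ) := by
  have h0 := tendsto_div_of_sq_div hx
  have h1 := ((h0.mul hB).sub (hJ.mul hA)).div ((h0.mul hA).sub hJ)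
    (by simpa using ⟨hk.ne', hσ.ne'⟩)
  have e : (0 * (μ ^ 2 + σ) - -(k * σ) * μ) / (0 * μ - -(k * σ)) = μ := by
    field_simp; ring
  rw [e] at h1
  refine h1.congr' ?_
  filter_upwards [eventually_gt_atTop 0] with T hT
  have hT2 : T ^ 2 ≠ 0 := by positivity
  rw [muHatLS, Pi.div_apply, ← mul_div_mul_right _ _ hT2]
  congr 1 <;> field_simp

lemma tendsto_exp_neg {k : ℝ} (hk : 0 < k) :
    Tendsto (fun t : ℝ => Real.exp (-(k * t))) atTop (𝓝 0) :=
  Real.tendsto_exp_neg_atTop_nhds_zero.comp (tendsto_id.const_mul_atTop hk)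

lemma tendsto_meanPath {k : ℝ} (hk : 0 < k) (μ : ℝ) : Tendsto (meanPath k μ) atTop (𝓝 μ) := by
  have := ((tendsto_exp_neg hk).const_sub 1).const_mul μ
  rwa [sub_zero, mul_one] at this

variable {a : ℝ → ℝ}

lemma tendsto_average_vasicekPath (hk : 0 < k) (μ : ℝ) (ha : Continuous a)
    (h1 : Tendsto (fun T => (∫ t in 0..T, ou k a t) / T) atTop (𝓝 0)) :
    Tendsto (fun T => (∫ t in 0..T, vasicekPath k μ a t) / T) atTop (𝓝 μ) := by
  have hm := continuous_meanPath k μ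
  have hz := continuous_ou k ha
  have h2 := (tendsto_cesaro (fun T _ => hm.intervalIntegrable 0 T) (tendsto_meanPath hk μ)).add h1
  rw [add_zero] at h2
  refine h2.congr fun T => ?_
  simp only [vasicekPath]
  rw [intervalIntegral.integral_add (hm.intervalIntegrable 0 T) (hz.intervalIntegrable 0 T), add_div]

lemma tendsto_sq_vasicekPath_div (hk : 0 < k) (μ : ℝ)
    (h3 : Tendsto (fun t => ou k a t ^ 2 / t) atTop (𝓝 0)) :
    Tendsto (fun T => vasicekPath k μ a T ^ 2 / T) atTop (𝓝 0) := by
  have h4 := (h3.const_mul 2).add (((tendsto_meanPath hk μ).pow 2 |>.const_mul 2).div_atTop tendsto_id)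
  rw [mul_zero, add_zero] at h4
  refine squeeze_zero' ?_ ?_ h4
  · filter_upwards [eventually_gt_atTop 0] with T hT
    positivity
  · filter_upwards [eventually_gt_atTop 0] with T hT
    have : vasicekPath k μ a T ^ 2 ≤ 2 * ou k a T ^ 2 + 2 * meanPath k μ T ^ 2 := by
      rw [vasicekPath]; nlinarith [sq_nonneg (meanPath k μ T - ou k a T)]
    calc _ ≤ (2 * ou k a T ^ 2 + 2 * meanPath k μ T ^ 2) / T := by gcongr
      _ = _ := by simp only [id]; ring

/-- Expand X² = m² - 2μe^{-kt}Z + 2μZ + Z². The first two terms converge pointwise to μ², the third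
averages to zero, the last to σ. -/
lemma tendsto_average_sq_vasicekPath (hk : 0 < k) (μ : ℝ) (ha : Continuous a)
    (h1 : Tendsto (fun T => (∫ t in 0..T, ou k a t) / T) atTop (𝓝 0))
    (h2 : Tendsto (fun T => (∫ t in 0..T, ou k a t ^ 2) / T) atTop (𝓝 σ))
    (h3 : Tendsto (fun t => ou k a t ^ 2 / t) atTop (𝓝 0)) :
    Tendsto (fun T => (∫ t in 0..T, vasicekPath k μ a t ^ 2) / T) atTop (𝓝 (μ ^ 2 + σ)) := by
  have hm := continuous_meanPath k μ
  have hz := continuous_ou k ha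
  -- The square is (Z²/t) · t e^{-2kt}, a product of two null functions.
  have hez : Tendsto (fun t => Real.exp (-(k * t)) * ou k a t) atTop (𝓝 0) := by
    have h5 := (Real.tendsto_pow_mul_exp_neg_atTop_nhds_zero 1).comp
      (tendsto_id.const_mul_atTop (by positivity : 0 < 2 * k))
    have h7 := (h3.mul (h5.const_mul (1 / (2 * k)))).sqrt
    simp only [mul_zero, Real.sqrt_zero] at h7
    refine (tendsto_zero_iff_abs_tendsto_zero _).2 (h7.congr' ?_)
    filter_upwards [eventually_gt_atTop 0] with t ht
    simp only [Function.comp, id, pow_one]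
    rw [← Real.sqrt_sq_eq_abs (Real.exp _ * _)]
    congr 1
    have e : Real.exp (-(2 * k * t)) = Real.exp (-(k * t)) ^ 2 := by
      rw [← Real.exp_nat_mul]; congr 1; push_cast; ring
    rw [e]
    field_simp
  have hr : Tendsto (fun t => meanPath k μ t ^ 2 + 2 * (-μ * (Real.exp (-(k * t)) * ou k a t))) atTop
      (𝓝 (μ ^ 2)) := by
    have := ((tendsto_meanPath hk μ).pow 2).add ((hez.const_mul (-μ)).const_mul 2)
    simpa using this
  have hrc : Continuous fun t => meanPath k μ t ^ 2 + 2 * (-μ * (Real.exp (-(k * t)) * ou k a t)) := by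
    fun_prop
  have h8 := ((tendsto_cesaro (fun T _ => hrc.intervalIntegrable 0 T) hr).add
    (h1.const_mul (2 * μ))).add h2
  rw [mul_zero, add_zero] at h8
  refine h8.congr fun T => ?_
  have e : ∀ t, vasicekPath k μ a t ^ 2 = meanPath k μ t ^ 2 +
      2 * (-μ * (Real.exp (-(k * t)) * ou k a t)) + 2 * μ * ou k a t + ou k a t ^ 2 := fun t => by
    rw [vasicekPath, meanPath]; ring
  have hz2 : Continuous fun t => ou k a t ^ 2 := hz.pow 2
  simp only [e]
  rw [intervalIntegral.integral_add ((hrc.intervalIntegrable 0 T).add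
      ((hz.intervalIntegrable 0 T).const_mul (2 * μ))) (hz2.intervalIntegrable 0 T),
    intervalIntegral.integral_add (hrc.intervalIntegrable 0 T)
      ((hz.intervalIntegrable 0 T).const_mul (2 * μ)), intervalIntegral.integral_const_mul]
  ring

lemma abs_pathIntegral_le (hk : 0 < k) (ha : Continuous a) (ha0 : a 0 = 0) {T : ℝ} (hT : 0 ≤ T)
    {D : ℝ} (hD : ∀ t ∈ Icc 0 T, |vasicekPath k μ a t| ≤ D) :
    |pathIntegral k μ (vasicekPath k μ a) T| ≤ D ^ 2 / 2 + D * (k * (|μ| + D) * T) := by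
  refine le_of_tendsto (tendsto_ito_sum hk ha ha0 hT).abs ?_
  filter_upwards [eventually_gt_atTop 0] with n hn using abs_ito_sum_le hk ha ha0 hT hD hn

lemma continuous_pathIntegral (k μ : ℝ) {x : ℝ → ℝ} (hx : Continuous x) :
    Continuous (pathIntegral k μ x) := by
  have := continuous_primitive' (a := fun t => x t * (k * (μ - x t))) (by fun_prop)
  unfold pathIntegral
  fun_prop

end PathLimits

/-! ### The mean of the pathwise integral -/

section Mean
variable {Ω : Type*} [MeasurableSpace Ω] {P : Measure Ω} [IsProbabilityMeasure P]

lemma integral_time_integral {W : ℝ → Ω → ℝ} (hW : Measurable (Function.uncurry W)) {T : ℝ}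
    {Y : Ω → ℝ} (hY : Integrable Y P) (hdom : ∀ᵐ ω ∂P, ∀ t ∈ Icc 0 T, |W t ω| ≤ Y ω) :
    IntegrableOn (fun t => ∫ ω, W t ω ∂P) (Ioc 0 T) ∧
    Integrable (fun ω => ∫ t in Ioc 0 T, W t ω) P ∧
    ∫ ω, (∫ t in Ioc 0 T, W t ω) ∂P = ∫ t in Ioc 0 T, ∫ ω, W t ω ∂P := by
  have hm : Measurable fun q : Ω × ℝ => W q.2 q.1 := hW.comp measurable_swap
  have hint : Integrable (fun q : Ω × ℝ => W q.2 q.1) (P.prod (volume.restrict (Ioc 0 T))) := by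
    have hb : Integrable (fun q : Ω × ℝ => Y q.1 * 1) (P.prod (volume.restrict (Ioc 0 T))) :=
      hY.mul_prod (integrable_const 1)
    refine hb.mono' hm.aestronglyMeasurable ?_
    have h1 : ∀ᵐ q : Ω × ℝ ∂(P.prod (volume.restrict (Ioc 0 T))),
        ∀ t ∈ Icc 0 T, |W t q.1| ≤ Y q.1 := Measure.quasiMeasurePreserving_fst.ae hdom
    have h2 : ∀ᵐ q : Ω × ℝ ∂(P.prod (volume.restrict (Ioc 0 T))), q.2 ∈ Ioc 0 T :=
      Measure.quasiMeasurePreserving_snd.ae (ae_restrict_mem measurableSet_Ioc)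
    filter_upwards [h1, h2] with q hq1 hq2
    rw [mul_one]
    exact hq1 _ (Ioc_subset_Icc_self hq2)
  exact ⟨hint.integral_prod_right, hint.integral_prod_left, integral_integral_swap hint⟩

namespace KernelGaussian
variable {g : ℝ → Ω → ℝ} {K : ℝ → ℝ → ℝ} {β C C' : ℝ} (M : KernelGaussian P g K β C C')
include M

lemma centered_ou {k : ℝ} (hk : 0 < k) {t : ℝ} (ht : 0 ≤ t) :
    ∫ ω, ou k (fun s => g s ω) t ∂P = 0 := by
  obtain ⟨Y, hY, -, h⟩ := M.exists_dominating_ou hk t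
  have : Tendsto (fun n => ∫ ω, ouSum k (fun s => g s ω) t n ∂P) atTop
      (𝓝 (∫ ω, ou k (fun s => g s ω) t ∂P)) := by
    refine tendsto_integral_of_dominated_convergence Y (fun n => ?_) (hY.integrable (by norm_num))
      (fun n => ?_) (ae_of_all _ fun ω => tendsto_ouSum k (M.cont ω) (M.zero ω) ht)
    · exact (M.measurable_of_span (M.ouSum_mem_span k t n)).aestronglyMeasurable
    · filter_upwards [h] with ω hω
      exact (hω t ⟨ht, le_rfl⟩).2.2 n
  refine tendsto_nhds_unique this ?_
  simp only [M.centered_of_span (M.ouSum_mem_span k t _)]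
  exact tendsto_const_nhds

lemma integral_vasicekPath {k : ℝ} (hk : 0 < k) (μ : ℝ) {t : ℝ} (ht : 0 ≤ t) :
    ∫ ω, vasicekPath k μ (fun s => g s ω) t ∂P = meanPath k μ t := by
  simp only [vasicekPath]
  rw [integral_add (integrable_const _) ((M.memLp_ou hk ht).integrable (by norm_num)),
    M.centered_ou hk ht]
  simp

lemma integral_sq_vasicekPath {k : ℝ} (hk : 0 < k) (μ : ℝ) {t : ℝ} (ht : 0 ≤ t) :
    ∫ ω, vasicekPath k μ (fun s => g s ω) t ^ 2 ∂P = meanPath k μ t ^ 2 + ouCov P g k t t := by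
  have i1 := (M.memLp_ou hk ht).integrable (by norm_num)
  have i2 : Integrable (fun ω => ou k (fun s => g s ω) t * ou k (fun s => g s ω) t) P :=
    ((M.memLp_ou hk ht).mono_exponent (p := 2) (by norm_num)).integrable_mul
      ((M.memLp_ou hk ht).mono_exponent (p := 2) (by norm_num))
  have e : ∀ ω, vasicekPath k μ (fun s => g s ω) t ^ 2 = meanPath k μ t ^ 2 +
      2 * meanPath k μ t * ou k (fun s => g s ω) t +
      ou k (fun s => g s ω) t * ou k (fun s => g s ω) t := fun ω => by rw [vasicekPath]; ring
  simp only [e]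
  rw [integral_add_add (integrable_const _) (i1.const_mul _) i2, integral_const_mul,
    M.centered_ou hk ht, ouCov]
  simp

lemma measurable_uncurry_vasicekPath (k μ : ℝ) :
    Measurable (Function.uncurry fun t ω => vasicekPath k μ (fun s => g s ω) (max t 0)) := by
  refine measurable_uncurry_of_continuous_of_measurable (fun ω => ?_)
    fun t => M.measurable_vasicekPath k μ (le_max_right _ _)
  exact (continuous_vasicekPath k μ (M.cont ω)).comp (by fun_prop)

/-- The mean of the pathwise part of the Skorohod integral grows linearly. -/
theorem tendsto_integral_pathIntegral_div {k : ℝ} (hk : 0 < k) (μ : ℝ) :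
    Tendsto (fun T => (∫ ω, pathIntegral k μ (vasicekPath k μ fun s => g s ω) T ∂P) / T) atTop
      (𝓝 (k * (C * (Real.Gamma (2 * β - 1) * k ^ (-(2 * β)))))) := by
  set σ := C * (Real.Gamma (2 * β - 1) * k ^ (-(2 * β)))
  have hx := M.measurable_uncurry_vasicekPath k μ
  set W : ℝ → Ω → ℝ := fun t ω => vasicekPath k μ (fun s => g s ω) (max t 0) *
    (k * (μ - vasicekPath k μ (fun s => g s ω) (max t 0))) with hWdef
  have hW : Measurable (Function.uncurry W) := hx.mul ((hx.const_sub μ).const_mul k)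
  have hfub : ∀ T, 0 ≤ T → IntegrableOn (fun t => ∫ ω, W t ω ∂P) (Ioc 0 T) ∧
      Integrable (fun ω => ∫ t in Ioc 0 T, W t ω) P ∧
      ∫ ω, (∫ t in Ioc 0 T, W t ω) ∂P = ∫ t in Ioc 0 T, ∫ ω, W t ω ∂P := fun T hT => by
    obtain ⟨D, hD, hD1, h⟩ := M.exists_dominating_vasicekPath hk μ T
    have hD2 : MemLp D 2 P := hD.mono_exponent (by norm_num)
    refine integral_time_integral hW (Y := fun ω => D ω * (k * (|μ| + D ω)))
      (hD2.integrable_mul (((memLp_const |μ|).add hD2).const_mul k)) ?_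
    filter_upwards [h] with ω hω t ht
    have h1 := hω t ht
    simp only [hWdef]
    rw [max_eq_left ht.1, abs_mul, abs_mul, abs_of_pos hk]
    have h2 := (abs_sub μ (vasicekPath k μ (fun s => g s ω) t)).trans (add_le_add le_rfl h1)
    exact mul_le_mul h1 (mul_le_mul_of_nonneg_left h2 hk.le) (by positivity) (by linarith [hD1 ω])
  have hw : ∀ t, 0 ≤ t → ∫ ω, W t ω ∂P =
      k * (μ * meanPath k μ t - (meanPath k μ t ^ 2 + ouCov P g k t t)) := fun t ht => by
    have i4 := M.memLp_vasicekPath hk μ ht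
    have i1 := i4.integrable (by norm_num)
    have i2 := (i4.mono_exponent (q := 4) (p := 2) (by norm_num)).integrable_sq
    rw [← M.integral_sq_vasicekPath hk μ ht, ← M.integral_vasicekPath hk μ ht, ← integral_const_mul,
      ← integral_sub (i1.const_mul μ) i2, ← integral_const_mul]
    congr 1
    ext ω
    simp only [hWdef]
    rw [max_eq_left ht]
    ring
  -- In the limit E[X k(μ-X)] becomes k(μ·μ - (μ²+σ)) = -kσ; the term E[X_T²]/2 is bounded and
  -- disappears after division by T.
  have hwl : Tendsto (fun t => ∫ ω, W t ω ∂P) atTop (𝓝 (-(k * σ))) := by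
    have h1 := (((tendsto_meanPath hk μ).const_mul μ).sub
      (((tendsto_meanPath hk μ).pow 2).add (M.tendsto_ouCov_self hk))).const_mul k
    have e : k * (μ * μ - (μ ^ 2 + σ)) = -(k * σ) := by ring
    rw [e] at h1
    refine h1.congr' ?_
    filter_upwards [eventually_ge_atTop 0] with t ht using (hw t ht).symm
  have hces := tendsto_cesaro (fun T hT =>
    (intervalIntegrable_iff_integrableOn_Ioc_of_le hT).2 (hfub T hT).1) hwl
  have hsq := ((((tendsto_meanPath hk μ).pow 2).add (M.tendsto_ouCov_self hk)).div_const 2).div_atTop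
    tendsto_id
  have hfin := hsq.sub hces
  rw [zero_sub, neg_neg] at hfin
  refine hfin.congr' ?_
  filter_upwards [eventually_gt_atTop 0] with T hT
  obtain ⟨f1, f2, f3⟩ := hfub T hT.le
  have e : ∀ ω, pathIntegral k μ (vasicekPath k μ fun s => g s ω) T =
      vasicekPath k μ (fun s => g s ω) T ^ 2 / 2 - ∫ t in Ioc 0 T, W t ω := fun ω => by
    rw [pathIntegral, intervalIntegral.integral_of_le hT.le]
    congr 1
    refine setIntegral_congr_fun measurableSet_Ioc fun t ht => ?_
    simp only [hWdef]
    rw [max_eq_left ht.1.le]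
  have i2 := ((M.memLp_vasicekPath hk μ hT.le).mono_exponent (q := 4) (p := 2)
    (by norm_num)).integrable_sq
  simp only [e]
  rw [integral_sub (i2.div_const 2) f2, integral_div, M.integral_sq_vasicekPath hk μ hT.le, f3,
    intervalIntegral.integral_of_le hT.le, sub_div, id]

/-- The continuous version of the Skorohod process subtracts this mean, so its paths are continuous
only if the mean is. -/
lemma continuousOn_integral_pathIntegral {k : ℝ} (hk : 0 < k) (μ : ℝ) :
    ContinuousOn (fun T => ∫ ω, pathIntegral k μ (vasicekPath k μ fun s => g s ω) T ∂P) (Ici 0) := by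
  intro T₀ hT₀
  obtain ⟨D, hD, hD1, h⟩ := M.exists_dominating_vasicekPath hk μ (T₀ + 1)
  have hD2 : MemLp D 2 P := hD.mono_exponent (by norm_num)
  have hT1 : 0 ≤ T₀ + 1 := by linarith [mem_Ici.1 hT₀]
  refine tendsto_integral_filter_of_dominated_convergence
    (fun ω => D ω ^ 2 / 2 + D ω * (k * (|μ| + D ω) * (T₀ + 1))) ?_ ?_ ?_ ?_
  · filter_upwards [self_mem_nhdsWithin] with T hT
    exact (M.memLp_pathIntegral hk μ hT).aestronglyMeasurable
  · filter_upwards [self_mem_nhdsWithin, mem_nhdsWithin_of_mem_nhds (Iio_mem_nhds (lt_add_one T₀))]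
      with T hT hT'
    filter_upwards [h] with ω hω
    have hD0 : 0 ≤ D ω := by linarith [hD1 ω]
    refine (abs_pathIntegral_le hk (M.cont ω) (M.zero ω) (mem_Ici.1 hT) fun t ht =>
      hω t ⟨ht.1, ht.2.trans (mem_Iio.1 hT').le⟩).trans ?_
    have := (mem_Iio.1 hT').le
    gcongr
  · exact (hD2.integrable_sq.div_const 2).add
      (hD2.integrable_mul ((((memLp_const |μ|).add hD2).const_mul k).mul_const (T₀ + 1)))
  · exact ae_of_all _ fun ω =>
      (continuous_pathIntegral k μ (continuous_vasicekPath k μ (M.cont ω))).continuousWithinAt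

end KernelGaussian
end Mean
end Vasicek

/-! ### Strong consistency of the four estimators -/

theorem theorem1 {Ω : Type*} [MeasurableSpace Ω] (P : Measure Ω) [IsProbabilityMeasure P]
    (G : ℝ → Ω → ℝ) (hG : Vasicek.IsContCenteredGaussian P G)
    (β C C' : ℝ) (Ψ : ℝ → ℝ → ℝ)
    (hR : Vasicek.CovAssumption (Vasicek.covFun P G) β C C' Ψ)
    (k μ : ℝ) (hk : 0 < k)
    (X : ℝ → Ω → ℝ) (hX : Vasicek.IsVasicekSolution P G k μ X) :
    (∀ᵐ ω ∂P, Tendsto (Vasicek.muHat (fun t => X t ω)) atTop (𝓝 μ)) ∧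
    (∀ᵐ ω ∂P, Tendsto (Vasicek.kHat β C (fun t => X t ω)) atTop (𝓝 k)) ∧
    (∃ S : ℝ → Ω → ℝ, Vasicek.IsSkorohodProcess P G X S) ∧
    ∀ S : ℝ → Ω → ℝ, Vasicek.IsSkorohodProcess P G X S →
      (∀ᵐ ω ∂P, Tendsto (Vasicek.muHatLS (fun t => X t ω)
        (Vasicek.intXdX k μ (fun t => X t ω) (fun T => S T ω))) atTop (𝓝 μ)) ∧
      (∀ᵐ ω ∂P, Tendsto (Vasicek.kHatLS (fun t => X t ω)
        (Vasicek.intXdX k μ (fun t => X t ω) (fun T => S T ω))) atTop (𝓝 k)) := by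
  obtain ⟨g, M, hg⟩ := Vasicek.exists_kernelGaussian hG hR
  have hσ : 0 < C * (Real.Gamma (2 * β - 1) * k ^ (-(2 * β))) := by
    have := hR.half_lt
    have h1 : 0 < Real.Gamma (2 * β - 1) := Real.Gamma_pos_of_pos (by linarith)
    have h2 := hR.C_pos
    positivity
  have hXg : ∀ᵐ ω ∂P, ∀ t, 0 ≤ t → X t ω = Vasicek.vasicekPath k μ (fun s => g s ω) t := by
    filter_upwards [hX, hg] with ω h1 h2 t ht
    refine Vasicek.solution_eq hk (M.cont ω) h1.1 (fun s hs => ?_) ht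
    rw [h1.2.2 s hs, ← h2 s hs, ← h2 0 le_rfl, M.zero, sub_zero]
  have hpath : ∀ᵐ ω ∂P,
      Tendsto (fun T => (∫ t in (0 : ℝ)..T, X t ω) / T) atTop (𝓝 μ) ∧
      Tendsto (fun T => (∫ t in (0 : ℝ)..T, X t ω ^ 2) / T) atTop
        (𝓝 (μ ^ 2 + C * (Real.Gamma (2 * β - 1) * k ^ (-(2 * β))))) ∧
      Tendsto (fun T => X T ω ^ 2 / T) atTop (𝓝 0) := by
    filter_upwards [hXg, M.tendsto_time_average hk, M.tendsto_ou_sq_div_atTop hk] with ω h1 h2 h3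
    refine ⟨?_, ?_, ?_⟩
    · refine (Vasicek.tendsto_average_vasicekPath hk μ (M.cont ω) h2.1).congr' ?_
      filter_upwards [eventually_ge_atTop 0] with T hT
      rw [intervalIntegral.integral_congr fun t ht => ?_]
      rw [uIcc_of_le hT] at ht
      exact (h1 t ht.1).symm
    · refine (Vasicek.tendsto_average_sq_vasicekPath hk μ (M.cont ω) h2.1 h2.2 h3).congr' ?_
      filter_upwards [eventually_ge_atTop 0] with T hT
      rw [intervalIntegral.integral_congr fun t ht => ?_]
      rw [uIcc_of_le hT] at ht
      simp only [h1 t ht.1]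
    · refine (Vasicek.tendsto_sq_vasicekPath_div hk μ h3).congr' ?_
      filter_upwards [eventually_ge_atTop 0] with T hT
      rw [h1 T hT]
  set S₀ : ℝ → Ω → ℝ := fun T ω =>
    Vasicek.pathIntegral k μ (Vasicek.vasicekPath k μ fun s => g s ω) T -
      ∫ ω, Vasicek.pathIntegral k μ (Vasicek.vasicekPath k μ fun s => g s ω) T ∂P with hS₀
  have hS₀p : Vasicek.IsSkorohodProcess P G X S₀ :=
    ⟨fun T hT => M.isSkorohodIntegral hk μ hg hXg hT, ae_of_all _ fun ω =>
      (Vasicek.continuous_pathIntegral k μ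
        (Vasicek.continuous_vasicekPath k μ (M.cont ω))).continuousOn.sub
        (M.continuousOn_integral_pathIntegral hk μ)⟩
  refine ⟨?_, ?_, ⟨S₀, hS₀p⟩, fun S hS => ?_⟩
  · filter_upwards [hpath] with ω h using Vasicek.tendsto_muHat h.1
  · filter_upwards [hpath] with ω h
    exact Vasicek.tendsto_kHat hk hR.half_lt hR.C_pos h.1 h.2.1
  -- The drift integrals in `intXdX` and in the pathwise integral cancel, leaving X_T²/2 minus the
  -- mean of the pathwise integral; divided by T this tends to -kσ.
  have hJ : ∀ᵐ ω ∂P, Tendsto (fun T => Vasicek.intXdX k μ (fun t => X t ω) (fun T => S T ω) T / T)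
      atTop (𝓝 (-(k * (C * (Real.Gamma (2 * β - 1) * k ^ (-(2 * β))))))) := by
    filter_upwards [hpath, hXg, hS.indistinguishable hG.measurable hS₀p] with ω h h1 h2
    have h3 := (h.2.2.div_const 2).sub (M.tendsto_integral_pathIntegral_div hk μ)
    rw [zero_div, zero_sub] at h3
    refine h3.congr' ?_
    filter_upwards [eventually_gt_atTop 0] with T hT
    have e : ∫ t in (0 : ℝ)..T, X t ω * (k * (μ - X t ω)) =
        ∫ t in (0 : ℝ)..T, Vasicek.vasicekPath k μ (fun s => g s ω) t *
          (k * (μ - Vasicek.vasicekPath k μ (fun s => g s ω) t)) := by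
      refine intervalIntegral.integral_congr fun t ht => ?_
      rw [uIcc_of_le hT.le] at ht
      simp only [h1 t ht.1]
    rw [Vasicek.intXdX, e, h2 T hT.le, h1 T hT.le]
    simp only [hS₀, Vasicek.pathIntegral]
    ring
  constructor
  · filter_upwards [hpath, hJ] with ω h1 h2
    exact Vasicek.tendsto_muHatLS hk hσ h1.1 h1.2.1 h1.2.2 h2
  · filter_upwards [hpath, hJ] with ω h1 h2
    exact Vasicek.tendsto_kHatLS hσ h1.1 h1.2.1 h1.2.2 h2
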